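/- **Setting.** Let $\kappa$ be the security parameter. All lengths below are efficiently computable (polynomially bounded) functions of $\kappa$. Fix a pattern $\pi$, a key derivation function $\delta(k,t)=(k^{Enc}_t,k^{Mac}_t)$ with $k,k^{Enc}_t,k^{Mac}_t\in\{0,1\}^\kappa$, a generator $\rho$ on $\{0,1\}^\kappa$, a message authentication code $\mu$ with tags in $\{0,1\}^\kappa$, and a family of permutations $\sigma$ of the $l$ slots of a routing vector, indexed by seeds; all are computable in polynomial time. A packet consists of a clear header (address of the next node and pointer to its slot) and a body $X$, i.e. a routing vector of $l$ slots followed by a payload of fixed length. The output of $\rho$ has the form $\rho=\rho_r\,|\,\rho_{Packet}$, where $\rho_r$ has the length of a slot and $\rho_{Packet}$ has the length of a body; $\rho_{Header}$ is the part of $\rho_{Packet}$ that covers the routing vector. **Ariadne.** To send the packet with index $t$ along the nodes $N_1,\dots,N_{n+1}$ (with $n+1\le l$), whose master keys shared with the source $N_0$ are $k_1,\dots,k_{n+1}$, the source derives $\rho_i=\rho(k^{Enc}_{i,t})$ and $k^{Mac}_{i,t}$ from $\delta(k_i,t)$, picks slots $p_1,\dots,p_{n+1}$ by the pseudo-random permutation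 with a fresh seed, and picks a uniformly random routing vector $R$. For $i=1,\dots,n+1$ it writes $\pi|Addr_{i+1}|p_{i+1}|0_\kappa$ into slot $p_i$ of $R$ and replaces $R$ by $R\oplus\rho_{i,Header}$ (the last node gets its own address and slot). It sets $X=R\,|\,\text{payload}$, and for $i=n+1,\dots,1$ replaces $X$ by $X\oplus\rho_{i,Packet}$, computes $\gamma_i=\mu(k^{Mac}_{i,t};X)$ and writes $(\pi|Addr_{i+1}|p_{i+1}|\gamma_i)\oplus\rho_{i,r}$ into slot $p_i$ of $X$. The packet is $(Addr_1,p_1,X)$. A node that receives a packet looks up the encrypted pattern found in the indicated slot in its table of the strings $\pi\oplus\rho_{t,\pi}$ ($t$ below a polynomial bound $T$; $\rho_{t,\pi}$ is the initial part of $\rho(k^{Enc}_t)$ of length $|\pi|$), unmasks the slot with $\rho_r$, sets the tag field in it to zero, checks the tag with $\mu$, replaces $X$ by $X\oplus\rho_{Packet}$ and puts the address and pointer read from the slot into the header. It drops the packet if one of these steps fails. **Path-session unlinkability game (class $\mathcal A_2$).** (1) The adversary receives the name of an honest node $N_j$ (an efficiently computable function of $\kappa$), whose master key $k_j$ is uniformly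 random. (2) It adaptively submits packets and gets the results of their processing by $N_j$. (3) It submits payloads $p_1,p_2$, an index $t$ with $t+1<T$, a path $\mathcal P=(N_0,N_1,\dots,N_j,\dots,N_{n+1})$ and a path $\mathcal P'$ that has other nodes $N'_1,\dots,N'_{k-1}$ (of possibly different number) before $N_j$ and the same nodes after it, and the master keys shared by $N_0$ with all nodes other than $N_j$. Here $N_j$ occurs exactly once on each path, it is not the destination, and each path has at most $l$ nodes after $N_0$. (4) A uniformly random bit $b$ is drawn. The source creates $Pkt_1$ with index $t$, carrying $p_1$ along $\mathcal P$, and a second packet with index $t+1$, carrying $p_2$ along $\mathcal P$ if $b=0$ and along $\mathcal P'$ if $b=1$. The adversary gets both packets as they leave $N_j$. (5) It again adaptively submits packets to $N_j$, and finally outputs a guess $b'$. **Theorem.** Suppose that $\rho$ is a pseudo-random generator, that $\delta$ is a secure key derivation function (for a uniformly random master key, the sequence $\delta(k,0),\dots,\delta(k,m-1)$ is computationally indistinguishable from a sequence of independent uniformly random pairs, for every polynomial $m=m(\kappa)$), and that the slot permutation with a uniformly random seed is computationally indistinguishable from a uniformly random permutation. Then Ariadne achieves path-session unlinkability against class $\mathcal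 A_2$: for every probabilistic polynomial-time adversary in the game, $\left|\Pr[b'=b]-\tfrac12\right|$ is negligible in $\kappa$. -/

import Mathlib

open Filter Asymptotics

namespace Ariadne

/-! ## Feasible computation

Data are binary trees. Programs form a small first-order language with an unbounded `while` loop
(so the language is Turing complete), and every elementary step is charged the full size of the
datum it acts on. Hence memory is bounded by input size plus time, and polynomial time in this
model is polynomial time on Turing machines. -/

/-- Binary trees, the data on which programs operate. -/
inductive Data : Type where
  | nil : Data
  | cons : Data → Data → Data
  deriving DecidableEq

namespace Data

/-- Number of constructors of a tree. -/
def size : Data → ℕ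
  | nil => 1
  | cons a b => a.size + b.size + 1

/-- First component (`nil` on `nil`). -/
def fst : Data → Data
  | nil => nil
  | cons a _ => a

/-- Second component (`nil` on `nil`). -/
def snd : Data → Data
  | nil => nil
  | cons _ b => b

/-- The list `[d₀, d₁, …]` as the tree `cons d₀ (cons d₁ …)`. -/
def ofList : List Data → Data
  | [] => nil
  | a :: l => cons a (ofList l)

/-- Every tree, read as a list. -/
def toList : Data → List Data
  | nil => []
  | cons a b => a :: toList b

theorem toList_ofList (l : List Data) : toList (ofList l) = l := by
  induction l with
  | nil => rfl
  | cons a l ih => simp [ofList, toList, ih]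

end Data

/-- Programs. -/
inductive Prog : Type where
  /-- return the input -/
  | id : Prog
  /-- return `nil` -/
  | nil : Prog
  /-- first component -/
  | fst : Prog
  /-- second component -/
  | snd : Prog
  /-- run the first program, then the second one on its result -/
  | seq : Prog → Prog → Prog
  /-- run both programs on the input and pair the results -/
  | pair : Prog → Prog → Prog
  /-- run the first program if the first component of the input is not `nil`, else the second -/
  | ite : Prog → Prog → Prog
  /-- repeat the program as long as the first component of the current value is not `nil` -/
  | loop : Prog → Prog

/-- `Run p x y n`: on input `x` the program `p` halts with output `y` after exactly `n` steps. -/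
inductive Run : Prog → Data → Data → ℕ → Prop where
  | id (x : Data) : Run .id x x x.size
  | nil (x : Data) : Run .nil x .nil x.size
  | fst (x : Data) : Run .fst x x.fst x.size
  | snd (x : Data) : Run .snd x x.snd x.size
  | seq {p q : Prog} {x y z : Data} {m n : ℕ} :
      Run p x y m → Run q y z n → Run (.seq p q) x z (m + n + x.size)
  | pair {p q : Prog} {x y z : Data} {m n : ℕ} :
      Run p x y m → Run q x z n → Run (.pair p q) x (.cons y z) (m + n + x.size)
  | ite_then {p q : Prog} {x y : Data} {n : ℕ} :
      x.fst ≠ .nil → Run p x y n → Run (.ite p q) x y (n + x.size)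
  | ite_else {p q : Prog} {x y : Data} {n : ℕ} :
      x.fst = .nil → Run q x y n → Run (.ite p q) x y (n + x.size)
  | loop_stop {p : Prog} {x : Data} : x.fst = .nil → Run (.loop p) x x x.size
  | loop_step {p : Prog} {x y z : Data} {m n : ℕ} :
      x.fst ≠ .nil → Run p x y m → Run (.loop p) y z n → Run (.loop p) x z (m + n + x.size)

/-- `f` is computed by a program whose running time is polynomial in the size of the input. -/
def PolyTime (f : Data → Data) : Prop :=
  ∃ (p : Prog) (c : Polynomial ℕ), ∀ x, ∃ n, n ≤ c.eval x.size ∧ Run p x (f x) n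

/-! ## Encodings -/

/-- Encodings of mathematical objects by data, with a total decoder. -/
class Code (α : Type) where
  enc : α → Data
  dec : Data → α
  dec_enc : ∀ a, dec (enc a) = a

open Code

instance : Code Data := ⟨id, id, fun _ => rfl⟩

instance : Code Unit := ⟨fun _ => .nil, fun _ => (), fun _ => rfl⟩

/-- Natural numbers are written in unary. -/
instance : Code ℕ where
  enc n := Data.ofList (List.replicate n .nil)
  dec d := d.toList.length
  dec_enc n := by simp [Data.toList_ofList]

/-- A bit; every datum other than `nil` is read as `1`. -/
instance : Code (ZMod 2) where
  enc b := if b = 0 then .nil else .cons .nil .nil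
  dec d := if d = .nil then 0 else 1
  dec_enc := by decide

instance {α β : Type} [Code α] [Code β] : Code (α × β) where
  enc x := .cons (enc x.1) (enc x.2)
  dec d := (dec d.fst, dec d.snd)
  dec_enc x := by simp [Data.fst, Data.snd, dec_enc]

instance {α : Type} [Code α] : Code (Option α) where
  enc x := match x with
    | none => .nil
    | some a => .cons (enc a) .nil
  dec d := match d with
    | .nil => none
    | .cons a _ => some (dec a)
  dec_enc x := by cases x <;> simp [dec_enc]

instance {α : Type} [Code α] : Code (List α) where
  enc l := Data.ofList (l.map enc)
  dec d := d.toList.map dec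
  dec_enc l := by
    have h : (dec ∘ enc : α → α) = id := funext dec_enc
    simp [Data.toList_ofList, h]

/-- Tuples are written as lists; missing entries of a shorter list are read as `nil`. -/
instance {α : Type} {n : ℕ} [Code α] : Code (Fin n → α) where
  enc v := Data.ofList (List.ofFn fun i => enc (v i))
  dec d := fun i => dec (d.toList.getD i .nil)
  dec_enc v := by
    funext i
    simp [Data.toList_ofList, dec_enc]

/-- A family of functions, indexed by the security parameter `κ`, is efficiently computable if one
program computes `f κ x` from `1^κ` and `x` in time polynomial in the size of this input. -/
def PolyTimeFamily {α β : ℕ → Type} [∀ κ, Code (α κ)] [∀ κ, Code (β κ)]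
    (f : ∀ κ, α κ → β κ) : Prop :=
  ∃ F : Data → Data, PolyTime F ∧ ∀ κ (x : α κ), F (enc (κ, x)) = enc (f κ x)

/-! ## Probability and indistinguishability -/

/-- Bit strings of length `n`. Addition is bitwise exclusive or. -/
abbrev Bits (n : ℕ) : Type := Fin n → ZMod 2

open Classical in
/-- Probability of an event under the uniform distribution on a finite set. -/
noncomputable def prob {Ω : Type} [Fintype Ω] (E : Ω → Prop) : ℝ :=
  ((Finset.univ.filter E).card : ℝ) / (Fintype.card Ω : ℝ)

/-- A function of the security parameter is negligible: it decays faster than every inverse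
polynomial. -/
def Negligible (f : ℕ → ℝ) : Prop :=
  SuperpolynomialDecay atTop (fun κ : ℕ => (κ : ℝ)) f

/-- A probabilistic polynomial-time distinguisher: a polynomial-time function of `1^κ`, the
challenge and a uniformly random string of polynomial length. It accepts by an output other than
`nil`. -/
structure Distinguisher where
  run : Data → Data
  polyTime : PolyTime run
  coins : Polynomial ℕ

/-- The distributions `X κ ω` with `ω` uniform in `Ω κ`, and `Y κ ω` with `ω` uniform in `Ω' κ`,
are computationally indistinguishable. -/
def Indistinguishable {Ω Ω' : ℕ → Type} [∀ κ, Fintype (Ω κ)] [∀ κ, Fintype (Ω' κ)]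
    {α : ℕ → Type} [∀ κ, Code (α κ)] (X : ∀ κ, Ω κ → α κ) (Y : ∀ κ, Ω' κ → α κ) : Prop :=
  ∀ D : Distinguisher, Negligible fun κ =>
    |prob (fun w : Ω κ × Bits (D.coins.eval κ) => D.run (enc (κ, X κ w.1, w.2)) ≠ .nil) -
      prob (fun w : Ω' κ × Bits (D.coins.eval κ) => D.run (enc (κ, Y κ w.1, w.2)) ≠ .nil)|

/-! ## The protocol

Everything in this section is for a fixed value `κ` of the security parameter. Concatenations of
strings of fixed lengths are written as tuples. -/

/-- The lengths (in bits, or in number of items) that fix the packet format. -/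
structure Sizes where
  /-- length of the pattern that references keys -/
  pat : ℕ
  /-- length of an address -/
  addr : ℕ
  /-- length of a slot pointer -/
  ptr : ℕ
  /-- number of slots of the routing vector -/
  slots : ℕ
  /-- length of the (padded) payload -/
  pay : ℕ
  /-- length of the seed of the pseudo-random slot permutation -/
  seed : ℕ
  /-- number of packet indices for which a node tabulates keys -/
  table : ℕ
  /-- pointers are long enough to distinguish the slots -/
  slots_le : slots ≤ 2 ^ ptr

/-- Keys, and also tags of the MAC. -/
abbrev Key (κ : ℕ) : Type := Bits κ

/-- Addresses; a node is identified with its address. -/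
abbrev Addr (S : Sizes) : Type := Bits S.addr

/-- Slot pointers as they are written in packets. -/
abbrev Ptr (S : Sizes) : Type := Bits S.ptr

/-- Routing elements: pattern, address of the successor, pointer to the slot of the successor,
tag. -/
abbrev RElem (κ : ℕ) (S : Sizes) : Type := Bits S.pat × Addr S × Ptr S × Key κ

/-- The routing vector. -/
abbrev Header (κ : ℕ) (S : Sizes) : Type := Fin S.slots → RElem κ S

/-- A packet without its common header: routing vector and payload. -/
abbrev Body (κ : ℕ) (S : Sizes) : Type := Header κ S × Bits S.pay

/-- Output of the generator `ρ`: the first part masks the routing element of a node, the second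
part (which splits into a mask for the routing vector and one for the payload) masks the packet. -/
abbrev Stream (κ : ℕ) (S : Sizes) : Type := RElem κ S × Body κ S

/-- Packets: the common header, i.e. the address of the next node and the pointer to the slot which
that node has to use, and the body. -/
abbrev Packet (κ : ℕ) (S : Sizes) : Type := Addr S × Ptr S × Body κ S

/-- The parameters of an instance of the protocol. -/
structure Scheme (κ : ℕ) (S : Sizes) where
  /-- the common pattern `π` -/
  pattern : Bits S.pat
  /-- the key derivation function `δ`; `δ k t = (k^Enc_t, k^Mac_t)` -/
  kdf : Key κ → ℕ → Key κ × Key κ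
  /-- the pseudo-random generator `ρ` -/
  prg : Key κ → Stream κ S
  /-- the message authentication code `μ` -/
  mac : Key κ → Body κ S → Key κ
  /-- the pseudo-random permutation of the slots -/
  perm : Bits S.seed → Equiv.Perm (Fin S.slots)

variable {κ : ℕ} {S : Sizes}

/-- The pointer to a slot: its number, in binary. -/
def ptrOf (s : Fin S.slots) : Ptr S := fun i => if s.val.testBit i then 1 else 0

/-- The slot that a pointer refers to, if there is one. -/
def slotOf (p : Ptr S) : Option (Fin S.slots) :=
  (List.finRange S.slots).find? fun s => ptrOf s = p

/-- What the source uses for one node of the path when it creates a packet: the address, the slot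
and the temporary key material. -/
structure Hop (κ : ℕ) (S : Sizes) where
  addr : Addr S
  slot : Fin S.slots
  stream : Stream κ S
  macKey : Key κ

/-- Key material for the packet with index `t` from a master key: `ρ(k^Enc_t)` and `k^Mac_t`. -/
def Scheme.derive (P : Scheme κ S) (k : Key κ) (t : ℕ) : Stream κ S × Key κ :=
  (P.prg (P.kdf k t).1, (P.kdf k t).2)

/-- The routing element of a node `h`, given the nodes after it and the tag. The last node of the
path gets its own address and its own slot. -/
def Scheme.relem (P : Scheme κ S) (h : Hop κ S) (rest : List (Hop κ S)) (tag : Key κ) :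
    RElem κ S :=
  let next := rest.headD h
  (P.pattern, next.addr, ptrOf next.slot, tag)

/-- Preparation of the routing vector, from the first node to the last: put the routing element
with a zero tag into the slot of the node, then mask the vector. -/
def Scheme.filler (P : Scheme κ S) : List (Hop κ S) → Header κ S → Header κ S
  | [], R => R
  | h :: rest, R =>
      P.filler rest (Function.update R h.slot (P.relem h rest 0) + h.stream.2.1)

/-- Construction of the layers, from the last node to the first: mask the packet, compute the tag,
and put the masked routing element with this tag into the slot of the node. -/
def Scheme.wrap (P : Scheme κ S) : List (Hop κ S) → Body κ S → Body κ S
  | [], X => X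
  | h :: rest, X =>
      let Y := P.wrap rest X + h.stream.2
      let tag := P.mac h.macKey Y
      (Function.update Y.1 h.slot (P.relem h rest tag + h.stream.1), Y.2)

/-- The packet that the source sends, from the path, the initial random routing vector `R` and the
payload. (The path consists of the first node and the list of the further ones.) -/
def Scheme.create (P : Scheme κ S) (first : Hop κ S) (rest : List (Hop κ S)) (R : Header κ S)
    (payload : Bits S.pay) : Packet κ S :=
  (first.addr, ptrOf first.slot,
    P.wrap (first :: rest) (P.filler (first :: rest) R, payload))

/-- What a node does with a packet after it has found the key material for it: unmask the routing
element, check the tag, unmask the packet and update the common header. The packet is dropped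
(`none`) if the check fails. -/
def Scheme.relay (P : Scheme κ S) (stream : Stream κ S) (macKey : Key κ) (pkt : Packet κ S) :
    Option (Packet κ S) :=
  match slotOf pkt.2.1 with
  | none => none
  | some s =>
      let r := pkt.2.2.1 s + stream.1
      let Y : Body κ S :=
        (Function.update pkt.2.2.1 s (r.1, r.2.1, r.2.2.1, 0), pkt.2.2.2)
      if P.mac macKey Y = r.2.2.2 then some (r.2.1, r.2.2.1, Y + stream.2) else none

/-- What a node with the master key `k` does with a packet: look up the encrypted pattern in the
table of the encrypted patterns for the indices `t < S.table`, and go on with the key material of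
the first match. The packet is dropped if there is no match. -/
def Scheme.nodeStep (P : Scheme κ S) (k : Key κ) (pkt : Packet κ S) : Option (Packet κ S) :=
  match slotOf pkt.2.1 with
  | none => none
  | some s =>
      match (List.range S.table).find?
          (fun t => (pkt.2.2.1 s).1 = P.pattern + (P.derive k t).1.1.1) with
      | none => none
      | some t => P.relay (P.derive k t).1 (P.derive k t).2 pkt

/-- The hops of a path for a packet with index `t`: the `i`-th node gets the `i`-th slot in the
order given by the permutation `σ`. -/
def Scheme.hops (P : Scheme κ S) (keyOf : Addr S → Key κ) (t : ℕ)
    (σ : Equiv.Perm (Fin S.slots)) (path : List (Addr S)) : List (Hop κ S) :=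
  (path.zip ((List.finRange S.slots).map σ)).map fun x =>
    ⟨x.1, x.2, (P.derive (keyOf x.1) t).1, (P.derive (keyOf x.1) t).2⟩

/-- The source creates a packet with index `t` for the path `pre ++ [nj] ++ suf`; the nodes of
`pre` relay it one after the other with their key material for that index; then `nj` handles it.
The result is the packet that leaves `nj`. -/
def Scheme.emitted (P : Scheme κ S) (keyOf : Addr S → Key κ) (nj : Addr S) (t : ℕ)
    (pre suf : List (Addr S)) (seed : Bits S.seed) (R : Header κ S) (payload : Bits S.pay) :
    Option (Packet κ S) :=
  match P.hops keyOf t (P.perm seed) (pre ++ nj :: suf) with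
  | [] => none
  | first :: rest =>
      (((first :: rest).take pre.length).foldlM (fun pkt h => P.relay h.stream h.macKey pkt)
        (P.create first rest R payload)).bind (P.nodeStep (keyOf nj))

/-! ## The path-session unlinkability game, adversaries with compromised nodes -/

/-- What the adversary submits in the challenge phase. -/
structure Challenge (κ : ℕ) (S : Sizes) where
  /-- index of the first packet; the second packet has the next index -/
  index : ℕ
  /-- payload of the first packet -/
  payload₁ : Bits S.pay
  /-- payload of the second packet -/
  payload₂ : Bits S.pay
  /-- the nodes between the source and the honest node on the first path -/
  pre₁ : List (Addr S)
  /-- the nodes between the source and the honest node on the second path -/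
  pre₂ : List (Addr S)
  /-- the nodes after the honest node, on both paths -/
  suf : List (Addr S)
  /-- the master keys shared by the source with the nodes other than the honest one -/
  keys : List (Addr S × Key κ)

/-- Total decoder for challenges. -/
def Challenge.ofData (d : Data) : Challenge κ S :=
  let x : ℕ × (Bits S.pay × Bits S.pay) ×
      (List (Addr S) × List (Addr S) × List (Addr S)) × List (Addr S × Key κ) := dec d
  ⟨x.1, x.2.1.1, x.2.1.2, x.2.2.1.1, x.2.2.1.2.1, x.2.2.1.2.2, x.2.2.2⟩

/-- A challenge is admissible: both indices are in the key table, the honest node occurs exactly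
once on each path and is not the destination, and the paths fit into the routing vector. -/
def Challenge.Valid (c : Challenge κ S) (nj : Addr S) : Prop :=
  c.index + 1 < S.table ∧ c.suf ≠ [] ∧ nj ∉ c.pre₁ ∧ nj ∉ c.pre₂ ∧ nj ∉ c.suf ∧
    c.pre₁.length + 1 + c.suf.length ≤ S.slots ∧ c.pre₂.length + 1 + c.suf.length ≤ S.slots

instance (c : Challenge κ S) (nj : Addr S) : Decidable (c.Valid nj) := by
  unfold Challenge.Valid; infer_instance

/-- Master keys: the key `k` of the honest node, and the keys given by the adversary for all other
nodes (zero for a node that the adversary did not list). -/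
def Challenge.keyOf (c : Challenge κ S) (nj : Addr S) (k : Key κ) (a : Addr S) : Key κ :=
  if a = nj then k else (c.keys.lookup a).getD 0

/-- The random choices of the challenger: the key of the honest node, the bit, and for each of the
two packets the seed of the slot permutation and the initial routing vector. -/
abbrev ChallengerCoins (κ : ℕ) (S : Sizes) : Type :=
  Key κ × Bool × (Bits S.seed × Header κ S) × (Bits S.seed × Header κ S)

set_option synthInstance.maxSize 1000 in
instance : Fintype (ChallengerCoins κ S) := inferInstance

/-- The two packets given to the adversary, as they leave the honest node: the first follows the
first path; the second follows the first path if the bit is `0` (`false`), and the second path if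
the bit is `1` (`true`). Nothing is given for an inadmissible challenge. -/
def Scheme.answer (P : Scheme κ S) (nj : Addr S) (w : ChallengerCoins κ S)
    (c : Challenge κ S) : Option (Packet κ S) × Option (Packet κ S) :=
  if c.Valid nj then
    (P.emitted (c.keyOf nj w.1) nj c.index c.pre₁ c.suf w.2.2.1.1 w.2.2.1.2 c.payload₁,
      P.emitted (c.keyOf nj w.1) nj (c.index + 1) (if w.2.1 then c.pre₂ else c.pre₁) c.suf
        w.2.2.2.1 w.2.2.2.2 c.payload₂)
  else (none, none)

/-- A probabilistic polynomial-time adversary in the game. From `1^κ`, the name of the honest node,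
a uniformly random string of polynomial length and the list of all answers so far (the latest one
first), it computes in polynomial time its next message. Its messages are polynomially many packets
for the honest node, the challenge, again polynomially many packets, and the guess. -/
structure Adversary where
  next : Data → Data
  polyTime : PolyTime next
  coins : Polynomial ℕ
  queries₁ : Polynomial ℕ
  queries₂ : Polynomial ℕ

/-- The adversary wins the game: it guesses the bit. -/
def Adversary.Wins (A : Adversary) (P : Scheme κ S) (nj : Addr S) (w : ChallengerCoins κ S)
    (r : Bits (A.coins.eval κ)) : Prop :=
  let move : List Data → Data := fun answers => A.next (enc (κ, nj, r, answers))
  let query : List Data → List Data := fun answers =>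
    enc (P.nodeStep w.1 (dec (move answers))) :: answers
  let h₁ := query^[A.queries₁.eval κ] []
  let h₂ := enc (P.answer nj w (Challenge.ofData (move h₁))) :: h₁
  let h₃ := query^[A.queries₂.eval κ] h₂
  (move h₃ ≠ .nil ↔ w.2.1 = true)

/-- Path-session unlinkability against adversaries that see every link and hold the master keys of
all nodes except the honest node `nj`: no probabilistic polynomial-time adversary guesses the bit
with probability non-negligibly different from one half. -/
def PathSessionUnlinkable (S : ℕ → Sizes) (P : ∀ κ, Scheme κ (S κ)) (nj : ∀ κ, Addr (S κ)) :
    Prop :=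
  ∀ A : Adversary, Negligible fun κ =>
    |prob (fun w : ChallengerCoins κ (S κ) × Bits (A.coins.eval κ) =>
      A.Wins (P κ) (nj κ) w.1 w.2) - 1 / 2|

/-! ## Assumptions on the building blocks -/

/-- The lengths and the algorithms of the protocol are efficiently computable. -/
structure Efficient (S : ℕ → Sizes) (P : ∀ κ, Scheme κ (S κ)) : Prop where
  pat : PolyTimeFamily fun κ (_ : Unit) => (S κ).pat
  addr : PolyTimeFamily fun κ (_ : Unit) => (S κ).addr
  ptr : PolyTimeFamily fun κ (_ : Unit) => (S κ).ptr
  slots : PolyTimeFamily fun κ (_ : Unit) => (S κ).slots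
  pay : PolyTimeFamily fun κ (_ : Unit) => (S κ).pay
  seed : PolyTimeFamily fun κ (_ : Unit) => (S κ).seed
  table : PolyTimeFamily fun κ (_ : Unit) => (S κ).table
  pattern : PolyTimeFamily fun κ (_ : Unit) => (P κ).pattern
  kdf : PolyTimeFamily fun κ (x : Key κ × ℕ) => (P κ).kdf x.1 x.2
  prg : PolyTimeFamily fun κ (k : Key κ) => (P κ).prg k
  mac : PolyTimeFamily fun κ (x : Key κ × Body κ (S κ)) => (P κ).mac x.1 x.2
  perm : PolyTimeFamily fun κ (s : Bits (S κ).seed) =>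
    fun i : Fin (S κ).slots => ((P κ).perm s i : ℕ)

/-- `ρ` is a pseudo-random generator: its output on a random key is indistinguishable from a random
string. -/
def PseudorandomGenerator (S : ℕ → Sizes) (P : ∀ κ, Scheme κ (S κ)) : Prop :=
  Indistinguishable (fun κ (k : Key κ) => (P κ).prg k) (fun κ (s : Stream κ (S κ)) => s)

/-- `δ` is a secure key derivation function: the sequence of polynomially many pairs of temporary
keys derived from a random master key is indistinguishable from a sequence of independent random
pairs. -/
def SecureKeyDerivation (S : ℕ → Sizes) (P : ∀ κ, Scheme κ (S κ)) : Prop :=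
  ∀ T : Polynomial ℕ, Indistinguishable
    (fun κ (k : Key κ) => fun t : Fin (T.eval κ) => (P κ).kdf k t)
    (fun κ (ks : Fin (T.eval κ) → Key κ × Key κ) => ks)

/-- The slot permutation is pseudo-random: with a random seed, it is indistinguishable from a
uniformly random permutation of the slots. -/
def PseudorandomSlots (S : ℕ → Sizes) (P : ∀ κ, Scheme κ (S κ)) : Prop :=
  Indistinguishable
    (fun κ (s : Bits (S κ).seed) => fun i : Fin (S κ).slots => ((P κ).perm s i : ℕ))
    (fun κ (σ : Equiv.Perm (Fin (S κ).slots)) => fun i : Fin (S κ).slots => (σ i : ℕ))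

end Ariadne

namespace Ariadne

/-! ## Closure properties of polynomial time -/

/-! Information-theoretic core. Suppose that the key material of the honest node is a table of
independent uniform streams and MAC keys. When the node takes off its layer, what remains is the
packet for the nodes after it, built on the routing vector `base` plus the header mask of this index
(`Scheme.relay_incoming`). All traces of the slots and keys used before the honest node are inside
`base`, and the mask is uniform and used for this packet only: a one-time pad. The only other trace
of the path is the place in the slot sequence where the slots of the remaining nodes begin, and a
rotation of a uniformly random permutation hides it. So the injective change of variables
`Adversary.blind` turns the answer into one that does not mention the bit, and flipping the bit
shows that the guess is right with probability exactly one half (`Adversary.prob_ideal`).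

The oracle is harmless because it almost never accepts anything. A packet is accepted if its
unmasked tag field equals a MAC value computed with that field set to zero. This MAC value does not
involve the mask of the tag, and neither do the ideal answers (`Scheme.idealAnswer_congr`), so at
most one of the `2 ^ κ` masks leads to acceptance (`prob_le_of_family`). Unforgeability thus comes
from the mask and not from `μ`. The same count shows that a challenge packet is rarely accepted
under a wrong table entry. A union bound gives `Adversary.abs_prob_winsWith_sub_half_le`. Collisions
of pattern masks may well be frequent, since patterns can be short. They need no bound: a collision
only makes the honest node drop the packet, and whether it occurs does not depend on the bit, so it
is part of the ideal game.

Computational part. Correctness of the relays (`Scheme.emitted_eq_emit`) rewrites the game exactly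
as one played with a table of key material. Three replacements lead to the uniform table: derived
keys by random keys, generator outputs by random streams (a hybrid argument,
`Indistinguishable.tuple`), and the slots of the second packet by a random permutation. The slots of
the first packet can stay pseudo-random, as its path does not depend on the bit.

In each replacement the whole game, adversary included, acts as the distinguisher. It must therefore
run in polynomial time, which is the purpose of the calculus of `PolyTime` and `Feasible` functions
that ends in `Efficient.f_output` and `Efficient.f_winsWith`. Its remaining coins must come exactly
uniform from random bits, which is the purpose of `Samplable`. -/

theorem Data.size_pos (d : Data) : 0 < d.size := by cases d <;> simp [Data.size]

@[simp] theorem Data.fst_cons (a b : Data) : (Data.cons a b).fst = a := rfl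

@[simp] theorem Data.snd_cons (a b : Data) : (Data.cons a b).snd = b := rfl

@[simp] theorem Data.toList_nil : Data.nil.toList = [] := rfl

@[simp] theorem Data.toList_cons (a b : Data) : (Data.cons a b).toList = a :: b.toList := rfl

theorem Data.size_fst_le (d : Data) : d.fst.size ≤ d.size := by
  cases d <;> simp [Data.size, Data.fst]; omega

theorem Data.size_snd_le (d : Data) : d.snd.size ≤ d.size := by
  cases d <;> simp [Data.size, Data.snd]; omega

theorem Data.ofList_toList (d : Data) : Data.ofList d.toList = d := by
  induction d with
  | nil => rfl
  | cons a b _ ih => simp [Data.toList, Data.ofList, ih]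

theorem Data.length_toList_le (d : Data) : d.toList.length ≤ d.size := by
  induction d with
  | nil => simp [Data.toList]
  | cons a b _ ih => simp [Data.toList, Data.size]; omega

/-- Every step is charged the size of its datum, so no output outgrows the running time. This turns
time bounds into the size bounds that compositions need. -/
theorem Run.size_le {p : Prog} {x y : Data} {n : ℕ} (h : Run p x y n) : y.size ≤ n := by
  induction h with
  | id x => exact le_rfl
  | nil x => exact x.size_pos
  | fst x => exact x.size_fst_le
  | snd x => exact x.size_snd_le
  | seq _ _ _ ih => omega
  | @pair p q x y z m n _ _ ih₁ ih₂ =>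
    have := x.size_pos
    simp only [Data.size]; omega
  | ite_then _ _ ih => omega
  | ite_else _ _ ih => omega
  | loop_stop _ => exact le_rfl
  | loop_step _ _ _ _ ih => omega

theorem polynomial_eval_mono (c : Polynomial ℕ) : Monotone fun n => c.eval n := by
  intro m n h
  simp only [Polynomial.eval_eq_sum, Polynomial.sum]
  exact Finset.sum_le_sum fun i _ => Nat.mul_le_mul_left _ (Nat.pow_le_pow_left h i)

namespace PolyTime

variable {f g h : Data → Data}

theorem size_le (hf : PolyTime f) : ∃ c : Polynomial ℕ, ∀ x, (f x).size ≤ c.eval x.size := by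
  obtain ⟨p, c, hp⟩ := hf
  refine ⟨c, fun x => ?_⟩
  obtain ⟨n, hn, hr⟩ := hp x
  exact hr.size_le.trans hn

theorem congr (hf : PolyTime f) (e : ∀ x, f x = g x) : PolyTime g := (funext e : f = g) ▸ hf

theorem ident : PolyTime fun x => x := ⟨.id, Polynomial.X, fun x => ⟨_, by simp, .id x⟩⟩

theorem fst' : PolyTime Data.fst := ⟨.fst, Polynomial.X, fun x => ⟨_, by simp, .fst x⟩⟩

theorem snd' : PolyTime Data.snd := ⟨.snd, Polynomial.X, fun x => ⟨_, by simp, .snd x⟩⟩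

theorem nil : PolyTime fun _ => Data.nil := ⟨.nil, Polynomial.X, fun x => ⟨_, by simp, .nil x⟩⟩

theorem comp (hg : PolyTime g) (hf : PolyTime f) : PolyTime fun x => g (f x) := by
  obtain ⟨c', hc'⟩ := hf.size_le
  obtain ⟨p, c, hp⟩ := hf
  obtain ⟨q, d, hq⟩ := hg
  refine ⟨.seq p q, c + d.comp c' + Polynomial.X, fun x => ?_⟩
  obtain ⟨m, hm, hr⟩ := hp x
  obtain ⟨n, hn, hs⟩ := hq (f x)
  refine ⟨_, ?_, .seq hr hs⟩
  have := polynomial_eval_mono d (hc' x)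
  simp only [Polynomial.eval_add, Polynomial.eval_comp, Polynomial.eval_X] at *
  omega

theorem cons (hf : PolyTime f) (hg : PolyTime g) : PolyTime fun x => Data.cons (f x) (g x) := by
  obtain ⟨p, c, hp⟩ := hf
  obtain ⟨q, d, hq⟩ := hg
  refine ⟨.pair p q, c + d + Polynomial.X, fun x => ?_⟩
  obtain ⟨m, hm, hr⟩ := hp x
  obtain ⟨n, hn, hs⟩ := hq x
  refine ⟨_, ?_, .pair hr hs⟩
  simp only [Polynomial.eval_add, Polynomial.eval_X]
  omega

theorem fst (hf : PolyTime f) : PolyTime fun x => (f x).fst := fst'.comp hf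

theorem snd (hf : PolyTime f) : PolyTime fun x => (f x).snd := snd'.comp hf

theorem const (d : Data) : PolyTime fun _ => d := by
  induction d with
  | nil => exact nil
  | cons a b iha ihb => exact iha.cons ihb

theorem iteFst (hf : PolyTime f) (hg : PolyTime g) :
    PolyTime fun x => if x.fst = .nil then g x else f x := by
  obtain ⟨p, c, hp⟩ := hf
  obtain ⟨q, d, hq⟩ := hg
  refine ⟨.ite p q, c + d + Polynomial.X, fun x => ?_⟩
  obtain ⟨m, hm, hr⟩ := hp x
  obtain ⟨n, hn, hs⟩ := hq x
  simp only [Polynomial.eval_add, Polynomial.eval_X]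
  by_cases hx : x.fst = .nil
  · refine ⟨n + x.size, by omega, ?_⟩
    rw [if_pos hx]; exact .ite_else hx hs
  · refine ⟨m + x.size, by omega, ?_⟩
    rw [if_neg hx]; exact .ite_then hx hr

theorem ite (hh : PolyTime h) (hf : PolyTime f) (hg : PolyTime g) :
    PolyTime fun x => if h x = .nil then g x else f x :=
  -- The tested value is paired in front of the input; `iteFst` inspects it there, and both branches
  -- discard it.
  ((iteFst (hf.comp snd') (hg.comp snd')).comp (hh.cons ident)).congr fun x => by
    by_cases hx : h x = .nil <;> simp [hx]

/-- A loop whose number of iterations is given by a measure, and whose states stay small. -/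
theorem loop (hf : PolyTime f) (hg : PolyTime g) (w : Data → ℕ) (hw : ∀ z, z.fst = .nil ↔ w z = 0)
    (hs : ∀ z, z.fst ≠ .nil → w (g z) + 1 = w z) (bN bS : Polynomial ℕ)
    (hN : ∀ x, w (f x) ≤ bN.eval x.size)
    (hS : ∀ x i, i ≤ w (f x) → (g^[i] (f x)).size ≤ bS.eval x.size) :
    PolyTime fun x => g^[w (f x)] (f x) := by
  obtain ⟨q, d, hq⟩ := hf
  obtain ⟨p, c, hp⟩ := hg
  refine ⟨.seq q (.loop p), d + (bN + 1) * (c.comp bS + bS) + Polynomial.X, fun x => ?_⟩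
  have hwi : ∀ i, i ≤ w (f x) → w (g^[i] (f x)) = w (f x) - i := by
    intro i
    induction i with
    | zero => simp
    | succ i ih =>
      intro hi
      have h1 := ih (by omega)
      have h2 := hs (g^[i] (f x)) (by rw [Ne, hw]; omega)
      rw [Function.iterate_succ_apply']; omega
  -- Induction on the number `k` of iterations still to come. Each costs one run of the body plus
  -- the charge for the current state; the extra `1` pays for the final test.
  have key : ∀ k i, i + k = w (f x) → ∃ n,
      n ≤ (k + 1) * (c.eval (bS.eval x.size) + bS.eval x.size) ∧
      Run (.loop p) (g^[i] (f x)) (g^[w (f x)] (f x)) n := by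
    intro k
    induction k with
    | zero =>
      intro i hi
      obtain rfl : i = w (f x) := by omega
      refine ⟨_, ?_, Run.loop_stop ((hw _).2 (by rw [hwi _ le_rfl]; omega))⟩
      have := hS x _ le_rfl
      omega
    | succ k ih =>
      intro i hi
      obtain ⟨n, hn, hr⟩ := ih (i + 1) (by omega)
      obtain ⟨m, hm, hr'⟩ := hp (g^[i] (f x))
      rw [Function.iterate_succ_apply'] at hr
      refine ⟨_, ?_, .loop_step (by rw [Ne, hw, hwi _ (by omega)]; omega) hr' hr⟩
      have h1 := hS x i (by omega)
      have h2 := polynomial_eval_mono c h1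
      simp only at h2
      rw [add_mul (k + 1) 1, one_mul]
      omega
  obtain ⟨n, hn, hr⟩ := key (w (f x)) 0 (by omega)
  obtain ⟨m, hm, hr'⟩ := hq x
  refine ⟨_, ?_, .seq hr' hr⟩
  simp only [Polynomial.eval_mul, Polynomial.eval_add, Polynomial.eval_one, Polynomial.eval_comp,
    Polynomial.eval_X]
  have h1 := Nat.mul_le_mul_right (c.eval (bS.eval x.size) + bS.eval x.size)
    (Nat.succ_le_succ (hN x))
  simp only [Nat.succ_eq_add_one] at h1
  omega

/-- A left fold whose states stay small. -/
theorem fold {c l s₀ : Data → Data} (hc : PolyTime c) (hl : PolyTime l) (hs₀ : PolyTime s₀)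
    (hg : PolyTime g) (b : Polynomial ℕ)
    (hb : ∀ (x : Data) i, (((l x).toList.take i).foldl
      (fun s a => g (.cons (c x) (.cons s a))) (s₀ x)).size ≤ b.eval x.size) :
    PolyTime fun x => (l x).toList.foldl (fun s a => g (.cons (c x) (.cons s a))) (s₀ x) := by
  -- The loop state consists of the remaining list, the fixed context `c x` and the accumulator, in
  -- this order.
  let body : Data → Data := fun z => .cons z.fst.snd (.cons z.snd.fst
    (g (.cons z.snd.fst (.cons z.snd.snd z.fst.fst))))
  have hbody : PolyTime body :=
    ident.fst.snd.cons (ident.snd.fst.cons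
      (hg.comp (ident.snd.fst.cons (ident.snd.snd.cons ident.fst.fst))))
  have hit : ∀ i (d : Data) (l : List Data) (s : Data), i ≤ l.length →
      body^[i] (.cons (.ofList l) (.cons d s)) = .cons (.ofList (l.drop i))
        (.cons d ((l.take i).foldl (fun s a => g (.cons d (.cons s a))) s)) := by
    intro i d
    induction i with
    | zero => intro l s _; simp
    | succ i ih =>
      intro l s hl
      cases l with
      | nil => simp at hl
      | cons a l =>
        simp only [List.length_cons, Nat.add_le_add_iff_right] at hl
        rw [Function.iterate_succ_apply]
        simpa [body, Data.ofList] using ih l (g (.cons d (.cons s a))) hl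
  have hdrop : ∀ (l : List Data) i, (Data.ofList (l.drop i)).size ≤ (Data.ofList l).size := by
    intro l
    induction l with
    | nil => simp
    | cons a l ih =>
      intro i
      cases i with
      | zero => simp
      | succ i => simp only [List.drop_succ_cons, Data.ofList, Data.size]; have := ih i; omega
  obtain ⟨bl, hbl⟩ := hl.size_le
  obtain ⟨bc, hbc⟩ := hc.size_le
  have hloop := loop (hl.cons (hc.cons hs₀)) hbody (fun z => z.fst.toList.length) ?_ ?_ bl
    (bl + bc + b + 2) ?_ ?_
  · refine hloop.snd.snd.congr fun x => ?_
    have := hit _ (c x) (l x).toList (s₀ x) le_rfl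
    rw [Data.ofList_toList] at this
    simp only [Data.fst_cons]
    rw [this]
    simp
  · intro z
    cases z.fst <;> simp
  · intro z hz
    cases z with
    | nil => exact absurd rfl hz
    | cons a s => cases a with
      | nil => exact absurd rfl hz
      | cons a l => simp [body]
  · intro x
    simpa using (Data.length_toList_le _).trans (hbl x)
  · intro x i hi
    simp only [Data.fst_cons] at hi
    have h1 := hb x i
    have h2 := hdrop (l x).toList i
    have h3 := hbc x
    have h4 := hbl x
    have h5 := hit _ (c x) (l x).toList (s₀ x) hi
    rw [Data.ofList_toList] at h2 h5
    rw [h5]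
    simp only [Data.size, Polynomial.eval_add, Polynomial.eval_ofNat] at *
    omega

end PolyTime

/-! ### Sizes, truncation and equality -/

/-- The unary numeral `n`. -/
def unary (n : ℕ) : Data := Data.ofList (List.replicate n .nil)

theorem size_unary (n : ℕ) : (unary n).size = 2 * n + 1 := by
  induction n with
  | zero => rfl
  | succ n ih =>
    have : unary (n + 1) = .cons .nil (unary n) := rfl
    simp only [this, Data.size, ih]; omega

theorem unary_succ (n : ℕ) : unary (n + 1) = .cons .nil (unary n) := rfl

theorem length_toList_unary (n : ℕ) : (unary n).toList.length = n := by
  simp [unary, Data.toList_ofList]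

namespace PolyTime

theorem foldl_const_iterate (k : Data → Data) (l : List Data) (s : Data) :
    l.foldl (fun s _ => k s) s = k^[l.length] s := by
  induction l generalizing s with
  | nil => rfl
  | cons a l ih => simp [ih]

/-- Iteration of `cons` with a fixed first component. -/
theorem iterateCons (hf : PolyTime f) (hg : PolyTime g) (hh : PolyTime h) :
    PolyTime fun x => (fun s => Data.cons (f x) s)^[(g x).toList.length] (h x) := by
  obtain ⟨bf, hbf⟩ := hf.size_le
  obtain ⟨bg, hbg⟩ := hg.size_le
  obtain ⟨bh, hbh⟩ := hh.size_le
  refine (fold hf hg hh (g := fun z => .cons z.fst z.snd.fst) (fst'.cons snd'.fst)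
    (bh + bg * (bf + 1)) fun x i => ?_).congr fun x => ?_
  · simp only [Data.fst_cons, Data.snd_cons, foldl_const_iterate]
    have hs : ∀ i a b, ((fun s => Data.cons a s)^[i] b).size = b.size + i * (a.size + 1) := by
      intro i
      induction i with
      | zero => simp
      | succ i ih =>
        intro a b
        rw [Function.iterate_succ_apply']
        simp only [Data.size, ih]; ring
    rw [hs]
    simp only [Polynomial.eval_add, Polynomial.eval_mul, Polynomial.eval_one]
    refine Nat.add_le_add (hbh x) (Nat.mul_le_mul ?_ (Nat.succ_le_succ (hbf x)))
    rw [List.length_take]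
    exact (min_le_right _ _).trans ((Data.length_toList_le _).trans (hbg x))
  · simp only [Data.fst_cons, Data.snd_cons, foldl_const_iterate]

/-- Dropping as many elements of a list as another list has. -/
theorem iterateSnd (hf : PolyTime f) (hg : PolyTime g) :
    PolyTime fun x => Data.snd^[(g x).toList.length] (f x) := by
  obtain ⟨bf, hbf⟩ := hf.size_le
  refine (fold nil hg hf (g := fun z => z.snd.fst.snd) snd'.fst.snd bf fun x i => ?_).congr
    fun x => ?_
  · simp only [Data.fst_cons, Data.snd_cons, foldl_const_iterate]
    refine le_trans ?_ (hbf x)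
    generalize (List.take i (g x).toList).length = n
    induction n with
    | zero => simp
    | succ n ih => rw [Function.iterate_succ_apply']; exact (Data.size_snd_le _).trans ih
  · simp only [Data.fst_cons, Data.snd_cons, foldl_const_iterate]

theorem iterate_cons_nil (n m : ℕ) : (fun s => Data.cons .nil s)^[n] (unary m) = unary (n + m) := by
  induction n with
  | zero => simp
  | succ n ih => rw [Function.iterate_succ_apply', ih, ← unary_succ]; congr 1; omega

/-- One step of the traversal of a tree that is kept on a stack; it counts the constructors. -/
def sizeStep (z : Data) : Data :=
  .cons (if z.fst.fst = .nil then z.fst.snd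
    else .cons z.fst.fst.fst (.cons z.fst.fst.snd z.fst.snd)) (.cons .nil z.snd)

theorem sizeList : PolyTime fun x => unary x.size := by
  have hstep : PolyTime sizeStep :=
    (ite (ident.fst.fst) (ident.fst.fst.fst.cons (ident.fst.fst.snd.cons ident.fst.snd))
      (ident.fst.snd)).cons (nil.cons ident.snd)
  -- The measure is the total size of the trees on the stack. Popping a leaf, or replacing a `cons`
  -- by its two components, lowers it by exactly one while the counter gains one.
  let w : Data → ℕ := fun z => (z.fst.toList.map Data.size).sum
  have hwle : ∀ d : Data, (d.toList.map Data.size).sum ≤ d.size := by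
    intro d
    induction d with
    | nil => simp
    | cons a b _ ih => simp [Data.size]; omega
  have hgrow : ∀ z, (sizeStep z).size ≤ z.size + 5 := by
    intro z
    rcases z with _ | ⟨_ | ⟨_ | ⟨a, b⟩, r⟩, s⟩ <;> simp [sizeStep, Data.size, Data.fst, Data.snd] <;>
      omega
  have h := loop ((ident.cons nil).cons nil) hstep w ?_ ?_ Polynomial.X
    (Polynomial.X + 4 + 5 * Polynomial.X) ?_ ?_
  · have hw1 : ∀ n z, w z = n → (sizeStep^[n] z).snd = (fun s => Data.cons .nil s)^[n] z.snd := by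
      intro n
      induction n with
      | zero => simp
      | succ n ih =>
        intro z hz
        rw [Function.iterate_succ_apply, ih]
        · rfl
        · rcases z with _ | ⟨_ | ⟨_ | ⟨a, b⟩, r⟩, s⟩ <;>
            simp [w, sizeStep, Data.size, Data.fst, Data.snd, Data.toList] at hz ⊢ <;> omega
    refine h.snd.congr fun x => ?_
    rw [hw1 _ _ rfl]
    have : w (((x.cons Data.nil)).cons Data.nil) = x.size := by simp [w]
    rw [this]
    exact iterate_cons_nil x.size 0
  · intro z
    rcases z with _ | ⟨_ | ⟨a, r⟩, s⟩
    · simp [w, Data.fst, Data.toList]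
    · simp [w, Data.fst, Data.toList]
    · have := a.size_pos
      simp [w, Data.fst, Data.toList]; omega
  · intro z hz
    rcases z with _ | ⟨_ | ⟨_ | ⟨a, b⟩, r⟩, s⟩ <;>
      simp [w, sizeStep, Data.size, Data.fst, Data.snd, Data.toList] at hz ⊢ <;> omega
  · intro x
    simp [w]
  · intro x i hi
    have : ∀ i z, (sizeStep^[i] z).size ≤ z.size + 5 * i := by
      intro i z
      induction i with
      | zero => simp
      | succ i ih => rw [Function.iterate_succ_apply']; have := hgrow (sizeStep^[i] z); omega
    have h1 := this i ((x.cons Data.nil).cons Data.nil)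
    simp only [Polynomial.eval_add, Polynomial.eval_mul, Polynomial.eval_X, w, Data.fst_cons,
      Data.toList_cons, Data.toList_nil, List.map_cons, List.map_nil, List.sum_cons, List.sum_nil,
      Polynomial.eval_ofNat, Data.size] at *
    omega

/-- Data with a prescribed polynomial size. -/
theorem exists_size_ge (c : Polynomial ℕ) : ∃ u, PolyTime u ∧ ∀ x, c.eval x.size ≤ (u x).size := by
  induction c using Polynomial.induction_on with
  | C a =>
    refine ⟨_, const (unary a), fun x => ?_⟩
    rw [Polynomial.eval_C, size_unary]; omega
  | add p q hp hq =>
    obtain ⟨u, hu, hu'⟩ := hp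
    obtain ⟨v, hv, hv'⟩ := hq
    refine ⟨_, hu.cons hv, fun x => ?_⟩
    have := hu' x; have := hv' x
    simp only [Polynomial.eval_add, Data.size]; omega
  | monomial n a h =>
    obtain ⟨u, hu, hu'⟩ := h
    -- Consing `x` once for every constructor of `u x` multiplies the size by at least `x.size`,
    -- which accounts for one more factor `X`.
    refine ⟨_, iterateCons ident (sizeList.comp hu) nil, fun x => ?_⟩
    have hs : ∀ i b, i * x.size ≤ ((fun s => Data.cons x s)^[i] b).size := by
      intro i
      induction i with
      | zero => simp
      | succ i ih =>
        intro b
        rw [Function.iterate_succ_apply', add_mul, one_mul]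
        simp only [Data.size]; have := ih b; omega
    rw [length_toList_unary]
    refine le_trans ?_ (hs _ _)
    rw [pow_succ, ← mul_assoc, Polynomial.eval_mul, Polynomial.eval_X]
    exact Nat.mul_le_mul_right _ (hu' x)

theorem iterate_snd_unary (m n : ℕ) : Data.snd^[m] (unary n) = unary (n - m) := by
  induction m generalizing n with
  | zero => simp
  | succ m ih =>
    rw [Function.iterate_succ_apply]
    cases n with
    | zero => simpa [unary, Data.ofList, Data.snd] using ih 0
    | succ n => rw [unary_succ, Data.snd_cons, ih]; congr 1; omega

theorem unary_eq_nil {n : ℕ} : unary n = .nil ↔ n = 0 := by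
  cases n <;> simp [unary, Data.ofList, List.replicate_succ]

/-- Case distinction on the comparison of two sizes. -/
theorem iteSizeLe {u v : Data → Data} (hu : PolyTime u) (hv : PolyTime v) (hf : PolyTime f)
    (hg : PolyTime g) : PolyTime fun x => if (u x).size ≤ (v x).size then f x else g x := by
  -- Truncated subtraction of unary sizes: the result is `nil` exactly if the first size is at most
  -- the second.
  refine (ite (iterateSnd (sizeList.comp hu) (sizeList.comp hv)) hg hf).congr fun x => ?_
  simp only [length_toList_unary, iterate_snd_unary, unary_eq_nil]
  congr 1; simp [Nat.sub_eq_zero_iff_le]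

/-- A left fold in which all states that are larger than a given polynomial are replaced. -/
theorem foldTrunc {c l s₀ : Data → Data} (hc : PolyTime c) (hl : PolyTime l) (hs₀ : PolyTime s₀)
    (hg : PolyTime g) (b : Polynomial ℕ) : ∃ u : Data → Data, PolyTime u ∧
    ∀ x, (∀ i, (((l x).toList.take i).foldl
      (fun s a => g (.cons (c x) (.cons s a))) (s₀ x)).size ≤ b.eval x.size) →
      u x = (l x).toList.foldl (fun s a => g (.cons (c x) (.cons s a))) (s₀ x) := by
  obtain ⟨t, ht, ht'⟩ := exists_size_ge b
  obtain ⟨bt, hbt⟩ := ht.size_le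
  obtain ⟨bs, hbs⟩ := hs₀.size_le
  -- `fold` wants its size bound on all data, including those that represent nothing. Discarding
  -- oversized states enforces the bound everywhere and changes nothing where it holds anyway. The
  -- yardstick `t x` travels in the context.
  let G : Data → Data := fun z => if (g (.cons z.fst.snd z.snd)).size ≤ z.fst.fst.size then
    g (.cons z.fst.snd z.snd) else .nil
  have hg' : PolyTime fun z : Data => g (.cons z.fst.snd z.snd) := hg.comp (fst'.snd.cons snd')
  have hG : PolyTime G := iteSizeLe hg' fst'.fst hg' nil
  have hGs : ∀ z, (G z).size ≤ z.fst.fst.size + 1 := by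
    intro z
    by_cases h : (g (.cons z.fst.snd z.snd)).size ≤ z.fst.fst.size
    · simp only [G, if_pos h]; omega
    · simp only [G, if_neg h, Data.size]; omega
  refine ⟨_, fold (ht.cons hc) hl hs₀ hG (bs + bt + 1) fun x i => ?_, fun x hx => ?_⟩
  · simp only [Polynomial.eval_add, Polynomial.eval_one]
    rcases List.eq_nil_or_concat ((l x).toList.take i) with h | ⟨L, a, h⟩
    · rw [h]; have := hbs x; simp only [List.foldl_nil]; omega
    · rw [h, List.concat_eq_append, List.foldl_append, List.foldl_cons, List.foldl_nil]
      have := hbt x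
      refine (hGs _).trans ?_
      simp only [Data.fst_cons]
      omega
  · have : ∀ i, ((l x).toList.take i).foldl (fun s a => G (.cons (.cons (t x) (c x)) (.cons s a)))
        (s₀ x) = ((l x).toList.take i).foldl (fun s a => g (.cons (c x) (.cons s a))) (s₀ x) := by
      intro i
      induction i with
      | zero => simp
      | succ i ih =>
        have h1 := hx (i + 1)
        rw [List.take_add_one] at h1 ⊢
        rw [List.foldl_append, List.foldl_append, ih]
        rw [List.foldl_append] at h1
        cases hi : (l x).toList[i]? with
        | none => simp
        | some a =>
          simp only [hi, Option.toList_some, List.foldl_cons, List.foldl_nil] at h1 ⊢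
          exact if_pos (h1.trans (ht' x))
    have h := this (l x).toList.length
    rwa [List.take_length] at h

/-- One step of the comparison of trees: the stack holds pairs that have to be equal. -/
def eqStep (z : Data) : Data :=
  let p := z.fst.fst
  if p.fst = .nil then
    .cons z.fst.snd (if p.snd = .nil then z.snd else .cons .nil .nil)
  else
    .cons (.cons (.cons p.fst.fst p.snd.fst) (.cons (.cons p.fst.snd p.snd.snd) z.fst.snd))
      (if p.snd = .nil then .cons .nil .nil else z.snd)

/-- Equality of trees is decidable in polynomial time. -/
theorem iteEq {u v : Data → Data} (hu : PolyTime u) (hv : PolyTime v) (hf : PolyTime f)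
    (hg : PolyTime g) : PolyTime fun x => if u x = v x then f x else g x := by
  have hp : PolyTime fun z : Data => z.fst.fst := ident.fst.fst
  have hstep : PolyTime eqStep :=
    (ite hp.fst
      ((hp.fst.fst.cons hp.snd.fst).cons ((hp.fst.snd.cons hp.snd.snd).cons ident.fst.snd) |>.cons
        (ite hp.snd ident.snd (const (.cons .nil .nil))))
      (ident.fst.snd.cons (ite hp.snd (const (.cons .nil .nil)) ident.snd))).congr fun z => rfl
  -- Only the first components of the stacked pairs are measured. The second ones need no count,
  -- because the projections of `nil` are `nil`; a mismatch of shapes sets the flag `z.snd`.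
  let w : Data → ℕ := fun z => (z.fst.toList.map fun p => p.fst.size).sum
  have hgrow : ∀ z, (eqStep z).size ≤ z.size + 10 := by
    intro z
    rcases z with _ | ⟨_ | ⟨_ | ⟨_ | ⟨a, b⟩, _ | ⟨a', b'⟩⟩, r⟩, s⟩ <;>
      simp [eqStep, Data.size, Data.fst, Data.snd] <;> omega
  obtain ⟨bu, hbu⟩ := hu.size_le
  obtain ⟨bv, hbv⟩ := hv.size_le
  have h := loop (((hu.cons hv).cons nil).cons nil) hstep w ?_ ?_ bu
    (bu + bv + 10 + 10 * bu) ?_ ?_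
  · have hw1 : ∀ n z, w z = n → ((eqStep^[n] z).snd = .nil ↔
        z.snd = .nil ∧ ∀ p ∈ z.fst.toList, p.fst = p.snd) := by
      intro n
      induction n with
      | zero =>
        intro z hz
        rcases z with _ | ⟨_ | ⟨a, r⟩, s⟩
        · simp [Data.snd, Data.fst]
        · simp [Data.snd, Data.fst]
        · have := a.fst.size_pos
          simp [w] at hz; omega
      | succ n ih =>
        intro z hz
        rw [Function.iterate_succ_apply, ih]
        · rcases z with _ | ⟨_ | ⟨_ | ⟨_ | ⟨a, b⟩, _ | ⟨a', b'⟩⟩, r⟩, s⟩ <;>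
            simp [eqStep, Data.fst, Data.snd] <;> tauto
        · rcases z with _ | ⟨_ | ⟨_ | ⟨_ | ⟨a, b⟩, _ | ⟨a', b'⟩⟩, r⟩, s⟩ <;>
            simp [w, eqStep, Data.size, Data.fst, Data.snd, Data.toList] at hz ⊢ <;> omega
    refine (ite h.snd hg hf).congr fun x => ?_
    congr 1
    simp only [eq_iff_iff]
    rw [hw1 _ _ rfl]
    simp
  · intro z
    rcases z with _ | ⟨_ | ⟨a, r⟩, s⟩
    · simp [w, Data.fst, Data.toList]
    · simp [w, Data.fst, Data.toList]
    · have := a.fst.size_pos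
      simp [w]; omega
  · intro z hz
    rcases z with _ | ⟨_ | ⟨_ | ⟨_ | ⟨a, b⟩, _ | ⟨a', b'⟩⟩, r⟩, s⟩ <;>
      simp [w, eqStep, Data.size, Data.fst, Data.snd, Data.toList] at hz ⊢ <;> omega
  · intro x
    simpa [w] using hbu x
  · intro x i hi
    have : ∀ i z, (eqStep^[i] z).size ≤ z.size + 10 * i := by
      intro i z
      induction i with
      | zero => simp
      | succ i ih => rw [Function.iterate_succ_apply']; have := hgrow (eqStep^[i] z); omega
    have h1 := this i (((((u x).cons (v x)).cons .nil)).cons .nil)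
    have h2 := hbu x
    have h3 := hbv x
    simp only [Polynomial.eval_add, Polynomial.eval_mul, w, Data.fst_cons,
      Data.toList_cons, Data.toList_nil, List.map_cons, List.map_nil, List.sum_cons, List.sum_nil,
      Polynomial.eval_ofNat, Data.size] at *
    omega

end PolyTime

/-! ## Feasible functions -/

/-- Representations by data. In contrast to `Code`, no decoder is required. -/
class DataRep (α : Type) where
  rep : α → Data

open DataRep

instance : DataRep Data := ⟨id⟩

instance : DataRep Unit := ⟨fun _ => .nil⟩

instance : DataRep ℕ := ⟨unary⟩

instance : DataRep (ZMod 2) := ⟨fun b => if b = 0 then .nil else .cons .nil .nil⟩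

instance : DataRep Bool := ⟨fun b => if b then .cons .nil .nil else .nil⟩

instance {n : ℕ} : DataRep (Fin n) := ⟨fun i => unary i⟩

instance {α β : Type} [DataRep α] [DataRep β] : DataRep (α × β) := ⟨fun x => .cons (rep x.1) (rep x.2)⟩

instance {α : Type} [DataRep α] : DataRep (Option α) where
  rep x := match x with
    | none => .nil
    | some a => .cons (rep a) .nil

instance {α : Type} [DataRep α] : DataRep (List α) := ⟨fun l => Data.ofList (l.map rep)⟩

instance {α : Type} {n : ℕ} [DataRep α] : DataRep (Fin n → α) :=
  ⟨fun v => Data.ofList (List.ofFn fun i => rep (v i))⟩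

/-! ### Representations of lists and their sizes -/

section rep

variable {α β : Type} [DataRep α] [DataRep β]

theorem rep_nat (n : ℕ) : rep n = unary n := rfl

theorem rep_pair (a : α) (b : β) : rep (a, b) = .cons (rep a) (rep b) := rfl

theorem rep_prod (x : α × β) : rep x = .cons (rep x.1) (rep x.2) := rfl

theorem rep_nil : rep ([] : List α) = .nil := rfl

theorem rep_cons (a : α) (l : List α) : rep (a :: l) = .cons (rep a) (rep l) := rfl

theorem rep_none : rep (none : Option α) = .nil := rfl

theorem rep_some (a : α) : rep (some a) = .cons (rep a) .nil := rfl

theorem rep_ofFn {n : ℕ} (v : Fin n → α) : rep (List.ofFn v) = rep v := by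
  change Data.ofList ((List.ofFn v).map rep) = Data.ofList (List.ofFn fun i => rep (v i))
  rw [List.map_ofFn]; rfl

theorem rep_false : rep false = .nil := rfl

theorem rep_true : rep true = .cons .nil .nil := rfl

theorem rep_replicate (n : ℕ) : rep (List.replicate n ()) = unary n := by
  change Data.ofList _ = Data.ofList _
  rw [List.map_replicate]; rfl

theorem toList_rep (l : List α) : (rep l).toList = l.map rep := Data.toList_ofList _

theorem size_rep_append (l m : List α) :
    (rep (l ++ m)).size + 1 = (rep l).size + (rep m).size := by
  induction l with
  | nil => simp [rep_nil, Data.size]; omega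
  | cons a l ih => simp only [List.cons_append, rep_cons, Data.size]; omega

theorem size_rep_sublist {l m : List α} (h : l.Sublist m) : (rep l).size ≤ (rep m).size := by
  induction h with
  | slnil => rfl
  | cons _ _ ih => simp only [rep_cons, Data.size]; omega
  | cons_cons _ _ ih => simp only [rep_cons, Data.size]; omega

theorem size_rep_mem {l : List α} {a : α} (h : a ∈ l) : (rep a).size ≤ (rep l).size := by
  have := size_rep_sublist (List.singleton_sublist.2 h)
  simp only [rep_cons, Data.size] at this; omega

theorem length_le_size_rep (l : List α) : l.length ≤ (rep l).size := by
  have := Data.length_toList_le (rep l)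
  rwa [toList_rep, List.length_map] at this

theorem size_rep_le {l : List α} {n : ℕ} (h : ∀ a ∈ l, (rep a).size ≤ n) :
    (rep l).size ≤ l.length * (n + 1) + 1 := by
  induction l with
  | nil => simp [rep_nil, Data.size]
  | cons a l ih =>
    have h1 := ih fun b hb => h b (List.mem_cons_of_mem _ hb)
    have h2 := h a List.mem_cons_self
    simp only [rep_cons, Data.size, List.length_cons, add_mul, one_mul]; omega

theorem size_rep_reverse (l : List α) : (rep l.reverse).size = (rep l).size := by
  induction l with
  | nil => rfl
  | cons a l ih =>
    have := size_rep_append l.reverse [a]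
    simp only [List.reverse_cons, rep_cons, rep_nil, Data.size] at *; omega

end rep

/-- A family of functions is feasible if one program computes the representation of the value from
the security parameter and the representation of the argument in polynomial time. -/
def Feasible {α β : ℕ → Type} [∀ κ, DataRep (α κ)] [∀ κ, DataRep (β κ)] (f : ∀ κ, α κ → β κ) : Prop :=
  ∃ F : Data → Data, PolyTime F ∧ ∀ κ (x : α κ), F (.cons (rep κ) (rep x)) = rep (f κ x)

/-- All members of the family of types have representations of polynomial size. -/
def PolySize (σ : ℕ → Type) [∀ κ, DataRep (σ κ)] : Prop :=
  ∃ c : Polynomial ℕ, ∀ κ (s : σ κ), (rep s).size ≤ c.eval κ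

/-! ### Combinators for feasible functions -/

namespace Feasible

variable {α β γ δ σ : ℕ → Type} [∀ κ, DataRep (α κ)] [∀ κ, DataRep (β κ)] [∀ κ, DataRep (γ κ)]
  [∀ κ, DataRep (δ κ)] [∀ κ, DataRep (σ κ)]

theorem recast {f : ∀ κ, α κ → β κ} {g : ∀ κ, α κ → γ κ} (hf : Feasible f)
    (h : ∀ κ x, rep (f κ x) = rep (g κ x)) : Feasible g := by
  obtain ⟨F, hF, e⟩ := hf
  exact ⟨F, hF, fun κ x => (e κ x).trans (h κ x)⟩

theorem congr {f g : ∀ κ, α κ → β κ} (hf : Feasible f) (h : ∀ κ x, f κ x = g κ x) : Feasible g :=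
  hf.recast fun κ x => by rw [h]

theorem size_le {f : ∀ κ, α κ → β κ} (hf : Feasible f) : ∃ c : Polynomial ℕ,
    ∀ κ x, (rep (f κ x)).size ≤ c.eval (Data.cons (rep κ) (rep x)).size := by
  obtain ⟨F, hF, e⟩ := hf
  obtain ⟨c, hc⟩ := hF.size_le
  exact ⟨c, fun κ x => e κ x ▸ hc _⟩

theorem id : Feasible fun κ (x : α κ) => x := ⟨_, .snd', fun _ _ => rfl⟩

theorem kappa : Feasible fun κ (_ : α κ) => κ := ⟨_, .fst', fun _ _ => rfl⟩

theorem const (d : Data) {f : ∀ κ, α κ → β κ} (h : ∀ κ x, rep (f κ x) = d) : Feasible f :=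
  ⟨_, .const d, fun κ x => (h κ x).symm⟩

theorem comp {g : ∀ κ, β κ → γ κ} {f : ∀ κ, α κ → β κ} (hg : Feasible g) (hf : Feasible f) :
    Feasible fun κ x => g κ (f κ x) := by
  obtain ⟨F, hF, e⟩ := hf
  obtain ⟨G, hG, e'⟩ := hg
  exact ⟨_, hG.comp (PolyTime.fst'.cons hF), fun κ x => by rw [e, ← e']; rfl⟩

theorem param {c : ∀ κ, β κ} (hc : Feasible fun κ (_ : Unit) => c κ) :
    Feasible fun κ (_ : α κ) => c κ :=
  hc.comp (const (f := fun _ _ => ()) .nil fun _ _ => rfl)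

theorem pair {f : ∀ κ, α κ → β κ} {g : ∀ κ, α κ → γ κ} (hf : Feasible f) (hg : Feasible g) :
    Feasible fun κ x => (f κ x, g κ x) := by
  obtain ⟨F, hF, e⟩ := hf
  obtain ⟨G, hG, e'⟩ := hg
  exact ⟨_, hF.cons hG, fun κ x => by rw [e, e']; rfl⟩

theorem fst {f : ∀ κ, α κ → β κ × γ κ} (hf : Feasible f) : Feasible fun κ x => (f κ x).1 := by
  obtain ⟨F, hF, e⟩ := hf
  exact ⟨_, hF.fst, fun κ x => by rw [e]; rfl⟩

theorem snd {f : ∀ κ, α κ → β κ × γ κ} (hf : Feasible f) : Feasible fun κ x => (f κ x).2 := by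
  obtain ⟨F, hF, e⟩ := hf
  exact ⟨_, hF.snd, fun κ x => by rw [e]; rfl⟩

/-- Substitution into a function of two arguments. -/
theorem comp₂ {g : ∀ κ, β κ → γ κ → δ κ} {f₁ : ∀ κ, α κ → β κ} {f₂ : ∀ κ, α κ → γ κ}
    (hg : Feasible fun κ (y : β κ × γ κ) => g κ y.1 y.2) (h₁ : Feasible f₁) (h₂ : Feasible f₂) :
    Feasible fun κ x => g κ (f₁ κ x) (f₂ κ x) :=
  hg.comp (h₁.pair h₂)

/-! ### Case distinctions -/

theorem cond {b : ∀ κ, α κ → Bool} {f g : ∀ κ, α κ → β κ} (hb : Feasible b) (hf : Feasible f)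
    (hg : Feasible g) : Feasible fun κ x => if b κ x = true then f κ x else g κ x := by
  obtain ⟨B, hB, eb⟩ := hb
  obtain ⟨F, hF, e⟩ := hf
  obtain ⟨G, hG, e'⟩ := hg
  refine ⟨_, hB.ite hF hG, fun κ x => ?_⟩
  rw [e, e', eb]
  beta_reduce
  cases b κ x <;> simp [rep_true, rep_false]

theorem ite {p : ∀ κ, α κ → Prop} [∀ κ x, Decidable (p κ x)] {f g : ∀ κ, α κ → β κ}
    (hp : Feasible fun κ x => decide (p κ x)) (hf : Feasible f) (hg : Feasible g) :
    Feasible fun κ x => if p κ x then f κ x else g κ x :=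
  (hp.cond hf hg).congr fun κ x => by simp

theorem bfalse : Feasible fun κ (_ : α κ) => false := const .nil fun _ _ => rfl

theorem btrue : Feasible fun κ (_ : α κ) => true := const (.cons .nil .nil) fun _ _ => rfl

theorem dand {p q : ∀ κ, α κ → Prop} [∀ κ x, Decidable (p κ x)] [∀ κ x, Decidable (q κ x)]
    [∀ κ x, Decidable (p κ x ∧ q κ x)]
    (hp : Feasible fun κ x => decide (p κ x)) (hq : Feasible fun κ x => decide (q κ x)) :
    Feasible fun κ x => decide (p κ x ∧ q κ x) :=
  (hp.cond hq bfalse).congr fun κ x => by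
    by_cases h : p κ x <;> simp [h]

theorem dnot {p : ∀ κ, α κ → Prop} [∀ κ x, Decidable (p κ x)] [∀ κ x, Decidable (¬ p κ x)]
    (hp : Feasible fun κ x => decide (p κ x)) : Feasible fun κ x => decide (¬ p κ x) :=
  (hp.cond bfalse btrue).congr fun κ x => by
    by_cases h : p κ x <;> simp [h]

theorem deq {f g : ∀ κ, α κ → β κ} [∀ κ x, Decidable (f κ x = g κ x)]
    (inj : ∀ κ, Function.Injective (rep : β κ → Data)) (hf : Feasible f) (hg : Feasible g) :
    Feasible fun κ x => decide (f κ x = g κ x) := by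
  obtain ⟨F, hF, e⟩ := hf
  obtain ⟨G, hG, e'⟩ := hg
  refine ⟨_, PolyTime.iteEq hF hG (.const (.cons .nil .nil)) .nil, fun κ x => ?_⟩
  rw [e, e']
  by_cases h : f κ x = g κ x
  · simp [h, rep_true]
  · rw [if_neg fun h' => h (inj κ h')]; simp [h, rep_false]

/-! ### Options -/

theorem onone : Feasible fun κ (_ : α κ) => (none : Option (β κ)) := const .nil fun _ _ => rfl

theorem osome {f : ∀ κ, α κ → β κ} (hf : Feasible f) : Feasible fun κ x => some (f κ x) := by
  obtain ⟨F, hF, e⟩ := hf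
  exact ⟨_, hF.cons .nil, fun κ x => by rw [e]; rfl⟩

theorem oelim {o : ∀ κ, α κ → Option (β κ)} {n : ∀ κ, α κ → γ κ} {s : ∀ κ, α κ → β κ → γ κ}
    (ho : Feasible o) (hn : Feasible n) (hs : Feasible fun κ (y : α κ × β κ) => s κ y.1 y.2) :
    Feasible fun κ x => (o κ x).elim (n κ x) (s κ x) := by
  obtain ⟨O, hO, eo⟩ := ho
  obtain ⟨N, hN, en⟩ := hn
  obtain ⟨F, hF, es⟩ := hs
  refine ⟨_, hO.ite (hF.comp (PolyTime.fst'.cons (PolyTime.snd'.cons hO.fst))) hN, fun κ x => ?_⟩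
  rw [eo]
  beta_reduce
  cases h : o κ x with
  | none => simp [rep_none, en]
  | some a => simpa [rep_some, rep_pair] using es κ (x, a)

theorem obind {o : ∀ κ, α κ → Option (β κ)} {s : ∀ κ, α κ → β κ → Option (γ κ)}
    (ho : Feasible o) (hs : Feasible fun κ (y : α κ × β κ) => s κ y.1 y.2) :
    Feasible fun κ x => (o κ x).bind (s κ x) :=
  (oelim ho onone hs).congr fun κ x => by cases o κ x <;> rfl

/-! ### Lists -/

theorem lnil : Feasible fun κ (_ : α κ) => ([] : List (β κ)) := const .nil fun _ _ => rfl

theorem lcons {f : ∀ κ, α κ → β κ} {l : ∀ κ, α κ → List (β κ)} (hf : Feasible f)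
    (hl : Feasible l) : Feasible fun κ x => f κ x :: l κ x := by
  obtain ⟨F, hF, e⟩ := hf
  obtain ⟨G, hG, e'⟩ := hl
  exact ⟨_, hF.cons hG, fun κ x => by rw [e, e']; rfl⟩

theorem ltail {l : ∀ κ, α κ → List (β κ)} (hl : Feasible l) : Feasible fun κ x => (l κ x).tail := by
  obtain ⟨G, hG, e'⟩ := hl
  exact ⟨_, hG.snd, fun κ x => by rw [e']; beta_reduce; cases l κ x <;> rfl⟩

theorem lhead? {l : ∀ κ, α κ → List (β κ)} (hl : Feasible l) :
    Feasible fun κ x => (l κ x).head? := by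
  obtain ⟨G, hG, e'⟩ := hl
  refine ⟨_, hG.ite (hG.fst.cons .nil) .nil, fun κ x => ?_⟩
  rw [e']
  beta_reduce
  cases h : l κ x <;> simp [rep_nil, rep_none, rep_cons, rep_some]

theorem lheadD {l : ∀ κ, α κ → List (β κ)} {d : ∀ κ, α κ → β κ} (hl : Feasible l)
    (hd : Feasible d) : Feasible fun κ x => (l κ x).headD (d κ x) :=
  (hl.lhead?.oelim hd (id.snd)).congr fun κ x => by cases l κ x <;> rfl

/-- Intermediate states need a polynomial bound only for genuine arguments; `PolyTime.foldTrunc`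
deals with data that represent nothing. -/
theorem foldl {l : ∀ κ, α κ → List (β κ)} {s₀ : ∀ κ, α κ → σ κ}
    {step : ∀ κ, α κ → σ κ → β κ → σ κ} (hl : Feasible l) (hs₀ : Feasible s₀)
    (hstep : Feasible fun κ (y : α κ × σ κ × β κ) => step κ y.1 y.2.1 y.2.2)
    (hb : ∃ b : Polynomial ℕ, ∀ κ x i, (rep (((l κ x).take i).foldl (step κ x) (s₀ κ x))).size ≤
      b.eval (Data.cons (rep κ) (rep x)).size) :
    Feasible fun κ x => (l κ x).foldl (step κ x) (s₀ κ x) := by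
  obtain ⟨L, hL, el⟩ := hl
  obtain ⟨Z, hZ, ez⟩ := hs₀
  obtain ⟨F, hF, e⟩ := hstep
  obtain ⟨b, hb⟩ := hb
  have hg : PolyTime fun z : Data => F (.cons z.fst.fst (.cons z.fst.snd z.snd)) :=
    hF.comp (PolyTime.fst'.fst.cons (PolyTime.fst'.snd.cons PolyTime.snd'))
  obtain ⟨u, hu, e'⟩ := PolyTime.foldTrunc .ident hL hZ hg b
  have key : ∀ κ x (m : List (β κ)) s, (m.map rep).foldl (fun s a =>
      F (.cons (rep κ) (.cons (rep x) (.cons s a)))) (rep s) = rep (m.foldl (step κ x) s) := by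
    intro κ x m
    induction m with
    | nil => intro s; rfl
    | cons a m ih =>
      intro s
      rw [List.map_cons, List.foldl_cons, List.foldl_cons, ← ih]
      congr 1
      exact e κ (x, s, a)
  refine ⟨u, hu, fun κ x => ?_⟩
  rw [e']
  · simp only [Data.fst_cons, Data.snd_cons]
    rw [el, ez, toList_rep, key]
  · intro i
    simp only [Data.fst_cons, Data.snd_cons]
    rw [el, ez, toList_rep, ← List.map_take, key]
    exact hb κ x i

theorem foldl_polySize {l : ∀ κ, α κ → List (β κ)} {s₀ : ∀ κ, α κ → σ κ}
    {step : ∀ κ, α κ → σ κ → β κ → σ κ} (hσ : PolySize σ) (hl : Feasible l) (hs₀ : Feasible s₀)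
    (hstep : Feasible fun κ (y : α κ × σ κ × β κ) => step κ y.1 y.2.1 y.2.2) :
    Feasible fun κ x => (l κ x).foldl (step κ x) (s₀ κ x) := by
  refine foldl hl hs₀ hstep ?_
  obtain ⟨c, hc⟩ := hσ
  refine ⟨c, fun κ x i => (hc κ _).trans (polynomial_eval_mono c ?_)⟩
  simp only [Data.size, rep_nat, size_unary]
  omega

theorem lreverse {l : ∀ κ, α κ → List (β κ)} (hl : Feasible l) :
    Feasible fun κ x => (l κ x).reverse := by
  refine (foldl (σ := fun κ => List (β κ)) (step := fun κ _ s a => a :: s) hl lnil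
    (id.snd.snd.lcons id.snd.fst) ?_).congr fun κ x => ?_
  · obtain ⟨c, hc⟩ := hl.size_le
    refine ⟨c, fun κ x i => ?_⟩
    have : ∀ m : List (β κ), m.foldl (fun s a => a :: s) [] = m.reverse := by simp
    rw [this, size_rep_reverse]
    exact (size_rep_sublist (List.take_sublist _ _)).trans (hc κ x)
  · simp

/-- Computed as a left fold over the reversed list. The intermediate states are right folds over
suffixes of the list, and sublists are a convenient class containing them; hence the form of the
bound. -/
theorem foldr {l : ∀ κ, α κ → List (β κ)} {s₀ : ∀ κ, α κ → σ κ}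
    {step : ∀ κ, α κ → β κ → σ κ → σ κ} (hl : Feasible l) (hs₀ : Feasible s₀)
    (hstep : Feasible fun κ (y : α κ × σ κ × β κ) => step κ y.1 y.2.2 y.2.1)
    (hb : ∃ b : Polynomial ℕ, ∀ κ x (m : List (β κ)), m.Sublist (l κ x) →
      (rep (m.foldr (step κ x) (s₀ κ x))).size ≤ b.eval (Data.cons (rep κ) (rep x)).size) :
    Feasible fun κ x => (l κ x).foldr (step κ x) (s₀ κ x) := by
  refine (foldl (step := fun κ x s a => step κ x a s) hl.lreverse hs₀ hstep ?_).congr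
    fun κ x => by simp
  obtain ⟨b, hb⟩ := hb
  refine ⟨b, fun κ x i => ?_⟩
  rw [List.foldl_eq_foldr_reverse]
  refine hb κ x _ ?_
  simpa using (List.take_sublist i (l κ x).reverse).reverse

theorem foldr_polySize {l : ∀ κ, α κ → List (β κ)} {s₀ : ∀ κ, α κ → σ κ}
    {step : ∀ κ, α κ → β κ → σ κ → σ κ} (hσ : PolySize σ) (hl : Feasible l) (hs₀ : Feasible s₀)
    (hstep : Feasible fun κ (y : α κ × σ κ × β κ) => step κ y.1 y.2.2 y.2.1) :
    Feasible fun κ x => (l κ x).foldr (step κ x) (s₀ κ x) :=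
  (foldl_polySize (step := fun κ x s a => step κ x a s) hσ hl.lreverse hs₀ hstep).congr
    fun κ x => by simp

theorem lmap {l : ∀ κ, α κ → List (β κ)} {f : ∀ κ, α κ → β κ → γ κ} (hl : Feasible l)
    (hf : Feasible fun κ (y : α κ × β κ) => f κ y.1 y.2) :
    Feasible fun κ x => (l κ x).map (f κ x) := by
  refine (foldr (σ := fun κ => List (γ κ)) (step := fun κ x a s => f κ x a :: s) hl lnil
    (lcons (hf.comp₂ id.fst id.snd.snd) id.snd.fst) ?_).congr fun κ x => ?_
  · obtain ⟨c, hc⟩ := hl.size_le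
    obtain ⟨d, hd⟩ := hf.size_le
    refine ⟨c * (d.comp (Polynomial.X + 1 + c) + 1) + 1, fun κ x m hm => ?_⟩
    have e : ∀ m : List (β κ), m.foldr (fun a s => f κ x a :: s) [] = m.map (f κ x) := by
      intro m; induction m <;> simp_all
    rw [e]
    have h1 := hc κ x
    refine (size_rep_le (n := d.eval ((Data.cons (rep κ) (rep x)).size + 1 +
      c.eval (Data.cons (rep κ) (rep x)).size)) ?_).trans ?_
    · intro a ha
      obtain ⟨b, hb, rfl⟩ := List.mem_map.1 ha
      refine (hd κ (x, b)).trans (polynomial_eval_mono d ?_)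
      have := size_rep_mem (hm.subset hb)
      simp only [rep_pair, Data.size] at *
      omega
    · simp only [Polynomial.eval_add, Polynomial.eval_mul, Polynomial.eval_one,
        Polynomial.eval_comp, Polynomial.eval_X, List.length_map]
      have := (hm.length_le.trans (length_le_size_rep _)).trans h1
      gcongr
  · induction l κ x <;> simp_all

theorem lfind? {l : ∀ κ, α κ → List (β κ)} {p : ∀ κ, α κ → β κ → Bool} (hl : Feasible l)
    (hp : Feasible fun κ (y : α κ × β κ) => p κ y.1 y.2) :
    Feasible fun κ x => (l κ x).find? (p κ x) := by
  have e : ∀ κ x (m : List (β κ)), m.foldr (fun a s => if p κ x a = true then some a else s) none =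
      m.find? (p κ x) := by
    intro κ x m
    induction m with
    | nil => rfl
    | cons a m ih =>
      rw [List.foldr_cons, List.find?_cons, ih]
      cases p κ x a <;> simp
  refine (foldr (σ := fun κ => Option (β κ))
    (step := fun κ x a s => if p κ x a = true then some a else s) hl onone
    (cond (hp.comp₂ id.fst id.snd.snd) id.snd.snd.osome id.snd.fst) ?_).congr fun κ x => e κ x _
  obtain ⟨c, hc⟩ := hl.size_le
  refine ⟨c + 2, fun κ x m hm => ?_⟩
  rw [e]
  have h1 := hc κ x
  simp only [Polynomial.eval_add, Polynomial.eval_ofNat]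
  cases h : m.find? (p κ x) with
  | none => simp only [rep_none, Data.size]; omega
  | some a =>
    have h2 := size_rep_mem (hm.subset (List.mem_of_find?_eq_some h))
    have h3 : (rep (some a)).size = (rep a).size + 1 + 1 := rfl
    omega

theorem lappend {l m : ∀ κ, α κ → List (β κ)} (hl : Feasible l) (hm : Feasible m) :
    Feasible fun κ x => l κ x ++ m κ x := by
  refine (foldr (σ := fun κ => List (β κ)) (step := fun κ x a s => a :: s) hl hm
    (id.snd.snd.lcons id.snd.fst) ?_).congr fun κ x => by simp
  obtain ⟨c, hc⟩ := hl.size_le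
  obtain ⟨d, hd⟩ := hm.size_le
  refine ⟨c + d, fun κ x k hk => ?_⟩
  rw [List.foldr_cons_eq_append]
  have := size_rep_append (k.map fun a => a) (m κ x)
  have := hc κ x
  have := hd κ x
  have := size_rep_sublist hk
  simp only [Polynomial.eval_add, List.map_id'] at *
  omega

/-! ### Natural numbers -/

theorem toUnits {n : ∀ κ, α κ → ℕ} (hn : Feasible n) :
    Feasible fun κ x => List.replicate (n κ x) () :=
  hn.recast fun _ _ => (rep_replicate _).symm

theorem ofUnits {n : ∀ κ, α κ → ℕ} (hn : Feasible fun κ x => List.replicate (n κ x) ()) :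
    Feasible n :=
  hn.recast fun _ _ => rep_replicate _

theorem num (n : ℕ) : Feasible fun κ (_ : α κ) => n := const (unary n) fun _ _ => rfl

theorem val {n : ℕ → ℕ} {f : ∀ κ, α κ → Fin (n κ)} (hf : Feasible f) :
    Feasible fun κ x => (f κ x : ℕ) := hf.recast fun _ _ => rfl

theorem ofVal {n : ℕ → ℕ} {f : ∀ κ, α κ → Fin (n κ)} (hf : Feasible fun κ x => (f κ x : ℕ)) :
    Feasible f := hf.recast fun _ _ => rfl

theorem add {m n : ∀ κ, α κ → ℕ} (hm : Feasible m) (hn : Feasible n) :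
    Feasible fun κ x => m κ x + n κ x :=
  ofUnits ((hm.toUnits.lappend hn.toUnits).congr fun κ x => by simp)

theorem llength {l : ∀ κ, α κ → List (β κ)} (hl : Feasible l) :
    Feasible fun κ x => (l κ x).length :=
  ofUnits ((lmap (f := fun _ _ _ => ()) hl (const .nil fun _ _ => rfl)).congr fun κ x => by simp)

theorem ldrop {n : ∀ κ, α κ → ℕ} {l : ∀ κ, α κ → List (β κ)} (hn : Feasible n) (hl : Feasible l) :
    Feasible fun κ x => (l κ x).drop (n κ x) := by
  obtain ⟨N, hN, en⟩ := hn
  obtain ⟨L, hL, el⟩ := hl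
  refine ⟨_, hL.iterateSnd hN, fun κ x => ?_⟩
  rw [en, el, rep_nat, length_toList_unary]
  beta_reduce
  generalize n κ x = k
  generalize l κ x = m
  induction k generalizing m with
  | zero => rfl
  | succ k ih =>
    rw [Function.iterate_succ_apply]
    cases m with
    | nil => simpa [rep_nil, Data.snd] using ih []
    | cons a m => simpa [rep_cons] using ih m

theorem sub {m n : ∀ κ, α κ → ℕ} (hm : Feasible m) (hn : Feasible n) :
    Feasible fun κ x => m κ x - n κ x :=
  ofUnits ((ldrop hn hm.toUnits).congr fun κ x => by simp)

theorem ltake {n : ∀ κ, α κ → ℕ} {l : ∀ κ, α κ → List (β κ)} (hn : Feasible n) (hl : Feasible l) :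
    Feasible fun κ x => (l κ x).take (n κ x) :=
  (ldrop (hl.llength.sub hn) hl.lreverse).lreverse.congr fun κ x => by
    rw [List.drop_reverse, List.reverse_reverse]
    rcases le_total (n κ x) (l κ x).length with h | h
    · rw [Nat.sub_sub_self h]
    · rw [Nat.sub_eq_zero_of_le h, Nat.sub_zero, List.take_length, List.take_of_length_le h]

theorem rep_nat_injective : Function.Injective (rep : ℕ → Data) := by
  intro m n h
  simpa [rep_nat, size_unary] using congrArg Data.size h

theorem dle {m n : ∀ κ, α κ → ℕ} (hm : Feasible m) (hn : Feasible n) :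
    Feasible fun κ x => decide (m κ x ≤ n κ x) :=
  (deq (fun _ => rep_nat_injective) (hm.sub hn) (num 0)).congr fun κ x => by
    simp [Nat.sub_eq_zero_iff_le]

theorem dlt {m n : ∀ κ, α κ → ℕ} (hm : Feasible m) (hn : Feasible n) :
    Feasible fun κ x => decide (m κ x < n κ x) :=
  (dle (hm.add (num 1)) hn).congr fun κ x => by simp

theorem lrange {n : ∀ κ, α κ → ℕ} (hn : Feasible n) : Feasible fun κ x => List.range (n κ x) := by
  -- Each step prepends the length of the list built so far, so the range appears in reverse.
  have e : ∀ (m : List Unit), m.foldl (fun s _ => s.length :: s) [] =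
      (List.range m.length).reverse := by
    intro m
    induction m using List.reverseRecOn with
    | nil => rfl
    | append_singleton m a ih => rw [List.foldl_append, ih]; simp [List.range_succ]
  refine (foldl (σ := fun _ => List ℕ) (step := fun κ _ s _ => s.length :: s) hn.toUnits lnil
    (id.snd.fst.llength.lcons id.snd.fst) ?_).lreverse.congr fun κ x => ?_
  · obtain ⟨c, hc⟩ := hn.size_le
    refine ⟨c * (2 * c + 2) + 1, fun κ x i => ?_⟩
    have h1 := hc κ x
    rw [rep_nat, size_unary] at h1
    rw [e, size_rep_reverse]
    have h2 : (List.take i (List.replicate (n κ x) ())).length ≤ n κ x := by simp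
    refine (size_rep_le (n := 2 * (n κ x) + 1) fun a ha => ?_).trans ?_
    · have := List.mem_range.1 ha
      rw [rep_nat, size_unary]; omega
    · rw [List.length_range]
      simp only [Polynomial.eval_add, Polynomial.eval_mul, Polynomial.eval_one,
        Polynomial.eval_ofNat]
      gcongr <;> omega
  · rw [e]; simp

theorem finRange {n : ℕ → ℕ} (hn : Feasible fun κ (_ : Unit) => n κ) :
    Feasible fun κ (_ : α κ) => List.finRange (n κ) :=
  hn.param.lrange.recast fun κ x => by
    change Data.ofList _ = Data.ofList _
    rw [← List.map_coe_finRange_eq_range, List.map_map]; rfl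

/-! ### Tuples -/

theorem toList {n : ℕ → ℕ} {f : ∀ κ, α κ → Fin (n κ) → β κ} (hf : Feasible f) :
    Feasible fun κ x => List.ofFn (f κ x) :=
  hf.recast fun _ _ => (rep_ofFn _).symm

theorem lam {n : ℕ → ℕ} {f : ∀ κ, α κ → Fin (n κ) → β κ} (hn : Feasible fun κ (_ : Unit) => n κ)
    (hf : Feasible fun κ (y : α κ × Fin (n κ)) => f κ y.1 y.2) : Feasible f :=
  (lmap (finRange hn) hf).recast fun κ x => by rw [← rep_ofFn, List.ofFn_eq_map]

theorem app {n : ℕ → ℕ} {f : ∀ κ, α κ → Fin (n κ) → β κ} {i : ∀ κ, α κ → Fin (n κ)}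
    (hf : Feasible f) (hi : Feasible i) : Feasible fun κ x => f κ x (i κ x) := by
  obtain ⟨L, hL, el⟩ := ldrop hi.val hf.toList
  refine ⟨_, hL.fst, fun κ x => ?_⟩
  rw [el]
  beta_reduce
  rw [List.drop_eq_getElem_cons (by simp), rep_cons, Data.fst_cons, List.getElem_ofFn]

end Feasible

/-! ## Further feasible functions -/

section rep

variable {α β : Type} [DataRep α] [DataRep β]

theorem rep_fin_injective {n : ℕ} : Function.Injective (rep : Fin n → Data) :=
  fun _ _ h => Fin.val_injective (Feasible.rep_nat_injective h)

theorem rep_zmod_injective : Function.Injective (rep : ZMod 2 → Data) := by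
  intro a b h
  have : ∀ a b : ZMod 2, (if a = 0 then Data.nil else .cons .nil .nil) =
    (if b = 0 then Data.nil else .cons .nil .nil) → a = b := by decide
  exact this a b h

theorem rep_tuple_injective {n : ℕ} (h : Function.Injective (rep : α → Data)) :
    Function.Injective (rep : (Fin n → α) → Data) := by
  intro v w e
  have := congrArg Data.toList e
  simp only [rep, Data.toList_ofList, List.ofFn_inj] at this
  exact funext fun i => h (congrFun this i)

end rep

/-! ### Types whose elements have polynomial size -/

namespace PolySize

variable {β γ : ℕ → Type} [∀ κ, DataRep (β κ)] [∀ κ, DataRep (γ κ)]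

theorem zmod : PolySize fun _ => ZMod 2 := ⟨3, fun κ s => by
  simp only [rep, Polynomial.eval_ofNat]; split_ifs <;> simp [Data.size]⟩

theorem prod (hβ : PolySize β) (hγ : PolySize γ) : PolySize fun κ => β κ × γ κ := by
  obtain ⟨c, hc⟩ := hβ
  obtain ⟨d, hd⟩ := hγ
  refine ⟨c + d + 1, fun κ s => ?_⟩
  have := hc κ s.1
  have := hd κ s.2
  simp only [rep_prod, Data.size, Polynomial.eval_add, Polynomial.eval_one]; omega

theorem option (hβ : PolySize β) : PolySize fun κ => Option (β κ) := by
  obtain ⟨c, hc⟩ := hβ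
  refine ⟨c + 2, fun κ s => ?_⟩
  simp only [Polynomial.eval_add, Polynomial.eval_ofNat]
  cases s with
  | none => simp only [rep_none, Data.size]; omega
  | some a =>
    have h1 := hc κ a
    have h2 : (rep (some a)).size = (rep a).size + 1 + 1 := rfl
    omega

/-- The value is a unary output of a polynomial-time program on an input of size `2 * κ + 3`: the
numeral `κ` takes `2 * κ + 1`, the unit and the pairing take one each. -/
theorem exists_le {n : ℕ → ℕ} (hn : Feasible fun κ (_ : Unit) => n κ) :
    ∃ c : Polynomial ℕ, ∀ κ, n κ ≤ c.eval κ := by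
  obtain ⟨c, hc⟩ := hn.size_le
  refine ⟨c.comp (2 * Polynomial.X + 3), fun κ => ?_⟩
  have h := hc κ ()
  have h1 : (Data.cons (rep κ) (rep ())).size = 2 * κ + 3 := by
    simp only [Data.size, rep_nat, size_unary]
    rw [show (rep () : Data) = .nil from rfl, Data.size]
  rw [h1, rep_nat, size_unary] at h
  simp only [Polynomial.eval_comp, Polynomial.eval_add, Polynomial.eval_mul, Polynomial.eval_X,
    Polynomial.eval_ofNat]
  omega

theorem fin {n : ℕ → ℕ} (hn : Feasible fun κ (_ : Unit) => n κ) : PolySize fun κ => Fin (n κ) := by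
  obtain ⟨c, hc⟩ := exists_le hn
  refine ⟨2 * c + 1, fun κ s => ?_⟩
  have h1 : (rep s).size = 2 * (s : ℕ) + 1 := size_unary _
  have := hc κ
  have := s.isLt
  simp only [Polynomial.eval_add, Polynomial.eval_mul, Polynomial.eval_one, Polynomial.eval_ofNat]
  omega

theorem tuple {n : ℕ → ℕ} (hn : Feasible fun κ (_ : Unit) => n κ) (hβ : PolySize β) :
    PolySize fun κ => Fin (n κ) → β κ := by
  obtain ⟨c, hc⟩ := exists_le hn
  obtain ⟨d, hd⟩ := hβ
  refine ⟨c * (d + 1) + 1, fun κ s => ?_⟩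
  rw [← rep_ofFn]
  refine (size_rep_le (n := d.eval κ) fun a ha => ?_).trans ?_
  · exact hd κ a
  · have := hc κ
    simp only [List.length_ofFn, Polynomial.eval_add, Polynomial.eval_mul, Polynomial.eval_one]
    gcongr

end PolySize

namespace Feasible

variable {α β γ δ σ : ℕ → Type} [∀ κ, DataRep (α κ)] [∀ κ, DataRep (β κ)] [∀ κ, DataRep (γ κ)]
  [∀ κ, DataRep (δ κ)] [∀ κ, DataRep (σ κ)]

/-! ### Arithmetic -/

theorem iterate {n : ∀ κ, α κ → ℕ} {s₀ : ∀ κ, α κ → σ κ} {step : ∀ κ, α κ → σ κ → σ κ}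
    (hn : Feasible n) (hs₀ : Feasible s₀)
    (hstep : Feasible fun κ (y : α κ × σ κ) => step κ y.1 y.2)
    (hb : ∃ b : Polynomial ℕ, ∀ κ x i, i ≤ n κ x → (rep ((step κ x)^[i] (s₀ κ x))).size ≤
      b.eval (Data.cons (rep κ) (rep x)).size) :
    Feasible fun κ x => (step κ x)^[n κ x] (s₀ κ x) := by
  have e : ∀ κ x (m : List Unit) s, m.foldl (fun s _ => step κ x s) s =
      (step κ x)^[m.length] s := by
    intro κ x m
    induction m with
    | nil => intro s; rfl
    | cons a m ih => intro s; simp [ih]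
  refine (foldl (step := fun κ x s (_ : Unit) => step κ x s) hn.toUnits hs₀
    (hstep.comp₂ id.fst id.snd.fst) ?_).congr fun κ x => by rw [e]; simp
  obtain ⟨b, hb⟩ := hb
  refine ⟨b, fun κ x i => ?_⟩
  rw [e]
  exact hb κ x _ (by simp)

theorem mul {m n : ∀ κ, α κ → ℕ} (hm : Feasible m) (hn : Feasible n) :
    Feasible fun κ x => m κ x * n κ x := by
  have e : ∀ (a i : ℕ), (fun s => s + a)^[i] 0 = i * a := by
    intro a i
    induction i with
    | zero => simp
    | succ i ih => rw [Function.iterate_succ_apply', ih]; ring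
  refine (iterate (step := fun κ x s => s + n κ x) hm (num 0)
    (id.snd.add (hn.comp id.fst)) ?_).congr fun κ x => e _ _
  obtain ⟨c, hc⟩ := hm.size_le
  obtain ⟨d, hd⟩ := hn.size_le
  refine ⟨2 * (c * d) + 1, fun κ x i hi => ?_⟩
  have h1 := hc κ x
  have h2 := hd κ x
  rw [rep_nat, size_unary] at h1 h2
  rw [e, rep_nat, size_unary]
  simp only [Polynomial.eval_add, Polynomial.eval_mul, Polynomial.eval_one, Polynomial.eval_ofNat]
  gcongr <;> omega

theorem evalPoly (q : Polynomial ℕ) : Feasible fun κ (_ : α κ) => q.eval κ := by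
  induction q using Polynomial.induction_on with
  | C a => exact (num a).congr fun κ x => by simp
  | add p q hp hq => exact (hp.add hq).congr fun κ x => by simp
  | monomial n a h =>
    exact (h.mul kappa).congr fun κ x => by simp [pow_succ, mul_assoc]

theorem half {n : ∀ κ, α κ → ℕ} (hn : Feasible n) :
    Feasible fun κ x => (decide (n κ x % 2 = 1), n κ x / 2) := by
  -- Counting up to `n` in steps of one: the first component is the current parity, the second one
  -- collects the carries.
  let f : Bool × ℕ → Bool × ℕ := fun s => if s.1 = true then (false, s.2 + 1) else (true, s.2)
  have e : ∀ i : ℕ, f^[i] (false, 0) = (decide (i % 2 = 1), i / 2) := by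
    intro i
    induction i with
    | zero => rfl
    | succ i ih =>
      rw [Function.iterate_succ_apply', ih]
      rcases Nat.mod_two_eq_zero_or_one i with h | h <;> simp [f, h] <;> omega
  refine (iterate (step := fun κ x s => f s) hn (bfalse.pair (num 0))
    (cond id.snd.fst (bfalse.pair (id.snd.snd.add (num 1))) (btrue.pair id.snd.snd)) ?_).congr
      fun κ x => e _
  obtain ⟨c, hc⟩ := hn.size_le
  refine ⟨c + 5, fun κ x i hi => ?_⟩
  have h1 := hc κ x
  rw [rep_nat, size_unary] at h1
  rw [e, rep_pair, Data.size, rep_nat, size_unary]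
  have : ∀ b : Bool, (rep b).size ≤ 3 := by intro b; cases b <;> simp [rep, Data.size]
  have := this (decide (i % 2 = 1))
  simp only [Polynomial.eval_add, Polynomial.eval_ofNat]
  omega

/-- Repeated halving avoids the power `2 ^ i`, whose unary numeral would be exponentially long. This
gives access to binary digits of unary numbers. -/
theorem divTwoPow {n i : ∀ κ, α κ → ℕ} (hn : Feasible n) (hi : Feasible i) :
    Feasible fun κ x => n κ x / 2 ^ i κ x := by
  have e : ∀ i n : ℕ, (fun s => s / 2)^[i] n = n / 2 ^ i := by
    intro i n
    induction i with
    | zero => simp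
    | succ i ih => rw [Function.iterate_succ_apply', ih, Nat.div_div_eq_div_mul, pow_succ]
  refine (iterate (step := fun κ x s => s / 2) hi hn (half id.snd).snd ?_).congr fun κ x => e _ _
  obtain ⟨c, hc⟩ := hn.size_le
  refine ⟨c, fun κ x i hi => ?_⟩
  have h1 := hc κ x
  rw [rep_nat, size_unary] at h1 ⊢
  rw [e]
  have := Nat.div_le_self (n κ x) (2 ^ i)
  omega

theorem testBit {n i : ∀ κ, α κ → ℕ} (hn : Feasible n) (hi : Feasible i) :
    Feasible fun κ x => (n κ x).testBit (i κ x) :=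
  (half (divTwoPow hn hi)).fst.congr fun _ _ => (Nat.testBit_eq_decide_div_mod_eq ..).symm

/-! ### Addition of bit strings -/

theorem zmod_zero : Feasible fun κ (_ : α κ) => (0 : ZMod 2) := const .nil fun _ _ => rfl

theorem zmod_one : Feasible fun κ (_ : α κ) => (1 : ZMod 2) :=
  const (.cons .nil .nil) fun _ _ => rfl

theorem zmod_add : Feasible fun _ (y : ZMod 2 × ZMod 2) => y.1 + y.2 := by
  have h0 : ∀ f : ∀ _ : ℕ, ZMod 2 × ZMod 2 → ZMod 2, Feasible f →
      Feasible fun κ x => decide (f κ x = 0) :=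
    fun f hf => deq (fun _ => rep_zmod_injective) hf zmod_zero
  refine (ite (h0 _ id.fst) id.snd (ite (h0 _ id.snd) zmod_one zmod_zero)).congr fun κ x => ?_
  have : ∀ a b : ZMod 2, (if a = 0 then b else if b = 0 then 1 else 0) = a + b := by decide
  exact this _ _

theorem tuple_add {n : ℕ → ℕ} [∀ κ, Add (β κ)] (hn : Feasible fun κ (_ : Unit) => n κ)
    (h : Feasible fun κ (y : β κ × β κ) => y.1 + y.2) :
    Feasible fun κ (y : (Fin (n κ) → β κ) × (Fin (n κ) → β κ)) => y.1 + y.2 :=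
  lam (f := fun κ (y : (Fin (n κ) → β κ) × (Fin (n κ) → β κ)) i => y.1 i + y.2 i) hn
    (h.comp ((app id.fst.fst id.snd).pair (app id.fst.snd id.snd)))

theorem prod_add [∀ κ, Add (β κ)] [∀ κ, Add (γ κ)]
    (h : Feasible fun κ (y : β κ × β κ) => y.1 + y.2)
    (h' : Feasible fun κ (y : γ κ × γ κ) => y.1 + y.2) :
    Feasible fun κ (y : (β κ × γ κ) × (β κ × γ κ)) => y.1 + y.2 :=
  (h.comp (id.fst.fst.pair id.snd.fst)).pair (h'.comp (id.fst.snd.pair id.snd.snd))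

theorem bits_add {n : ℕ → ℕ} (hn : Feasible fun κ (_ : Unit) => n κ) :
    Feasible fun κ (y : Bits (n κ) × Bits (n κ)) => y.1 + y.2 := tuple_add hn zmod_add

theorem bits_zero {n : ℕ → ℕ} (hn : Feasible fun κ (_ : Unit) => n κ) :
    Feasible fun κ (_ : α κ) => (0 : Bits (n κ)) :=
  lam (f := fun κ (_ : α κ) (_ : Fin (n κ)) => (0 : ZMod 2)) hn zmod_zero

theorem bits_eq {n : ℕ → ℕ} {f g : ∀ κ, α κ → Bits (n κ)} [∀ κ x, Decidable (f κ x = g κ x)]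
    (hf : Feasible f) (hg : Feasible g) : Feasible fun κ x => decide (f κ x = g κ x) :=
  deq (fun _ => rep_tuple_injective rep_zmod_injective) hf hg

theorem fupdate {n : ℕ → ℕ} {f : ∀ κ, α κ → Fin (n κ) → β κ} {i : ∀ κ, α κ → Fin (n κ)}
    {v : ∀ κ, α κ → β κ} (hn : Feasible fun κ (_ : Unit) => n κ) (hf : Feasible f)
    (hi : Feasible i) (hv : Feasible v) :
    Feasible fun κ x => Function.update (f κ x) (i κ x) (v κ x) := by
  refine (lam (f := fun κ x j => if j = i κ x then v κ x else f κ x j) hn ?_).congr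
    fun κ x => ?_
  · exact ite (deq (fun _ => rep_fin_injective) id.snd (hi.comp id.fst)) (hv.comp id.fst)
      (app (hf.comp id.fst) id.snd)
  · funext j
    simp only [Function.update_apply]

/-! ### Further list functions -/

theorem lzip {l : ∀ κ, α κ → List (β κ)} {m : ∀ κ, α κ → List (γ κ)} (hl : Feasible l)
    (hm : Feasible m) : Feasible fun κ x => (l κ x).zip (m κ x) := by
  -- The state holds the unread part of the second list and the pairs formed so far, in reverse.
  let step : ∀ κ, α κ → List (γ κ) × List (β κ × γ κ) → β κ → List (γ κ) × List (β κ × γ κ) :=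
    fun κ _ s a => s.1.head?.elim s fun b => (s.1.tail, (a, b) :: s.2)
  have hstep : Feasible fun κ (y : α κ × (List (γ κ) × List (β κ × γ κ)) × β κ) =>
      step κ y.1 y.2.1 y.2.2 :=
    oelim id.snd.fst.fst.lhead? id.snd.fst
      (id.fst.snd.fst.fst.ltail.pair (lcons (id.fst.snd.snd.pair id.snd) id.fst.snd.fst.snd))
  have e : ∀ κ x (l : List (β κ)) (m : List (γ κ)) acc,
      (l.foldl (step κ x) (m, acc)) = (m.drop l.length, (l.zip m).reverse ++ acc) := by
    intro κ x l
    induction l with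
    | nil => intro m acc; simp
    | cons a l ih =>
      intro m acc
      cases m with
      | nil =>
        have : step κ x ([], acc) a = ([], acc) := rfl
        rw [List.foldl_cons, this, ih]; simp
      | cons b m =>
        have : step κ x (b :: m, acc) a = (m, (a, b) :: acc) := rfl
        rw [List.foldl_cons, this, ih]; simp
  refine (foldl (s₀ := fun κ x => (m κ x, [])) hl (hm.pair lnil) hstep ?_).snd.lreverse.congr
    fun κ x => by rw [e κ x]; simp
  obtain ⟨c, hc⟩ := hl.size_le
  obtain ⟨d, hd⟩ := hm.size_le
  refine ⟨d + (c * (c + d + 2) + 1) + 1, fun κ x i => ?_⟩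
  have h1 := hc κ x
  have h2 := hd κ x
  rw [e κ x, rep_pair, Data.size, List.append_nil, size_rep_reverse]
  have h3 : (rep ((m κ x).drop ((l κ x).take i).length)).size ≤ (rep (m κ x)).size :=
    size_rep_sublist (List.drop_sublist _ _)
  have h4 : (rep ((List.take i (l κ x)).zip (m κ x))).size ≤
      ((List.take i (l κ x)).zip (m κ x)).length *
        ((rep (l κ x)).size + (rep (m κ x)).size + 1 + 1) + 1 := by
    refine size_rep_le fun a ha => ?_
    have h5 := List.of_mem_zip ha
    have h6 := size_rep_mem (List.mem_of_mem_take h5.1)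
    have h7 := size_rep_mem h5.2
    rw [rep_prod, Data.size]; omega
  have h5 : ((List.take i (l κ x)).zip (m κ x)).length ≤ (rep (l κ x)).size := by
    refine le_trans ?_ (length_le_size_rep _)
    rw [List.length_zip]
    exact (min_le_left _ _).trans (by simp)
  have h6 : ((List.take i (l κ x)).zip (m κ x)).length *
        ((rep (l κ x)).size + (rep (m κ x)).size + 1 + 1) ≤
      c.eval (Data.cons (rep κ) (rep x)).size *
        (c.eval (Data.cons (rep κ) (rep x)).size + d.eval (Data.cons (rep κ) (rep x)).size + 2) :=
    Nat.mul_le_mul (h5.trans h1) (by omega)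
  simp only [Polynomial.eval_add, Polynomial.eval_mul, Polynomial.eval_one, Polynomial.eval_ofNat]
  omega

theorem dmem {f : ∀ κ, α κ → β κ} {l : ∀ κ, α κ → List (β κ)} [∀ κ, DecidableEq (β κ)]
    [∀ κ x, Decidable (f κ x ∈ l κ x)]
    (inj : ∀ κ, Function.Injective (rep : β κ → Data)) (hf : Feasible f) (hl : Feasible l) :
    Feasible fun κ x => decide (f κ x ∈ l κ x) := by
  refine (oelim (n := fun _ _ => false) (s := fun _ _ _ => true)
    (lfind? (p := fun κ x a => decide (f κ x = a)) hl (deq inj (hf.comp id.fst) id.snd))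
    bfalse btrue).congr fun κ x => ?_
  by_cases h : f κ x ∈ l κ x
  · obtain ⟨a, ha⟩ : ∃ a, (l κ x).find? (fun a => decide (f κ x = a)) = some a := by
      rw [← Option.isSome_iff_exists, List.find?_isSome]
      exact ⟨_, h, by simp⟩
    simp [ha, h]
  · have : (l κ x).find? (fun a => decide (f κ x = a)) = none := by
      rw [List.find?_eq_none]
      rintro a ha h'
      rw [decide_eq_true_eq] at h'
      exact h (h' ▸ ha)
    simp [this, h]

theorem llookup {f : ∀ κ, α κ → β κ} {l : ∀ κ, α κ → List (β κ × γ κ)} [∀ κ, DecidableEq (β κ)]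
    (inj : ∀ κ, Function.Injective (rep : β κ → Data)) (hf : Feasible f) (hl : Feasible l) :
    Feasible fun κ x => (l κ x).lookup (f κ x) := by
  refine (oelim (s := fun _ _ a => some a.2)
    (lfind? (p := fun κ x (a : β κ × γ κ) => decide (f κ x = a.1)) hl
      (deq inj (hf.comp id.fst) id.snd.fst))
    onone id.snd.snd.osome).congr fun κ x => ?_
  induction l κ x with
  | nil => rfl
  | cons a m ih =>
    rw [List.find?_cons, List.lookup_cons]
    by_cases h : f κ x = a.1
    · simp [h]
    · have h' : (f κ x == a.1) = false := by simpa using h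
      simp only [h, decide_false, h']
      exact ih

theorem ogetD {o : ∀ κ, α κ → Option (β κ)} {d : ∀ κ, α κ → β κ} (ho : Feasible o)
    (hd : Feasible d) : Feasible fun κ x => (o κ x).getD (d κ x) :=
  (oelim ho hd id.snd).congr fun κ x => by cases o κ x <;> rfl

theorem isNil {l : ∀ κ, α κ → List (β κ)} [∀ κ x, Decidable (l κ x = [])] (hl : Feasible l) :
    Feasible fun κ x => decide (l κ x = []) :=
  (oelim (n := fun _ _ => true) (s := fun _ _ _ => false) hl.lhead? btrue bfalse).congr
    fun κ x => by
      by_cases h : l κ x = []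
      · simp [h]
      · obtain ⟨a, m, h'⟩ := List.exists_cons_of_ne_nil h
        simp [h']

/-! ### Decoding -/

theorem dataToList : Feasible fun _ (d : Data) => d.toList :=
  id.recast fun κ d => by
    change d = Data.ofList (d.toList.map fun d => d)
    rw [List.map_id', Data.ofList_toList]

theorem dec_nat : Feasible fun _ (d : Data) => (Code.dec d : ℕ) := dataToList.llength

theorem dec_zmod : Feasible fun _ (d : Data) => (Code.dec d : ZMod 2) :=
  (ite (deq (fun _ _ _ h => h) id (const .nil fun _ _ => rfl)) zmod_zero zmod_one :
    Feasible fun _ (d : Data) => if d = Data.nil then (0 : ZMod 2) else 1)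

theorem dec_prod [∀ κ, Code (β κ)] [∀ κ, Code (γ κ)]
    (h : Feasible fun κ (d : Data) => (Code.dec d : β κ))
    (h' : Feasible fun κ (d : Data) => (Code.dec d : γ κ)) :
    Feasible fun κ (d : Data) => (Code.dec d : β κ × γ κ) := by
  have hf : Feasible fun _ (d : Data) => d.fst := ⟨_, PolyTime.snd'.fst, fun _ _ => rfl⟩
  have hs : Feasible fun _ (d : Data) => d.snd := ⟨_, PolyTime.snd'.snd, fun _ _ => rfl⟩
  exact (h.comp hf).pair (h'.comp hs)

theorem dec_list [∀ κ, Code (β κ)] (h : Feasible fun κ (d : Data) => (Code.dec d : β κ)) :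
    Feasible fun κ (d : Data) => (Code.dec d : List (β κ)) :=
  lmap (f := fun _ _ a => Code.dec a) dataToList (h.comp id.snd)

theorem dec_tuple [∀ κ, Code (β κ)] {n : ℕ → ℕ} (hn : Feasible fun κ (_ : Unit) => n κ)
    (h : Feasible fun κ (d : Data) => (Code.dec d : β κ)) :
    Feasible fun κ (d : Data) => (Code.dec d : Fin (n κ) → β κ) := by
  refine lam (f := fun κ (d : Data) (i : Fin (n κ)) => (Code.dec (d.toList.getD i .nil) : β κ)) hn
    (h.comp ((lheadD (ldrop id.snd.val (dataToList.comp id.fst)) (const .nil fun _ _ => rfl)).congr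
      fun κ x => ?_))
  rw [List.headD_eq_head?_getD, List.head?_drop, ← List.getD_eq_getElem?_getD]

theorem dec_bits {n : ℕ → ℕ} (hn : Feasible fun κ (_ : Unit) => n κ) :
    Feasible fun κ (d : Data) => (Code.dec d : Bits (n κ)) := dec_tuple hn dec_zmod

end Feasible

/-! ## The game with abstract key material -/

section defs

variable {κ : ℕ} {S : Sizes}

/-- Processing of a packet by a node with a given table of key material. -/
def Scheme.pick (P : Scheme κ S) (L : List (Stream κ S × Key κ)) (pkt : Packet κ S) :
    Option (Packet κ S) :=
  (slotOf pkt.2.1).bind fun s =>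
    (L.find? fun m => decide ((pkt.2.2.1 s).1 = P.pattern + m.1.1.1)).bind fun m =>
      P.relay m.1 m.2 pkt

/-- The key material that the source uses for a node: the honest node has the table `L`, the keys
of the other nodes are listed by the adversary. -/
def Scheme.material (P : Scheme κ S) (nj : Addr S) (L : List (Stream κ S × Key κ))
    (keys : List (Addr S × Key κ)) (t : ℕ) (a : Addr S) : Stream κ S × Key κ :=
  if a = nj then (L.drop t).headD 0 else P.derive ((keys.lookup a).getD 0) t

/-- The hops of a path with given slots. -/
def hopsWith (mat : Addr S → Stream κ S × Key κ) (slots : List (Fin S.slots))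
    (path : List (Addr S)) : List (Hop κ S) :=
  (path.zip slots).map fun x => ⟨x.1, x.2, (mat x.1).1, (mat x.1).2⟩

/-- The packet that arrives at the node after the first `n` hops. -/
def Scheme.arrive (P : Scheme κ S) (hs : List (Hop κ S)) (n : ℕ) (R : Header κ S)
    (payload : Bits S.pay) : Option (Packet κ S) :=
  (hs.drop n).head?.bind fun h =>
    some (h.addr, ptrOf h.slot, P.wrap (hs.drop n) (P.filler hs R, payload))

/-- The packet that leaves the honest node with the table `L`. -/
def Scheme.emit (P : Scheme κ S) (nj : Addr S) (L : List (Stream κ S × Key κ))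
    (keys : List (Addr S × Key κ)) (t : ℕ) (pre suf : List (Addr S))
    (σ : Fin S.slots → Fin S.slots) (R : Header κ S) (payload : Bits S.pay) :
    Option (Packet κ S) :=
  (P.arrive (hopsWith (P.material nj L keys t) (List.ofFn σ) (pre ++ nj :: suf)) pre.length R
    payload).bind (P.pick L)

/-- The randomness used for one packet: slots and initial routing vector. -/
abbrev PacketCoins (κ : ℕ) (S : Sizes) : Type := (Fin S.slots → Fin S.slots) × Header κ S

/-- The answer to the challenge. -/
def Scheme.respond (P : Scheme κ S) (nj : Addr S) (L : List (Stream κ S × Key κ)) (b : Bool)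
    (w₁ w₂ : PacketCoins κ S) (c : Challenge κ S) :
    Option (Packet κ S) × Option (Packet κ S) :=
  if c.Valid nj then
    (P.emit nj L c.keys c.index c.pre₁ c.suf w₁.1 w₁.2 c.payload₁,
      P.emit nj L c.keys (c.index + 1) (if b = true then c.pre₂ else c.pre₁) c.suf w₂.1 w₂.2
        c.payload₂)
  else (none, none)

/-- The next message of an adversary, from the list of the previous answers. -/
def Adversary.move (A : Adversary) (nj : Addr S) (r : Bits (A.coins.eval κ))
    (answers : List Data) : Data :=
  A.next (Code.enc (κ, nj, r, answers))

/-- A query of an adversary to an oracle. -/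
def Adversary.query (A : Adversary) (nj : Addr S) (r : Bits (A.coins.eval κ))
    (step : Packet κ S → Option (Packet κ S)) (answers : List Data) : List Data :=
  Code.enc (step (Code.dec (A.move nj r answers))) :: answers

/-- The output of an adversary that interacts with the oracle `step` and gets the answer `ans` to
its challenge. -/
def Adversary.output (A : Adversary) (nj : Addr S) (r : Bits (A.coins.eval κ))
    (step : Packet κ S → Option (Packet κ S))
    (ans : Challenge κ S → Option (Packet κ S) × Option (Packet κ S)) : Data :=
  let h₁ := (A.query nj r step)^[A.queries₁.eval κ] []
  let h₂ := Code.enc (ans (Challenge.ofData (A.move nj r h₁))) :: h₁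
  A.move nj r ((A.query nj r step)^[A.queries₂.eval κ] h₂)

theorem Adversary.wins_iff (A : Adversary) (P : Scheme κ S) (nj : Addr S)
    (w : ChallengerCoins κ S) (r : Bits (A.coins.eval κ)) :
    A.Wins P nj w r ↔
      (A.output nj r (P.nodeStep w.1) (P.answer nj w) ≠ .nil ↔ w.2.1 = true) := Iff.rfl

instance : DataRep (Hop κ S) := ⟨fun h => rep (h.addr, h.slot, h.stream, h.macKey)⟩

instance : DataRep (Challenge κ S) := ⟨fun c => rep (c.index, (c.payload₁, c.payload₂),
  (c.pre₁, c.pre₂, c.suf), c.keys)⟩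

/-- Every hop together with its successor; the last hop is its own successor. -/
def withNext (l : List (Hop κ S)) : List (Hop κ S × Hop κ S) :=
  l.foldr (fun h acc => (h, acc.head?.elim h Prod.fst) :: acc) []

theorem withNext_cons (h : Hop κ S) (l : List (Hop κ S)) :
    withNext (h :: l) = (h, l.headD h) :: withNext l := by
  cases l <;> rfl

/-- The recursion looks at the rest of the path only to find the next hop. With the successor
attached to every hop it becomes a fold whose state is one routing vector, and such folds are
feasible. -/
theorem Scheme.filler_eq_foldl (P : Scheme κ S) (l : List (Hop κ S)) (R : Header κ S) :
    P.filler l R = (withNext l).foldl (fun (R : Header κ S) a =>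
      (Function.update R a.1.slot ((P.pattern, a.2.addr, ptrOf a.2.slot, 0) : RElem κ S) :
        Header κ S) + a.1.stream.2.1) R := by
  induction l generalizing R with
  | nil => rfl
  | cons h l ih => rw [withNext_cons, List.foldl_cons, Scheme.filler, ih]; rfl

theorem Scheme.wrap_eq_foldr (P : Scheme κ S) (l : List (Hop κ S)) (X : Body κ S) :
    P.wrap l X = (withNext l).foldr (fun a X => (Function.update (X + a.1.stream.2).1 a.1.slot
      ((P.pattern, a.2.addr, ptrOf a.2.slot, P.mac a.1.macKey (X + a.1.stream.2)) +
        a.1.stream.1), (X + a.1.stream.2).2)) X := by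
  induction l with
  | nil => rfl
  | cons h l ih => rw [withNext_cons, List.foldr_cons, ← ih]; rfl

theorem Scheme.relay_eq (P : Scheme κ S) (s : Stream κ S) (k : Key κ) (pkt : Packet κ S) :
    P.relay s k pkt = (slotOf pkt.2.1).bind fun i =>
      if P.mac k (Function.update pkt.2.2.1 i ((pkt.2.2.1 i + s.1).1, (pkt.2.2.1 i + s.1).2.1,
        (pkt.2.2.1 i + s.1).2.2.1, 0), pkt.2.2.2) = (pkt.2.2.1 i + s.1).2.2.2 then
        some ((pkt.2.2.1 i + s.1).2.1, (pkt.2.2.1 i + s.1).2.2.1,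
          (Function.update pkt.2.2.1 i ((pkt.2.2.1 i + s.1).1, (pkt.2.2.1 i + s.1).2.1,
            (pkt.2.2.1 i + s.1).2.2.1, 0), pkt.2.2.2) + s.2)
      else none := by
  unfold Scheme.relay
  cases slotOf pkt.2.1 <;> rfl

end defs

/-! ## Feasibility of the protocol -/

namespace Feasible

variable {S : ℕ → Sizes} {P : ∀ κ, Scheme κ (S κ)} {α : ℕ → Type} [∀ κ, DataRep (α κ)]

theorem hop_tuple {h : ∀ κ, α κ → Hop κ (S κ)} (hh : Feasible h) : Feasible fun κ x =>
    ((h κ x).addr, (h κ x).slot, (h κ x).stream, (h κ x).macKey) := hh.recast fun _ _ => rfl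

theorem hop_addr {h : ∀ κ, α κ → Hop κ (S κ)} (hh : Feasible h) :
    Feasible fun κ x => (h κ x).addr := hh.hop_tuple.fst

theorem hop_slot {h : ∀ κ, α κ → Hop κ (S κ)} (hh : Feasible h) :
    Feasible fun κ x => (h κ x).slot := hh.hop_tuple.snd.fst

theorem hop_stream {h : ∀ κ, α κ → Hop κ (S κ)} (hh : Feasible h) :
    Feasible fun κ x => (h κ x).stream := hh.hop_tuple.snd.snd.fst

theorem hop_macKey {h : ∀ κ, α κ → Hop κ (S κ)} (hh : Feasible h) :
    Feasible fun κ x => (h κ x).macKey := hh.hop_tuple.snd.snd.snd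

theorem hop_mk {a : ∀ κ, α κ → Addr (S κ)} {s : ∀ κ, α κ → Fin (S κ).slots}
    {st : ∀ κ, α κ → Stream κ (S κ)} {k : ∀ κ, α κ → Key κ} (ha : Feasible a) (hs : Feasible s)
    (hst : Feasible st) (hk : Feasible k) :
    Feasible fun κ x => (⟨a κ x, s κ x, st κ x, k κ x⟩ : Hop κ (S κ)) :=
  (ha.pair (hs.pair (hst.pair hk))).recast fun _ _ => rfl

theorem challenge_tuple {c : ∀ κ, α κ → Challenge κ (S κ)} (hc : Feasible c) :
    Feasible fun κ x => ((c κ x).index, ((c κ x).payload₁, (c κ x).payload₂),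
      ((c κ x).pre₁, (c κ x).pre₂, (c κ x).suf), (c κ x).keys) := hc.recast fun _ _ => rfl

end Feasible

theorem polySize_key : PolySize Key := .tuple .kappa .zmod

theorem feasible_key_add : Feasible fun κ (y : Key κ × Key κ) => y.1 + y.2 :=
  .bits_add .kappa

namespace Efficient

variable {S : ℕ → Sizes} {P : ∀ κ, Scheme κ (S κ)} {α : ℕ → Type} [∀ κ, DataRep (α κ)]

theorem f_pat (E : Efficient S P) : Feasible fun κ (_ : Unit) => (S κ).pat := E.pat
theorem f_addr (E : Efficient S P) : Feasible fun κ (_ : Unit) => (S κ).addr := E.addr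
theorem f_ptr (E : Efficient S P) : Feasible fun κ (_ : Unit) => (S κ).ptr := E.ptr
theorem f_slots (E : Efficient S P) : Feasible fun κ (_ : Unit) => (S κ).slots := E.slots
theorem f_pay (E : Efficient S P) : Feasible fun κ (_ : Unit) => (S κ).pay := E.pay
theorem f_seed (E : Efficient S P) : Feasible fun κ (_ : Unit) => (S κ).seed := E.seed
theorem f_table (E : Efficient S P) : Feasible fun κ (_ : Unit) => (S κ).table := E.table

theorem f_pattern (E : Efficient S P) : Feasible fun κ (_ : α κ) => (P κ).pattern :=
  Feasible.param (c := fun κ => (P κ).pattern) E.pattern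

theorem f_kdf (E : Efficient S P) : Feasible fun κ (x : Key κ × ℕ) => (P κ).kdf x.1 x.2 := E.kdf

theorem f_prg (E : Efficient S P) : Feasible fun κ (k : Key κ) => (P κ).prg k := E.prg

theorem f_mac (E : Efficient S P) :
    Feasible fun κ (x : Key κ × Body κ (S κ)) => (P κ).mac x.1 x.2 := E.mac

theorem f_perm (E : Efficient S P) : Feasible fun κ (s : Bits (S κ).seed) =>
    fun i : Fin (S κ).slots => (P κ).perm s i := E.perm

/-! ### Sizes of the objects of the protocol -/

theorem polySize_relem (E : Efficient S P) : PolySize fun κ => RElem κ (S κ) :=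
  (PolySize.tuple E.f_pat .zmod).prod ((PolySize.tuple E.f_addr .zmod).prod
    ((PolySize.tuple E.f_ptr .zmod).prod polySize_key))

theorem polySize_header (E : Efficient S P) : PolySize fun κ => Header κ (S κ) :=
  .tuple E.f_slots E.polySize_relem

theorem polySize_body (E : Efficient S P) : PolySize fun κ => Body κ (S κ) :=
  E.polySize_header.prod (.tuple E.f_pay .zmod)

theorem polySize_packet (E : Efficient S P) : PolySize fun κ => Packet κ (S κ) :=
  (PolySize.tuple E.f_addr .zmod).prod ((PolySize.tuple E.f_ptr .zmod).prod E.polySize_body)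

theorem polySize_hop (E : Efficient S P) : PolySize fun κ => Hop κ (S κ) := by
  obtain ⟨c, hc⟩ := (PolySize.tuple E.f_addr .zmod).prod ((PolySize.fin E.f_slots).prod
    ((E.polySize_relem.prod E.polySize_body).prod polySize_key))
  exact ⟨c, fun κ h => hc κ (h.addr, h.slot, h.stream, h.macKey)⟩

/-! ### Addition -/

theorem relem_add (E : Efficient S P) :
    Feasible fun κ (y : RElem κ (S κ) × RElem κ (S κ)) => y.1 + y.2 :=
  .prod_add (.bits_add E.f_pat) (.prod_add (.bits_add E.f_addr)
    (.prod_add (.bits_add E.f_ptr) feasible_key_add))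

theorem header_add (E : Efficient S P) :
    Feasible fun κ (y : Header κ (S κ) × Header κ (S κ)) => y.1 + y.2 :=
  .tuple_add E.f_slots E.relem_add

theorem body_add (E : Efficient S P) :
    Feasible fun κ (y : Body κ (S κ) × Body κ (S κ)) => y.1 + y.2 :=
  .prod_add E.header_add (.bits_add E.f_pay)

/-! ### The algorithms -/

theorem f_ptrOf (E : Efficient S P) : Feasible fun κ (s : Fin (S κ).slots) => (ptrOf s : Ptr (S κ)) :=
  .lam (f := fun κ (s : Fin (S κ).slots) (i : Fin (S κ).ptr) =>
      if s.val.testBit i then (1 : ZMod 2) else 0) E.f_ptr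
    (.cond (.testBit (Feasible.id.fst.val) (Feasible.id.snd.val)) .zmod_one .zmod_zero)

theorem f_slotOf (E : Efficient S P) :
    Feasible fun κ (p : Ptr (S κ)) => (slotOf p : Option (Fin (S κ).slots)) :=
  .lfind? (p := fun κ (p : Ptr (S κ)) s => decide (ptrOf s = p)) (.finRange E.f_slots)
    (.bits_eq (E.f_ptrOf.comp Feasible.id.snd) Feasible.id.fst)

theorem f_relay (E : Efficient S P) : Feasible fun κ
    (x : (Stream κ (S κ) × Key κ) × Packet κ (S κ)) => (P κ).relay x.1.1 x.1.2 x.2 := by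
  have hH : Feasible fun κ (y : ((Stream κ (S κ) × Key κ) × Packet κ (S κ)) × Fin (S κ).slots) =>
      y.1.2.2.2.1 := Feasible.id.fst.snd.snd.snd.fst
  have hi : Feasible fun κ (y : ((Stream κ (S κ) × Key κ) × Packet κ (S κ)) × Fin (S κ).slots) =>
      y.2 := Feasible.id.snd
  have hr : Feasible fun κ (y : ((Stream κ (S κ) × Key κ) × Packet κ (S κ)) × Fin (S κ).slots) =>
      y.1.2.2.2.1 y.2 + y.1.1.1.1 :=
    E.relem_add.comp ((hH.app hi).pair Feasible.id.fst.fst.fst.fst)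
  have hY : Feasible fun κ (y : ((Stream κ (S κ) × Key κ) × Packet κ (S κ)) × Fin (S κ).slots) =>
      ((Function.update y.1.2.2.2.1 y.2 ((y.1.2.2.2.1 y.2 + y.1.1.1.1).1,
        (y.1.2.2.2.1 y.2 + y.1.1.1.1).2.1, (y.1.2.2.2.1 y.2 + y.1.1.1.1).2.2.1, 0),
        y.1.2.2.2.2) : Body κ (S κ)) :=
    (Feasible.fupdate E.f_slots hH hi (hr.fst.pair (hr.snd.fst.pair (hr.snd.snd.fst.pair
      (.bits_zero .kappa))))).pair Feasible.id.fst.snd.snd.snd.snd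
  have hm := E.f_mac.comp (Feasible.id.fst.fst.snd.pair hY)
  have hs := Feasible.ite (Feasible.bits_eq hm hr.snd.snd.snd) (Feasible.osome (hr.snd.fst.pair
    (hr.snd.snd.fst.pair (E.body_add.comp (hY.pair Feasible.id.fst.fst.fst.snd))))) .onone
  refine Feasible.congr (f := fun κ (x : (Stream κ (S κ) × Key κ) × Packet κ (S κ)) =>
    (slotOf x.2.2.1).bind fun i =>
      if (P κ).mac x.1.2 (Function.update x.2.2.2.1 i ((x.2.2.2.1 i + x.1.1.1).1,
        (x.2.2.2.1 i + x.1.1.1).2.1, (x.2.2.2.1 i + x.1.1.1).2.2.1, 0), x.2.2.2.2) =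
          (x.2.2.2.1 i + x.1.1.1).2.2.2 then
        some ((x.2.2.2.1 i + x.1.1.1).2.1, (x.2.2.2.1 i + x.1.1.1).2.2.1,
          (Function.update x.2.2.2.1 i ((x.2.2.2.1 i + x.1.1.1).1, (x.2.2.2.1 i + x.1.1.1).2.1,
            (x.2.2.2.1 i + x.1.1.1).2.2.1, 0), x.2.2.2.2) + x.1.1.2)
      else none)
    (.obind (E.f_slotOf.comp Feasible.id.snd.snd.fst) hs)
    fun κ x => (Scheme.relay_eq _ _ _ _).symm

theorem f_pick (E : Efficient S P) : Feasible fun κ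
    (x : List (Stream κ (S κ) × Key κ) × Packet κ (S κ)) => (P κ).pick x.1 x.2 := by
  refine .obind (E.f_slotOf.comp Feasible.id.snd.snd.fst) (.obind (.lfind? Feasible.id.fst.fst
    (p := fun κ (y : (List (Stream κ (S κ) × Key κ) × Packet κ (S κ)) × Fin (S κ).slots) m =>
      decide ((y.1.2.2.2.1 y.2).1 = (P κ).pattern + m.1.1.1)) ?_) ?_)
  · exact .bits_eq (Feasible.app Feasible.id.fst.fst.snd.snd.snd.fst Feasible.id.fst.snd).fst
      ((Feasible.bits_add E.f_pat).comp (E.f_pattern.pair Feasible.id.snd.fst.fst.fst))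
  · exact E.f_relay.comp (Feasible.id.snd.pair Feasible.id.fst.fst.snd)

theorem f_derive (E : Efficient S P) :
    Feasible fun κ (x : Key κ × ℕ) => (P κ).derive x.1 x.2 :=
  (E.f_prg.comp E.f_kdf.fst).pair E.f_kdf.snd

theorem stream_zero (E : Efficient S P) : Feasible fun κ (_ : α κ) => (0 : Stream κ (S κ)) := by
  have hr : Feasible fun κ (_ : α κ) => (0 : RElem κ (S κ)) :=
    (Feasible.bits_zero E.f_pat).pair ((Feasible.bits_zero E.f_addr).pair
      ((Feasible.bits_zero E.f_ptr).pair (Feasible.bits_zero .kappa)))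
  have hr' : Feasible fun κ (_ : α κ × Fin (S κ).slots) => (0 : RElem κ (S κ)) :=
    (Feasible.bits_zero E.f_pat).pair ((Feasible.bits_zero E.f_addr).pair
      ((Feasible.bits_zero E.f_ptr).pair (Feasible.bits_zero .kappa)))
  exact hr.pair ((Feasible.lam (f := fun κ (_ : α κ) (_ : Fin (S κ).slots) =>
    (0 : RElem κ (S κ))) E.f_slots hr').pair (Feasible.bits_zero E.f_pay))

theorem f_material (E : Efficient S P) {nj : ∀ κ, Addr (S κ)}
    (hN : Feasible fun κ (_ : Unit) => nj κ) : Feasible fun κ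
    (x : (List (Stream κ (S κ) × Key κ) × List (Addr (S κ) × Key κ) × ℕ) × Addr (S κ)) =>
      (P κ).material (nj κ) x.1.1 x.1.2.1 x.1.2.2 x.2 := by
  refine .ite (.bits_eq Feasible.id.snd hN.param) ?_ ?_
  · exact .lheadD (.ldrop Feasible.id.fst.snd.snd Feasible.id.fst.fst)
      (E.stream_zero.pair (.bits_zero .kappa))
  · exact E.f_derive.comp ((Feasible.ogetD (.llookup
      (fun _ => rep_tuple_injective rep_zmod_injective) Feasible.id.snd Feasible.id.fst.snd.fst)
      (.bits_zero .kappa)).pair Feasible.id.fst.snd.snd)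

theorem f_withNext (E : Efficient S P) :
    Feasible fun κ (l : List (Hop κ (S κ))) => withNext l := by
  refine .foldr (σ := fun κ => List (Hop κ (S κ) × Hop κ (S κ)))
    (step := fun κ _ h acc => (h, acc.head?.elim h Prod.fst) :: acc) .id .lnil
    (.lcons (Feasible.id.snd.snd.pair (.oelim Feasible.id.snd.fst.lhead? Feasible.id.snd.snd
      Feasible.id.snd.fst)) Feasible.id.snd.fst) ?_
  obtain ⟨c, hc⟩ := E.polySize_hop
  refine ⟨Polynomial.X * (2 * c + 2) + 1, fun κ x m hm => ?_⟩
  change (rep (withNext m)).size ≤ _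
  have hl : (withNext m).length = m.length := by
    clear hm
    induction m with
    | nil => rfl
    | cons a m ih => rw [withNext_cons]; simp [ih]
  refine (size_rep_le (n := 2 * c.eval κ + 1) fun a _ => ?_).trans ?_
  · have := hc κ a.1
    have := hc κ a.2
    rw [rep_prod, Data.size]; omega
  · have h1 := length_le_size_rep x
    have h2 := hm.length_le
    have h3 : κ ≤ (Data.cons (rep κ) (rep x)).size := by
      simp only [Data.size, rep_nat, size_unary]; omega
    have h4 := polynomial_eval_mono c h3
    have h5 : x.length ≤ (Data.cons (rep κ) (rep x)).size := by simp only [Data.size]; omega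
    rw [hl]
    simp only [Polynomial.eval_add, Polynomial.eval_mul, Polynomial.eval_one, Polynomial.eval_X,
      Polynomial.eval_ofNat]
    simp only at h4
    exact Nat.add_le_add_right (Nat.mul_le_mul (h2.trans h5) (by omega)) 1

theorem f_filler (E : Efficient S P) : Feasible fun κ
    (x : List (Hop κ (S κ)) × Header κ (S κ)) => (P κ).filler x.1 x.2 := by
  refine (Feasible.foldl_polySize (step := fun κ _ (R : Header κ (S κ)) a =>
    (Function.update R a.1.slot
      (((P κ).pattern, a.2.addr, ptrOf a.2.slot, 0) : RElem κ (S κ)) :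
        Header κ (S κ)) + a.1.stream.2.1) E.polySize_header
    (E.f_withNext.comp Feasible.id.fst) Feasible.id.snd ?_).congr
      fun κ x => ((P κ).filler_eq_foldl _ _).symm
  have ha : Feasible fun κ (y : (List (Hop κ (S κ)) × Header κ (S κ)) × Header κ (S κ) ×
    (Hop κ (S κ) × Hop κ (S κ))) => y.2.2.1 := Feasible.id.snd.snd.fst
  have hb : Feasible fun κ (y : (List (Hop κ (S κ)) × Header κ (S κ)) × Header κ (S κ) ×
    (Hop κ (S κ) × Hop κ (S κ))) => y.2.2.2 := Feasible.id.snd.snd.snd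
  have hr := (E.f_pattern (α := fun κ => (List (Hop κ (S κ)) × Header κ (S κ)) × Header κ (S κ) ×
    (Hop κ (S κ) × Hop κ (S κ)))).pair (hb.hop_addr.pair ((E.f_ptrOf.comp hb.hop_slot).pair
      (Feasible.bits_zero .kappa)))
  have hu := Feasible.fupdate E.f_slots Feasible.id.snd.fst ha.hop_slot hr
  have h := E.header_add.comp (hu.pair ha.hop_stream.snd.fst)
  exact h

theorem f_wrap (E : Efficient S P) : Feasible fun κ
    (x : List (Hop κ (S κ)) × Body κ (S κ)) => (P κ).wrap x.1 x.2 := by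
  refine (Feasible.foldr_polySize (step := fun κ _ a (X : Body κ (S κ)) =>
    ((Function.update (X + a.1.stream.2).1 a.1.slot
      (((P κ).pattern, a.2.addr, ptrOf a.2.slot, (P κ).mac a.1.macKey (X + a.1.stream.2)) +
        a.1.stream.1), (X + a.1.stream.2).2) : Body κ (S κ))) E.polySize_body
    (E.f_withNext.comp Feasible.id.fst) Feasible.id.snd ?_).congr
      fun κ x => ((P κ).wrap_eq_foldr _ _).symm
  have ha : Feasible fun κ (y : (List (Hop κ (S κ)) × Body κ (S κ)) × Body κ (S κ) ×
    (Hop κ (S κ) × Hop κ (S κ))) => y.2.2.1 := Feasible.id.snd.snd.fst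
  have hb : Feasible fun κ (y : (List (Hop κ (S κ)) × Body κ (S κ)) × Body κ (S κ) ×
    (Hop κ (S κ) × Hop κ (S κ))) => y.2.2.2 := Feasible.id.snd.snd.snd
  have hY := E.body_add.comp (Feasible.id.snd.fst.pair ha.hop_stream.snd)
  have hr := (E.f_pattern (α := fun κ => (List (Hop κ (S κ)) × Body κ (S κ)) × Body κ (S κ) ×
    (Hop κ (S κ) × Hop κ (S κ)))).pair (hb.hop_addr.pair ((E.f_ptrOf.comp hb.hop_slot).pair
      (E.f_mac.comp (ha.hop_macKey.pair hY))))
  have hu := Feasible.fupdate E.f_slots hY.fst ha.hop_slot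
    (E.relem_add.comp (hr.pair ha.hop_stream.fst))
  have h := hu.pair hY.snd
  exact h

end Efficient

/-! ### Feasibility of the packets and answers in the game -/

namespace Efficient

variable {S : ℕ → Sizes} {P : ∀ κ, Scheme κ (S κ)} {α : ℕ → Type} [∀ κ, DataRep (α κ)]
  {nj : ∀ κ, Addr (S κ)}

theorem f_hopsWith (E : Efficient S P) (hN : Feasible fun κ (_ : Unit) => nj κ)
    {L : ∀ κ, α κ → List (Stream κ (S κ) × Key κ)} {keys : ∀ κ, α κ → List (Addr (S κ) × Key κ)}
    {t : ∀ κ, α κ → ℕ} {slots : ∀ κ, α κ → List (Fin (S κ).slots)}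
    {path : ∀ κ, α κ → List (Addr (S κ))} (hL : Feasible L) (hk : Feasible keys)
    (ht : Feasible t) (hs : Feasible slots) (hp : Feasible path) : Feasible fun κ x =>
      hopsWith ((P κ).material (nj κ) (L κ x) (keys κ x) (t κ x)) (slots κ x) (path κ x) := by
  have hm : Feasible fun κ (y : α κ × Addr (S κ) × Fin (S κ).slots) =>
      (P κ).material (nj κ) (L κ y.1) (keys κ y.1) (t κ y.1) y.2.1 := by
    have h := (E.f_material hN).comp (((hL.comp (Feasible.id (α := fun κ =>
      α κ × Addr (S κ) × Fin (S κ).slots)).fst).pair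
      ((hk.comp Feasible.id.fst).pair (ht.comp Feasible.id.fst))).pair Feasible.id.snd.fst)
    exact h
  have h := Feasible.lmap (f := fun κ x (y : Addr (S κ) × Fin (S κ).slots) =>
    (⟨y.1, y.2, ((P κ).material (nj κ) (L κ x) (keys κ x) (t κ x) y.1).1,
      ((P κ).material (nj κ) (L κ x) (keys κ x) (t κ x) y.1).2⟩ : Hop κ (S κ))) (hp.lzip hs)
    (Feasible.id.snd.fst.hop_mk Feasible.id.snd.snd hm.fst hm.snd)
  exact h

theorem f_arrive (E : Efficient S P) {hs : ∀ κ, α κ → List (Hop κ (S κ))} {n : ∀ κ, α κ → ℕ}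
    {R : ∀ κ, α κ → Header κ (S κ)} {payload : ∀ κ, α κ → Bits (S κ).pay}
    (hh : Feasible hs) (hn : Feasible n) (hR : Feasible R) (hp : Feasible payload) :
    Feasible fun κ x => (P κ).arrive (hs κ x) (n κ x) (R κ x) (payload κ x) := by
  have hd : Feasible fun κ x => (hs κ x).drop (n κ x) := .ldrop hn hh
  have hw := E.f_wrap.comp (hd.pair ((E.f_filler.comp (hh.pair hR)).pair hp))
  have h := Feasible.obind (s := fun κ x (h : Hop κ (S κ)) => some (h.addr, ptrOf h.slot,
    (P κ).wrap ((hs κ x).drop (n κ x)) ((P κ).filler (hs κ x) (R κ x), payload κ x))) hd.lhead?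
    (Feasible.osome (Feasible.id.snd.hop_addr.pair
      ((E.f_ptrOf.comp Feasible.id.snd.hop_slot).pair (hw.comp Feasible.id.fst))))
  exact h

theorem f_emit (E : Efficient S P) (hN : Feasible fun κ (_ : Unit) => nj κ)
    {L : ∀ κ, α κ → List (Stream κ (S κ) × Key κ)} {keys : ∀ κ, α κ → List (Addr (S κ) × Key κ)}
    {t : ∀ κ, α κ → ℕ} {pre suf : ∀ κ, α κ → List (Addr (S κ))}
    {σ : ∀ κ, α κ → Fin (S κ).slots → Fin (S κ).slots}
    {R : ∀ κ, α κ → Header κ (S κ)} {payload : ∀ κ, α κ → Bits (S κ).pay}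
    (hL : Feasible L) (hk : Feasible keys) (ht : Feasible t) (hpre : Feasible pre)
    (hsuf : Feasible suf) (hσ : Feasible σ) (hR : Feasible R) (hp : Feasible payload) :
    Feasible fun κ x => (P κ).emit (nj κ) (L κ x) (keys κ x) (t κ x) (pre κ x) (suf κ x) (σ κ x)
      (R κ x) (payload κ x) := by
  have ha := E.f_arrive (E.f_hopsWith hN hL hk ht hσ.toList
    (hpre.lappend (Feasible.lcons hN.param hsuf))) hpre.llength hR hp
  have h := ha.obind (s := fun κ x p => (P κ).pick (L κ x) p)
    (E.f_pick.comp ((hL.comp Feasible.id.fst).pair Feasible.id.snd))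
  exact h

theorem f_valid (E : Efficient S P) (hN : Feasible fun κ (_ : Unit) => nj κ)
    {c : ∀ κ, α κ → Challenge κ (S κ)} (hc : Feasible c) :
    Feasible fun κ x => decide ((c κ x).Valid (nj κ)) := by
  have h := hc.challenge_tuple
  have hi := h.fst
  have hp₁ := h.snd.snd.fst.fst
  have hp₂ := h.snd.snd.fst.snd.fst
  have hs := h.snd.snd.fst.snd.snd
  have hn : Feasible fun κ (_ : α κ) => nj κ := hN.param
  have inj : ∀ κ, Function.Injective (rep : Addr (S κ) → Data) :=
    fun _ => rep_tuple_injective rep_zmod_injective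
  have := Feasible.dand (Feasible.dlt (hi.add (.num 1)) E.f_table.param)
    (.dand hs.isNil.dnot (.dand (Feasible.dmem inj hn hp₁).dnot
      (.dand (Feasible.dmem inj hn hp₂).dnot (.dand (Feasible.dmem inj hn hs).dnot
        (.dand (.dle ((hp₁.llength.add (.num 1)).add hs.llength) E.f_slots.param)
          (.dle ((hp₂.llength.add (.num 1)).add hs.llength) E.f_slots.param))))))
  exact this.congr fun κ x => by
    unfold Challenge.Valid
    congr 1

theorem f_respond (E : Efficient S P) (hN : Feasible fun κ (_ : Unit) => nj κ)
    {L : ∀ κ, α κ → List (Stream κ (S κ) × Key κ)} {b : ∀ κ, α κ → Bool}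
    {w₁ w₂ : ∀ κ, α κ → PacketCoins κ (S κ)} {c : ∀ κ, α κ → Challenge κ (S κ)}
    (hL : Feasible L) (hb : Feasible b) (h₁ : Feasible w₁) (h₂ : Feasible w₂) (hc : Feasible c) :
    Feasible fun κ x => (P κ).respond (nj κ) (L κ x) (b κ x) (w₁ κ x) (w₂ κ x) (c κ x) := by
  have h := hc.challenge_tuple
  have hp₁ := h.snd.snd.fst.fst
  have hp₂ := h.snd.snd.fst.snd.fst
  have hs := h.snd.snd.fst.snd.snd
  exact .ite (E.f_valid hN hc)
    ((E.f_emit hN hL h.snd.snd.snd h.fst hp₁ hs h₁.fst h₁.snd h.snd.fst.fst).pair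
      (E.f_emit hN hL h.snd.snd.snd (h.fst.add (.num 1)) (hb.cond hp₂ hp₁) hs h₂.fst h₂.snd
        h.snd.fst.snd)) (Feasible.onone.pair .onone)

theorem dec_packet (E : Efficient S P) :
    Feasible fun κ (d : Data) => (Code.dec d : Packet κ (S κ)) := by
  have hr : Feasible fun κ (d : Data) => (Code.dec d : RElem κ (S κ)) :=
    .dec_prod (.dec_bits E.f_pat) (.dec_prod (.dec_bits E.f_addr) (.dec_prod (.dec_bits E.f_ptr)
      (.dec_bits .kappa)))
  exact .dec_prod (.dec_bits E.f_addr) (.dec_prod (.dec_bits E.f_ptr)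
    (.dec_prod (.dec_tuple E.f_slots hr) (.dec_bits E.f_pay)))

theorem dec_challenge (E : Efficient S P) :
    Feasible fun κ (d : Data) => (Challenge.ofData d : Challenge κ (S κ)) := by
  have ha : Feasible fun κ (d : Data) => (Code.dec d : Addr (S κ)) := .dec_bits E.f_addr
  have hp : Feasible fun κ (d : Data) => (Code.dec d : Bits (S κ).pay) := .dec_bits E.f_pay
  have h := Feasible.dec_prod Feasible.dec_nat (.dec_prod (.dec_prod hp hp)
    (.dec_prod (.dec_prod (.dec_list ha) (.dec_prod (.dec_list ha) (.dec_list ha)))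
      (.dec_list (.dec_prod ha (.dec_bits .kappa)))))
  exact h.recast fun κ d => rfl

end Efficient

theorem Feasible.adversary_next (A : Adversary) : Feasible fun _ (d : Data) => A.next d :=
  ⟨fun z => A.next z.snd, A.polyTime.comp .snd', fun _ _ => rfl⟩

/-! ### Running an adversary in polynomial time -/

section output

variable {S : ℕ → Sizes} {P : ∀ κ, Scheme κ (S κ)} {α : ℕ → Type} [∀ κ, DataRep (α κ)]
  {nj : ∀ κ, Addr (S κ)} {A : Adversary}

theorem Feasible.move (hN : Feasible fun κ (_ : Unit) => nj κ)
    {r : ∀ κ, α κ → Bits (A.coins.eval κ)} {h : ∀ κ, α κ → List Data} (hr : Feasible r)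
    (hh : Feasible h) : Feasible fun κ x => A.move (nj κ) (r κ x) (h κ x) := by
  have h1 := Feasible.kappa.pair ((hN.param (α := α)).pair (hr.pair hh))
  have h2 : Feasible fun κ x => (Code.enc (κ, nj κ, r κ x, h κ x) : Data) :=
    h1.recast fun κ x => rfl
  exact (Feasible.adversary_next A).comp h2

theorem Efficient.f_query (E : Efficient S P) (hN : Feasible fun κ (_ : Unit) => nj κ)
    {r : ∀ κ, α κ → Bits (A.coins.eval κ)} {h : ∀ κ, α κ → List Data}
    {step : ∀ κ, α κ → Packet κ (S κ) → Option (Packet κ (S κ))} (hr : Feasible r)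
    (hh : Feasible h) (hs : Feasible fun κ (y : α κ × Packet κ (S κ)) => step κ y.1 y.2) :
    Feasible fun κ x => A.query (nj κ) (r κ x) (step κ x) (h κ x) := by
  have h1 := hs.comp (Feasible.id.pair (E.dec_packet.comp (Feasible.move hN hr hh)))
  have h2 : Feasible fun κ x =>
      (Code.enc (step κ x (Code.dec (A.move (nj κ) (r κ x) (h κ x)))) : Data) :=
    h1.recast fun κ x => by
      cases step κ x (Code.dec (A.move (nj κ) (r κ x) (h κ x))) <;> rfl
  exact h2.lcons hh

/-- Whatever the adversary asks, an answer is at most one packet, whose size is bounded in terms of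
`κ` alone. The history therefore grows linearly in the number of queries, and feeding it back to the
adversary causes no blow-up. -/
theorem Efficient.f_queries (E : Efficient S P) (hN : Feasible fun κ (_ : Unit) => nj κ)
    {r : ∀ κ, α κ → Bits (A.coins.eval κ)} {h : ∀ κ, α κ → List Data}
    {step : ∀ κ, α κ → Packet κ (S κ) → Option (Packet κ (S κ))} (q : Polynomial ℕ)
    (hr : Feasible r) (hh : Feasible h)
    (hs : Feasible fun κ (y : α κ × Packet κ (S κ)) => step κ y.1 y.2) :
    Feasible fun κ x => (A.query (nj κ) (r κ x) (step κ x))^[q.eval κ] (h κ x) := by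
  refine Feasible.iterate (step := fun κ x => A.query (nj κ) (r κ x) (step κ x)) (.evalPoly q) hh
    (E.f_query hN (hr.comp Feasible.id.fst) Feasible.id.snd (step := fun κ x => step κ x.1)
      (hs.comp (Feasible.id.fst.fst.pair Feasible.id.snd))) ?_
  obtain ⟨c, hc⟩ := E.polySize_packet.option
  obtain ⟨d, hd⟩ := hh.size_le
  refine ⟨d + q * (c + 1), fun κ x i hi => ?_⟩
  have key : ∀ i, (rep ((A.query (nj κ) (r κ x) (step κ x))^[i] (h κ x))).size ≤
      (rep (h κ x)).size + i * (c.eval κ + 1) := by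
    intro i
    induction i with
    | zero => simp
    | succ i ih =>
      rw [Function.iterate_succ_apply']
      generalize (A.query (nj κ) (r κ x) (step κ x))^[i] (h κ x) = l at ih
      rw [Adversary.query, rep_cons, Data.size, add_mul, one_mul]
      have h1 := hc κ (step κ x (Code.dec (A.move (nj κ) (r κ x) l)))
      have h2 : rep (Code.enc (step κ x (Code.dec (A.move (nj κ) (r κ x) l)))) =
          rep (step κ x (Code.dec (A.move (nj κ) (r κ x) l))) := by
        cases step κ x (Code.dec (A.move (nj κ) (r κ x) l)) <;> rfl
      rw [h2]; omega
  refine (key i).trans ?_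
  have h3 : κ ≤ (Data.cons (rep κ) (rep x)).size := by
    simp only [Data.size, rep_nat, size_unary]; omega
  have h4 := polynomial_eval_mono c h3
  have h5 := polynomial_eval_mono q h3
  simp only [Polynomial.eval_add, Polynomial.eval_mul, Polynomial.eval_one] at *
  exact Nat.add_le_add (hd κ x) (Nat.mul_le_mul (hi.trans h5) (by omega))

theorem Efficient.f_output (E : Efficient S P) (hN : Feasible fun κ (_ : Unit) => nj κ)
    {r : ∀ κ, α κ → Bits (A.coins.eval κ)}
    {step : ∀ κ, α κ → Packet κ (S κ) → Option (Packet κ (S κ))}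
    {ans : ∀ κ, α κ → Challenge κ (S κ) → Option (Packet κ (S κ)) × Option (Packet κ (S κ))}
    (hr : Feasible r) (hs : Feasible fun κ (y : α κ × Packet κ (S κ)) => step κ y.1 y.2)
    (ha : Feasible fun κ (y : α κ × Challenge κ (S κ)) => ans κ y.1 y.2) :
    Feasible fun κ x => A.output (nj κ) (r κ x) (step κ x) (ans κ x) := by
  have h₁ := E.f_queries (A := A) hN A.queries₁ hr Feasible.lnil hs
  have h₂ := ha.comp (Feasible.id.pair (E.dec_challenge.comp (Feasible.move hN hr h₁)))
  have h₃ : Feasible fun κ x => (Code.enc (ans κ x (Challenge.ofData (A.move (nj κ) (r κ x)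
      ((A.query (nj κ) (r κ x) (step κ x))^[A.queries₁.eval κ] [])))) : Data) :=
    h₂.recast fun κ x => by
      rcases ans κ x (Challenge.ofData (A.move (nj κ) (r κ x)
        ((A.query (nj κ) (r κ x) (step κ x))^[A.queries₁.eval κ] []))) with ⟨_ | a, _ | b⟩ <;> rfl
  have h := Feasible.move hN hr (E.f_queries (A := A) hN A.queries₂ hr (h₃.lcons h₁) hs)
  exact h

end output

/-! ## Probability on finite sets -/

section prob

variable {Ω Ω' : Type} [Fintype Ω] [Fintype Ω']

open Classical in
theorem prob_eq (E : Ω → Prop) : prob E = (∑ w, if E w then (1 : ℝ) else 0) / Fintype.card Ω := by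
  unfold prob
  rw [Finset.sum_boole]

theorem prob_equiv (e : Ω ≃ Ω') (E : Ω' → Prop) : prob (fun w => E (e w)) = prob E := by
  classical
  rw [prob_eq, prob_eq, Fintype.card_congr e, e.sum_comp fun w => if E w then (1 : ℝ) else 0]

theorem prob_injective {f : Ω → Ω} (hf : Function.Injective f) (E : Ω → Prop) :
    prob (fun w => E (f w)) = prob E :=
  prob_equiv (Equiv.ofBijective f (Finite.injective_iff_bijective.1 hf)) E

theorem prob_mono {E F : Ω → Prop} (h : ∀ w, E w → F w) : prob E ≤ prob F := by
  unfold prob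
  gcongr
  exact h _

theorem prob_or_le (E F : Ω → Prop) : prob (fun w => E w ∨ F w) ≤ prob E + prob F := by
  classical
  unfold prob
  rw [← add_div, ← Nat.cast_add]
  gcongr
  refine le_trans (Finset.card_le_card fun w hw => ?_) (Finset.card_union_le _ _)
  simpa using hw

theorem prob_exists_le {ι : Type} (s : Finset ι) (E : ι → Ω → Prop) :
    prob (fun w => ∃ i ∈ s, E i w) ≤ ∑ i ∈ s, prob (E i) := by
  classical
  induction s using Finset.induction_on with
  | empty => simp [prob]
  | insert a s ha ih =>
    rw [Finset.sum_insert ha]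
    refine le_trans ?_ ((prob_or_le _ _).trans (add_le_add le_rfl ih))
    exact prob_mono fun w => by simp

/-- The difference lemma of game hopping: two events that agree outside `B` can be exchanged at the
price of the probability of `B`. -/
theorem abs_prob_sub_le {E F B : Ω → Prop} (h : ∀ w, ¬ B w → (E w ↔ F w)) :
    |prob E - prob F| ≤ prob B := by
  have h1 : prob E ≤ prob F + prob B :=
    (prob_mono fun w hw => by by_cases hB : B w
                              · exact Or.inr hB
                              · exact Or.inl ((h w hB).1 hw)).trans (prob_or_le F B)
  have h2 : prob F ≤ prob E + prob B :=
    (prob_mono fun w hw => by by_cases hB : B w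
                              · exact Or.inr hB
                              · exact Or.inl ((h w hB).2 hw)).trans (prob_or_le E B)
  rw [abs_le]; constructor <;> linarith

theorem prob_prod (E : Ω × Ω' → Prop) :
    prob E = (∑ a, prob fun b => E (a, b)) / Fintype.card Ω := by
  classical
  simp only [prob_eq]
  rw [Fintype.sum_prod_type, Fintype.card_prod, ← Finset.sum_div, Nat.cast_mul, div_div,
    mul_comm (Fintype.card Ω : ℝ)]

theorem prob_fst [Nonempty Ω'] (E : Ω → Prop) : prob (fun w : Ω × Ω' => E w.1) = prob E := by
  classical
  rw [prob_prod, prob_eq]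
  congr 1
  refine Finset.sum_congr rfl fun a _ => ?_
  by_cases h : E a
  · have : (Fintype.card Ω' : ℝ) ≠ 0 := by simp [Fintype.card_ne_zero]
    simp [prob_eq, h, this]
  · simp [prob_eq, h]

theorem prob_snd [Nonempty Ω'] (E : Ω → Prop) : prob (fun w : Ω' × Ω => E w.2) = prob E := by
  rw [← prob_fst (Ω' := Ω') E]
  exact prob_equiv (Equiv.prodComm _ _) fun w : Ω × Ω' => E w.1

/-- If at most one element of a family of permutations of the sample space leads into an event, the
event has small probability. -/
theorem prob_le_of_family {V : Type} [Fintype V] [Nonempty V] (act : V → Ω → Ω)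
    (hact : ∀ v, Function.Injective (act v)) (E : Ω → Prop)
    (h : ∀ w v v', E (act v w) → E (act v' w) → v = v') : prob E ≤ 1 / Fintype.card V := by
  classical
  have h1 : (Fintype.card V : ℝ) * prob E ≤ 1 := by
    -- Double counting: every `act v` preserves probability, so the sum over `v` is a multiple of
    -- `prob E`. With the order of summation exchanged, each sample point is counted at most once.
    have h2 : ∑ v, prob (fun w => E (act v w)) = Fintype.card V * prob E := by
      simp_rw [fun v => prob_injective (hact v) E]
      simp
    rw [← h2]
    simp only [prob_eq]
    rw [← Finset.sum_div, Finset.sum_comm]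
    refine div_le_one_of_le₀ ?_ (by positivity)
    refine (Finset.sum_le_card_nsmul _ _ 1 fun w _ => ?_).trans (by simp)
    rw [Finset.sum_boole]
    norm_cast
    refine Finset.card_le_one.2 fun v hv v' hv' => ?_
    simp only [Finset.mem_filter, Finset.mem_univ, true_and] at hv hv'
    exact h w v v' hv hv'
  have h3 : (0 : ℝ) < Fintype.card V := by exact_mod_cast Fintype.card_pos
  rw [le_div_iff₀ h3, mul_comm]
  exact h1

end prob

/-! ### Projections and sampling -/

/-- A map that looks like a projection of a product; it transports the uniform distribution to the
uniform distribution. -/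
def IsProjection {Ω Ω' : Type} (f : Ω → Ω') : Prop :=
  ∃ (V : Type) (_ : Fintype V) (_ : Nonempty V) (e : Ω ≃ Ω' × V), ∀ w, f w = (e w).1

namespace IsProjection

variable {Ω Ω' Ω'' Ω₂ Ω₂' : Type}

theorem prob_eq [Fintype Ω] [Fintype Ω'] {f : Ω → Ω'} (hf : IsProjection f) (E : Ω' → Prop) :
    prob (fun w => E (f w)) = prob E := by
  obtain ⟨V, _, _, e, he⟩ := hf
  simp_rw [he]
  rw [prob_equiv e fun w => E w.1, prob_fst]

theorem of_bijective {f : Ω → Ω'} (hf : Function.Bijective f) : IsProjection f :=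
  ⟨Unit, inferInstance, inferInstance, (Equiv.ofBijective f hf).trans (Equiv.prodPUnit _).symm,
    fun _ => rfl⟩

theorem id : IsProjection (fun w : Ω => w) := of_bijective Function.bijective_id

theorem comp {g : Ω' → Ω''} {f : Ω → Ω'} (hg : IsProjection g) (hf : IsProjection f) :
    IsProjection fun w => g (f w) := by
  obtain ⟨V, _, _, e, he⟩ := hf
  obtain ⟨V', _, _, e', he'⟩ := hg
  refine ⟨V' × V, inferInstance, inferInstance,
    (e.trans (e'.prodCongr (Equiv.refl V))).trans (Equiv.prodAssoc _ _ _), fun w => ?_⟩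
  beta_reduce
  rw [he', he]; rfl

theorem prod {f : Ω → Ω'} {g : Ω₂ → Ω₂'} (hf : IsProjection f) (hg : IsProjection g) :
    IsProjection fun w : Ω × Ω₂ => (f w.1, g w.2) := by
  obtain ⟨V, _, _, e, he⟩ := hf
  obtain ⟨V', _, _, e', he'⟩ := hg
  refine ⟨V × V', inferInstance, inferInstance,
    (e.prodCongr e').trans (Equiv.prodProdProdComm _ _ _ _), fun w => ?_⟩
  beta_reduce
  rw [he', he]; rfl

theorem pi {A : Type} [Fintype A] {f : Ω → Ω'} (hf : IsProjection f) :
    IsProjection fun (w : A → Ω) a => f (w a) := by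
  classical
  obtain ⟨V, _, _, e, he⟩ := hf
  refine ⟨A → V, inferInstance, inferInstance,
    (Equiv.piCongrRight fun _ => e).trans (Equiv.arrowProdEquivProdArrow A (fun _ => Ω')
      fun _ => V), fun w => ?_⟩
  funext a
  exact he _

/-- The coordinates outside the range of `i` form the complementary factor. -/
theorem reindex {A B X : Type} [Fintype B] [Fintype X] [Nonempty X] {i : A → B}
    (hi : Function.Injective i) : IsProjection fun (w : B → X) a => w (i a) := by
  classical
  refine ⟨{b // b ∉ Set.range i} → X, inferInstance, inferInstance,
    (Equiv.piEquivPiSubtypeProd (· ∈ Set.range i) fun _ => X).trans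
      (((Equiv.ofInjective i hi).symm.arrowCongr (Equiv.refl X)).prodCongr (Equiv.refl _)),
      fun w => ?_⟩
  rfl

end IsProjection

/-- Families of finite sets whose uniform distributions can be sampled efficiently from uniformly
random bits. -/
def Samplable (W : ℕ → Type) [∀ κ, DataRep (W κ)] : Prop :=
  ∃ (c : Polynomial ℕ) (s : ∀ κ, Bits (c.eval κ) → W κ), Feasible s ∧ ∀ κ, IsProjection (s κ)

namespace Samplable

variable {W W' : ℕ → Type} [∀ κ, DataRep (W κ)] [∀ κ, DataRep (W' κ)]

theorem zmod : Samplable fun _ => ZMod 2 := by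
  refine ⟨1, fun κ x => x ⟨0, by simp⟩, ?_, fun κ => ?_⟩
  · exact .app .id (.ofVal (.num 0))
  · have hi : Function.Injective fun _ : Unit => (⟨0, by simp⟩ : Fin (Polynomial.eval κ 1)) :=
      fun _ _ _ => rfl
    exact (IsProjection.of_bijective (Equiv.funUnique Unit (ZMod 2)).bijective).comp
      (IsProjection.reindex hi)

theorem of_bijective (h : Samplable W) {f : ∀ κ, W κ → W' κ} (hf : Feasible f)
    (hb : ∀ κ, Function.Bijective (f κ)) : Samplable W' := by
  obtain ⟨c, s, hs, hp⟩ := h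
  exact ⟨c, _, hf.comp hs, fun κ => (IsProjection.of_bijective (hb κ)).comp (hp κ)⟩

theorem bool : Samplable fun _ => Bool := by
  refine zmod.of_bijective (f := fun _ x => decide (x = 1)) (.deq (fun _ => rep_zmod_injective)
    .id .zmod_one) fun κ => ⟨?_, ?_⟩
  · have : ∀ a b : ZMod 2, decide (a = 1) = decide (b = 1) → a = b := by decide
    exact fun a b => this a b
  · have : ∀ b, ∃ a : ZMod 2, decide (a = 1) = b := by decide
    exact this

theorem prod (h : Samplable W) (h' : Samplable W') : Samplable fun κ => W κ × W' κ := by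
  obtain ⟨c, s, hs, hp⟩ := h
  obtain ⟨d, t, ht, hq⟩ := h'
  have hc : ∀ κ (i : Fin (c.eval κ)), (i : ℕ) < (c + d).eval κ := fun κ i => by
    rw [Polynomial.eval_add]; omega
  have hd : ∀ κ (i : Fin (d.eval κ)), c.eval κ + (i : ℕ) < (c + d).eval κ := fun κ i => by
    rw [Polynomial.eval_add]; omega
  refine ⟨c + d, fun κ x => (s κ fun i => x ⟨i, hc κ i⟩, t κ fun i => x ⟨_, hd κ i⟩), ?_,
    fun κ => ?_⟩
  · refine .pair (hs.comp (.lam (f := fun κ (x : Bits ((c + d).eval κ)) i => x ⟨i, hc κ i⟩)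
      (.evalPoly c) (.app Feasible.id.fst (.ofVal Feasible.id.snd.val)))) (ht.comp
      (.lam (f := fun κ (x : Bits ((c + d).eval κ)) i => x ⟨_, hd κ i⟩)
      (.evalPoly d) (.app Feasible.id.fst (.ofVal ((Feasible.evalPoly c).add
        Feasible.id.snd.val)))))
  · let i : Fin (c.eval κ) ⊕ Fin (d.eval κ) → Fin ((c + d).eval κ) :=
      Sum.elim (fun i => ⟨i, hc κ i⟩) fun i => ⟨_, hd κ i⟩
    have hi : Function.Injective i := by
      rintro (a | a) (b | b) h <;> simp [i, Fin.ext_iff] at h ⊢ <;> omega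
    exact ((hp κ).prod (hq κ)).comp ((IsProjection.of_bijective
      (Equiv.sumArrowEquivProdArrow _ _ _).bijective).comp (IsProjection.reindex (X := ZMod 2) hi))

theorem tuple {n : ℕ → ℕ} (hn : Feasible fun κ (_ : Unit) => n κ) (h : Samplable W) :
    Samplable fun κ => Fin (n κ) → W κ := by
  obtain ⟨c, s, hs, hp⟩ := h
  obtain ⟨p, hnp⟩ := PolySize.exists_le hn
  -- The `i`-th component reads the `i`-th block of `c.eval κ` bits. The number of bits must be a
  -- polynomial, so there are `p.eval κ ≥ n κ` blocks; the surplus is ignored.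
  have hlt : ∀ κ (i : Fin (n κ)) (j : Fin (c.eval κ)),
      (i : ℕ) * c.eval κ + j < (p * c).eval κ := fun κ i j => by
    rw [Polynomial.eval_mul]
    have h1 : ((i : ℕ) + 1) * c.eval κ ≤ p.eval κ * c.eval κ :=
      Nat.mul_le_mul_right _ (i.isLt.trans_le (hnp κ))
    have := j.isLt
    rw [add_mul] at h1
    omega
  refine ⟨p * c, fun κ x i => s κ fun j => x ⟨_, hlt κ i j⟩, ?_, fun κ => ?_⟩
  · refine .lam hn (hs.comp (.lam
      (f := fun κ (x : Bits ((p * c).eval κ) × Fin (n κ)) j => x.1 ⟨_, hlt κ x.2 j⟩)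
      (.evalPoly c) (.app Feasible.id.fst.fst (.ofVal ?_))))
    exact (Feasible.id.fst.snd.val.mul (.evalPoly c)).add Feasible.id.snd.val
  · let i : Fin (n κ) × Fin (c.eval κ) → Fin ((p * c).eval κ) := fun a => ⟨_, hlt κ a.1 a.2⟩
    have hi : Function.Injective i := by
      rintro ⟨a, b⟩ ⟨a', b'⟩ h
      simp only [i, Fin.mk.injEq] at h
      have h1 : (a : ℕ) = a' := by
        have e1 := Nat.add_mul_div_right b a (b.pos)
        have e2 := Nat.add_mul_div_right b' a' (b.pos)
        rw [Nat.div_eq_of_lt b.isLt] at e1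
        rw [Nat.div_eq_of_lt b'.isLt] at e2
        rw [add_comm] at e1 e2
        rw [h, e2] at e1
        omega
      have h2 : (b : ℕ) = b' := by rw [h1] at h; omega
      ext <;> assumption
    exact (hp κ).pi.comp ((IsProjection.of_bijective
      (Equiv.curry _ _ _).bijective).comp (IsProjection.reindex (X := ZMod 2) hi))

theorem bits {n : ℕ → ℕ} (hn : Feasible fun κ (_ : Unit) => n κ) :
    Samplable fun κ => Bits (n κ) := tuple hn zmod

end Samplable

/-- Distinguishing with efficiently samplable additional randomness. -/
theorem Indistinguishable.test {Ω Ω' α β W : ℕ → Type} [∀ κ, Fintype (Ω κ)]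
    [∀ κ, Fintype (Ω' κ)] [∀ κ, Fintype (W κ)] [∀ κ, Code (α κ)] [∀ κ, DataRep (β κ)]
    [∀ κ, DataRep (W κ)] {X : ∀ κ, Ω κ → α κ} {Y : ∀ κ, Ω' κ → α κ} (h : Indistinguishable X Y)
    {X' : ∀ κ, Ω κ → β κ} {Y' : ∀ κ, Ω' κ → β κ} (hX : ∀ κ w, rep (X' κ w) = Code.enc (X κ w))
    (hY : ∀ κ w, rep (Y' κ w) = Code.enc (Y κ w)) (hW : Samplable W)
    {test : ∀ κ, β κ → W κ → Bool} (ht : Feasible fun κ (y : β κ × W κ) => test κ y.1 y.2) :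
    Negligible fun κ => |prob (fun w : Ω κ × W κ => test κ (X' κ w.1) w.2 = true) -
      prob (fun w : Ω' κ × W κ => test κ (Y' κ w.1) w.2 = true)| := by
  obtain ⟨c, s, hs, hp⟩ := hW
  -- The sampler becomes part of the distinguisher, whose coins are its input bits.
  obtain ⟨F, hF, e⟩ := ht.comp (Feasible.id.fst.pair (hs.comp Feasible.id.snd))
  have key : ∀ κ (x : α κ) (y : β κ) (r : Bits (c.eval κ)), rep y = Code.enc x →
      (F (Code.enc (κ, x, r)) ≠ .nil ↔ test κ y (s κ r) = true) := by
    intro κ x y r hxy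
    have h1 : (Code.enc (κ, x, r) : Data) = .cons (rep κ) (rep (y, r)) := by
      rw [rep_pair, hxy]; rfl
    rw [h1, e]
    beta_reduce
    cases test κ y (s κ r) <;> simp [rep_false, rep_true]
  have h := h ⟨F, hF, c⟩
  simp only at h
  convert h using 4 with κ
  · rw [← ((IsProjection.id (Ω := Ω κ)).prod (hp κ)).prob_eq]
    congr 1; funext w
    exact propext (key κ _ _ _ (hX κ w.1)).symm
  · rw [← ((IsProjection.id (Ω := Ω' κ)).prod (hp κ)).prob_eq]
    congr 1; funext w
    exact propext (key κ _ _ _ (hY κ w.1)).symm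

/-! ## Correctness of the protocol -/

section

variable {κ : ℕ} {S : Sizes}

/-- Digits from position `S.ptr` on vanish, because slot numbers lie below `2 ^ S.ptr`; this is the
use of `S.slots_le`. -/
theorem ptrOf_injective : Function.Injective (ptrOf : Fin S.slots → Ptr S) := by
  intro s s' h
  refine Fin.ext (Nat.eq_of_testBit_eq fun i => ?_)
  by_cases hi : i < S.ptr
  · have h1 := congrFun h ⟨i, hi⟩
    simp only [ptrOf] at h1
    by_cases a : s.val.testBit i <;> by_cases b : s'.val.testBit i <;> simp_all
  · have h2 : 2 ^ S.ptr ≤ 2 ^ i := Nat.pow_le_pow_right (by norm_num) (by omega)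
    rw [Nat.testBit_lt_two_pow (s.isLt.trans_le (S.slots_le.trans h2)),
      Nat.testBit_lt_two_pow (s'.isLt.trans_le (S.slots_le.trans h2))]

@[simp] theorem slotOf_ptrOf (s : Fin S.slots) : slotOf (ptrOf s) = some s := by
  unfold slotOf
  have h : ((List.finRange S.slots).find? fun s' => decide (ptrOf s' = ptrOf s)).isSome := by
    rw [List.find?_isSome]
    exact ⟨s, List.mem_finRange s, by simp⟩
  obtain ⟨s', hs'⟩ := Option.isSome_iff_exists.1 h
  have := List.find?_some hs'
  rw [decide_eq_true_eq] at this
  rw [hs', ptrOf_injective this]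

theorem bits_add_self {n : ℕ} (x : Bits n) : x + x = 0 := by
  funext i
  have : ∀ a : ZMod 2, a + a = 0 := by decide
  exact this _

theorem relem_add_self (x : RElem κ S) : x + x = 0 := by
  refine Prod.ext (bits_add_self _) (Prod.ext (bits_add_self _) (Prod.ext (bits_add_self _)
    (bits_add_self _)))

theorem header_add_self (x : Header κ S) : x + x = 0 := funext fun _ => relem_add_self _

theorem body_add_self (x : Body κ S) : x + x = 0 :=
  Prod.ext (header_add_self _) (bits_add_self _)

/-- Outside the slots of the path, preparation and wrapping add the same masks, and these cancel in
characteristic two. -/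
theorem Scheme.wrap_filler_of_not_mem (P : Scheme κ S) (l : List (Hop κ S)) (R : Header κ S)
    (pay : Bits S.pay) {s : Fin S.slots} (hs : s ∉ l.map Hop.slot) :
    (P.wrap l (P.filler l R, pay)).1 s = R s := by
  induction l generalizing R with
  | nil => rfl
  | cons h l ih =>
    rw [List.map_cons, List.mem_cons, not_or] at hs
    simp only [Scheme.filler, Scheme.wrap]
    rw [Function.update_of_ne hs.1]
    change (P.wrap l (P.filler l _, pay)).1 s + h.stream.2.1 s = _
    rw [ih _ hs.2]
    change Function.update R h.slot (P.relem h l 0) s + h.stream.2.1 s + h.stream.2.1 s = R s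
    rw [Function.update_of_ne hs.1, add_assoc, relem_add_self, add_zero]

/-- The routing element that the filler prepared for a node reappears when the node has to check
its tag. -/
theorem Scheme.wrap_filler_slot (P : Scheme κ S) (h : Hop κ S) (l : List (Hop κ S))
    (R : Header κ S) (pay : Bits S.pay) (hs : h.slot ∉ l.map Hop.slot) :
    (P.wrap l (P.filler (h :: l) R, pay) + h.stream.2).1 h.slot = P.relem h l 0 := by
  simp only [Scheme.filler]
  change (P.wrap l (P.filler l _, pay)).1 h.slot + h.stream.2.1 h.slot = _
  rw [P.wrap_filler_of_not_mem l _ pay hs]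
  change Function.update R h.slot (P.relem h l 0) h.slot + h.stream.2.1 h.slot +
    h.stream.2.1 h.slot = _
  rw [Function.update_self, add_assoc, relem_add_self, add_zero]

theorem Scheme.relem_eq (P : Scheme κ S) (h : Hop κ S) (l : List (Hop κ S)) (tag : Key κ) :
    P.relem h l tag = (P.pattern, (l.headD h).addr, ptrOf (l.headD h).slot, tag) := rfl

/-- Correctness of one hop. The source computed the tag on a body whose slot already held the
routing element with zero tag (`wrap_filler_slot`). When the node unmasks its element and clears the
tag field it restores exactly this body, so the check succeeds; adding the mask again removes the
layer. -/
theorem Scheme.relay_wrap (P : Scheme κ S) (h : Hop κ S) (l : List (Hop κ S))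
    (R : Header κ S) (pay : Bits S.pay) (hs : h.slot ∉ l.map Hop.slot) :
    P.relay h.stream h.macKey (h.addr, ptrOf h.slot, P.wrap (h :: l) (P.filler (h :: l) R, pay)) =
      some ((l.headD h).addr, ptrOf (l.headD h).slot, P.wrap l (P.filler (h :: l) R, pay)) := by
  have key := P.wrap_filler_slot h l R pay hs
  have hw : P.wrap (h :: l) (P.filler (h :: l) R, pay) =
      (Function.update (P.wrap l (P.filler (h :: l) R, pay) + h.stream.2).1 h.slot
        (P.relem h l (P.mac h.macKey (P.wrap l (P.filler (h :: l) R, pay) + h.stream.2)) +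
          h.stream.1), (P.wrap l (P.filler (h :: l) R, pay) + h.stream.2).2) := rfl
  rw [hw, Scheme.relay_eq]
  generalize P.wrap l (P.filler (h :: l) R, pay) = X at key
  simp only [slotOf_ptrOf, Option.bind_some, Function.update_self, Function.update_idem]
  rw [add_assoc, relem_add_self, add_zero]
  have hup : ((Function.update (X + h.stream.2).1 h.slot (P.relem h l 0), (X + h.stream.2).2) :
      Body κ S) = X + h.stream.2 := by rw [← key, Function.update_eq_self]
  refine (if_pos ?_).trans ?_
  · exact congrArg (P.mac h.macKey) hup
  · change some (_, _, ((Function.update (X + h.stream.2).1 h.slot (P.relem h l 0),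
      (X + h.stream.2).2) : Body κ S) + h.stream.2) = _
    rw [hup, add_assoc, body_add_self, add_zero]
    rfl

theorem Scheme.foldlM_relay (P : Scheme κ S) (a l : List (Hop κ S)) (g : Hop κ S)
    (R : Header κ S) (pay : Bits S.pay) (hnd : ((a ++ g :: l).map Hop.slot).Nodup) :
    (a.foldlM (fun pkt h => P.relay h.stream h.macKey pkt)
      (((a ++ g :: l).headD g).addr, ptrOf ((a ++ g :: l).headD g).slot,
        P.wrap (a ++ g :: l) (P.filler (a ++ g :: l) R, pay))) =
      some (g.addr, ptrOf g.slot, P.wrap (g :: l) (P.filler (a ++ g :: l) R, pay)) := by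
  induction a generalizing R with
  | nil => rfl
  | cons h a ih =>
    rw [List.cons_append, List.map_cons, List.nodup_cons] at hnd
    have h1 := P.relay_wrap h (a ++ g :: l) R pay hnd.1
    rw [List.foldlM_cons]
    simp only [List.cons_append, List.headD_cons] at h1 ⊢
    rw [h1]
    -- The preparation for the first hop turns `R` into this vector, and the preparation for the
    -- rest of the path starts from it. Hence the induction is general in `R`.
    have h2 := ih (Function.update R h.slot (P.relem h (a ++ g :: l) 0) + h.stream.2.1) hnd.2
    have h3 : (a ++ g :: l).headD h = (a ++ g :: l).headD g := by cases a <;> rfl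
    rw [h3]
    exact h2

theorem Scheme.pick_eq_nodeStep (P : Scheme κ S) (k : Key κ) :
    P.pick ((List.range S.table).map (P.derive k)) = P.nodeStep k := by
  funext pkt
  unfold Scheme.pick Scheme.nodeStep
  cases slotOf pkt.2.1 with
  | none => rfl
  | some s =>
    simp only [Option.bind_some, List.find?_map]
    have e : ((fun m : Stream κ S × Key κ => decide ((pkt.2.2.1 s).1 = P.pattern + m.1.1.1)) ∘
      P.derive k) = fun t => decide ((pkt.2.2.1 s).1 = P.pattern + (P.derive k t).1.1.1) := rfl
    rw [e]
    cases (List.range S.table).find?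
      (fun t => decide ((pkt.2.2.1 s).1 = P.pattern + (P.derive k t).1.1.1)) <;> rfl

theorem map_slot_hopsWith (mat : Addr S → Stream κ S × Key κ) (slots : List (Fin S.slots))
    (path : List (Addr S)) (h : path.length ≤ slots.length) :
    (hopsWith mat slots path).map Hop.slot = slots.take path.length := by
  rw [hopsWith, List.map_map]
  induction path generalizing slots with
  | nil => simp
  | cons a p ih =>
    cases slots with
    | nil => simp at h
    | cons s slots =>
      simp only [List.length_cons, Nat.add_le_add_iff_right] at h
      simp only [List.zip_cons_cons, List.map_cons, List.length_cons, List.take_succ_cons]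
      rw [ih slots h]
      rfl

theorem hopsWith_append (mat : Addr S → Stream κ S × Key κ) (slots : List (Fin S.slots))
    (p q : List (Addr S)) : hopsWith mat slots (p ++ q) =
      hopsWith mat slots p ++ hopsWith mat (slots.drop p.length) q := by
  induction p generalizing slots with
  | nil => simp [hopsWith]
  | cons a p ih =>
    cases slots with
    | nil => simp [hopsWith]
    | cons s slots =>
      have h1 : ∀ p, hopsWith mat (s :: slots) (a :: p) =
        ⟨a, s, (mat a).1, (mat a).2⟩ :: hopsWith mat slots p := fun _ => rfl
      rw [List.cons_append, h1, h1, ih]; rfl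

theorem length_hopsWith (mat : Addr S → Stream κ S × Key κ) (slots : List (Fin S.slots))
    (path : List (Addr S)) (h : path.length ≤ slots.length) :
    (hopsWith mat slots path).length = path.length := by
  simp [hopsWith, h]

theorem hopsWith_congr {mat mat' : Addr S → Stream κ S × Key κ} {slots : List (Fin S.slots)}
    {path : List (Addr S)} (h : ∀ a ∈ path, mat a = mat' a) :
    hopsWith mat slots path = hopsWith mat' slots path := by
  refine List.map_congr_left fun x hx => ?_
  rw [h _ (List.of_mem_zip hx).1]

/-- Since the slots are distinct, all relays before the honest node accept and just strip layers, so
their actions disappear from the game. After this, the key of the honest node enters only through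
its table of derived material. -/
theorem Scheme.emitted_eq_emit (P : Scheme κ S) (c : Challenge κ S) {nj : Addr S} (k : Key κ)
    {t : ℕ} (ht : t < S.table) (pre suf : List (Addr S)) (seed : Bits S.seed) (R : Header κ S)
    (pay : Bits S.pay) (hlen : pre.length + 1 + suf.length ≤ S.slots) :
    P.emitted (c.keyOf nj k) nj t pre suf seed R pay =
      P.emit nj ((List.range S.table).map (P.derive k)) c.keys t pre suf (P.perm seed) R pay := by
  have hmat : (fun a => P.derive (c.keyOf nj k a) t) =
      P.material nj ((List.range S.table).map (P.derive k)) c.keys t := by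
    funext a
    unfold Scheme.material Challenge.keyOf
    split_ifs
    · rw [List.headD_eq_head?_getD, List.head?_drop]
      simp [ht]
    · rfl
  have hhops : P.hops (c.keyOf nj k) t (P.perm seed) (pre ++ nj :: suf) =
      hopsWith (P.material nj ((List.range S.table).map (P.derive k)) c.keys t)
        (List.ofFn (P.perm seed)) (pre ++ nj :: suf) := by
    rw [← hmat, List.ofFn_eq_map]; rfl
  have hl : (pre ++ nj :: suf).length ≤ (List.ofFn (P.perm seed)).length := by
    rw [List.length_ofFn, List.length_append, List.length_cons]; omega
  have hnd : ((hopsWith (P.material nj ((List.range S.table).map (P.derive k)) c.keys t)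
        (List.ofFn (P.perm seed)) (pre ++ nj :: suf)).map Hop.slot).Nodup := by
    rw [map_slot_hopsWith _ _ _ hl]
    exact (List.nodup_ofFn.2 (P.perm seed).injective).sublist (List.take_sublist _ _)
  unfold Scheme.emitted Scheme.emit Scheme.arrive
  rw [hhops, P.pick_eq_nodeStep, show c.keyOf nj k nj = k from if_pos rfl]
  generalize P.material nj ((List.range S.table).map (P.derive k)) c.keys t = mat at hnd
  rw [hopsWith_append] at hnd ⊢
  have hlp : (hopsWith mat (List.ofFn (P.perm seed)) pre).length = pre.length :=
    length_hopsWith _ _ _ (by rw [List.length_ofFn]; omega)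
  obtain ⟨g, l, hgl⟩ : ∃ g l, hopsWith mat ((List.ofFn (P.perm seed)).drop pre.length)
      (nj :: suf) = g :: l := by
    apply List.exists_cons_of_ne_nil
    rw [← List.length_pos_iff, length_hopsWith]
    · simp
    · rw [List.length_drop, List.length_ofFn, List.length_cons]; omega
  rw [hgl] at hnd ⊢
  generalize hopsWith mat (List.ofFn (P.perm seed)) pre = a at hnd hlp ⊢
  rw [← hlp, List.drop_left, List.head?_cons, Option.bind_some]
  have key := P.foldlM_relay a l g R pay hnd
  cases a with
  | nil => rfl
  | cons h a =>
    simp only [List.cons_append]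
    have h2 : (h :: (a ++ g :: l)).take (h :: a).length = h :: a := by simp
    rw [h2]
    exact congrArg (fun o => Option.bind o (P.nodeStep k)) key

theorem Scheme.answer_eq_respond (P : Scheme κ S) (nj : Addr S) (w : ChallengerCoins κ S) :
    P.answer nj w = P.respond nj ((List.range S.table).map (P.derive w.1)) w.2.1
      (P.perm w.2.2.1.1, w.2.2.1.2) (P.perm w.2.2.2.1, w.2.2.2.2) := by
  funext c
  unfold Scheme.answer Scheme.respond
  by_cases hv : c.Valid nj
  · rw [if_pos hv, if_pos hv]
    obtain ⟨h1, -, -, -, -, h2, h3⟩ := hv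
    rw [P.emitted_eq_emit c w.1 (by omega) _ _ _ _ _ h2, P.emitted_eq_emit c w.1 (by omega)]
    split_ifs <;> assumption
  · rw [if_neg hv, if_neg hv]

end

/-! ## The ideal form of the packets -/

section

variable {κ : ℕ} {S : Sizes}

/-- The part of the preparation of the routing vector that belongs to the first hops. -/
def Scheme.prefill (P : Scheme κ S) : List (Hop κ S) → List (Hop κ S) → Header κ S → Header κ S
  | [], _, R => R
  | h :: a, rest, R =>
      P.prefill a rest (Function.update R h.slot (P.relem h (a ++ rest) 0) + h.stream.2.1)

theorem Scheme.filler_append (P : Scheme κ S) (a l : List (Hop κ S)) (R : Header κ S) :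
    P.filler (a ++ l) R = P.filler l (P.prefill a l R) := by
  induction a generalizing R with
  | nil => rfl
  | cons h a ih => exact ih _

theorem Scheme.relem_congr (P : Scheme κ S) {g g' : Hop κ S} (ha : g.addr = g'.addr)
    (hs : g.slot = g'.slot) (l : List (Hop κ S)) (tag : Key κ) :
    P.relem g l tag = P.relem g' l tag := by
  cases l with
  | nil => simp only [Scheme.relem_eq, List.headD_nil, ha, hs]
  | cons h l => rfl

/-- A preceding hop stores the address and slot of its successor, never its key material. So the
material of the honest node leaves no trace in this part of the vector. -/
theorem Scheme.prefill_congr (P : Scheme κ S) (a : List (Hop κ S)) {g g' : Hop κ S}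
    (l : List (Hop κ S)) (ha : g.addr = g'.addr) (hs : g.slot = g'.slot) (R : Header κ S) :
    P.prefill a (g :: l) R = P.prefill a (g' :: l) R := by
  induction a generalizing R with
  | nil => rfl
  | cons h a ih =>
    have : P.relem h (a ++ g :: l) 0 = P.relem h (a ++ g' :: l) 0 := by
      cases a with
      | nil => simp only [List.nil_append, Scheme.relem_eq, List.headD_cons, ha, hs]
      | cons h a => rfl
    simp only [Scheme.prefill, this, ih]

/-- The routing vector at the honest node before it is masked with the stream of that node. -/
def Scheme.base (P : Scheme κ S) (nj : Addr S) (keys : List (Addr S × Key κ)) (t : ℕ)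
    (pre suf : List (Addr S)) (σ : Fin S.slots → Fin S.slots) (R : Header κ S) : Header κ S :=
  -- With the empty table the honest node is assigned the material `0`. The vector thus depends on
  -- the adversary's data and the coins of the packet, but on no table entry.
  match hopsWith (P.material nj [] keys t) ((List.ofFn σ).drop pre.length) (nj :: suf) with
  | [] => 0
  | g :: l => Function.update (P.prefill (hopsWith (P.material nj [] keys t) (List.ofFn σ) pre)
      (g :: l) R) g.slot (P.relem g l 0)

/-- The packet that arrives at the honest node, which uses the key material `m`. -/
def Scheme.incoming (P : Scheme κ S) (nj : Addr S) (keys : List (Addr S × Key κ)) (t : ℕ)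
    (pre suf : List (Addr S)) (σ : Fin S.slots → Fin S.slots) (R : Header κ S)
    (pay : Bits S.pay) (m : Stream κ S × Key κ) : Packet κ S :=
  match hopsWith (P.material nj [] keys t) ((List.ofFn σ).drop pre.length) (nj :: suf) with
  | [] => 0
  | g :: l => (g.addr, ptrOf g.slot, P.wrap (⟨g.addr, g.slot, m.1, m.2⟩ :: l)
      (P.filler l (P.base nj keys t pre suf σ R + m.1.2.1), pay))

/-- The packet with the given routing vector for the nodes after the honest one. -/
def Scheme.outgoing (P : Scheme κ S) (nj : Addr S) (keys : List (Addr S × Key κ)) (t : ℕ)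
    (suf : List (Addr S)) (slots : List (Fin S.slots)) (U : Header κ S)
    (pay : Bits S.pay) : Option (Packet κ S) :=
  (hopsWith (P.material nj [] keys t) slots suf).head?.map fun g => (g.addr, ptrOf g.slot,
    P.wrap (hopsWith (P.material nj [] keys t) slots suf)
      (P.filler (hopsWith (P.material nj [] keys t) slots suf) U, pay))

/-- The entry of a table. -/
def entry {N : ℕ} (tab : Fin N → Stream κ S × Key κ) (t : ℕ) : Stream κ S × Key κ :=
  if h : t < N then tab ⟨t, h⟩ else 0

/-- An earlier entry of the table has the same mask for the pattern. -/
def Collides {N : ℕ} (tab : Fin N → Stream κ S × Key κ) (t : ℕ) : Prop :=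
  ∃ i : Fin N, i.val < t ∧ (tab i).1.1.1 = (entry tab t).1.1.1

theorem hopsWith_cons (mat : Addr S → Stream κ S × Key κ) (slots : List (Fin S.slots))
    (s : Fin S.slots) (a : Addr S) (p : List (Addr S)) : hopsWith mat (s :: slots) (a :: p) =
      ⟨a, s, (mat a).1, (mat a).2⟩ :: hopsWith mat slots p := rfl

theorem Scheme.material_of_ne (P : Scheme κ S) {nj a : Addr S} (h : a ≠ nj)
    (L : List (Stream κ S × Key κ)) (keys : List (Addr S × Key κ)) (t : ℕ) :
    P.material nj L keys t a = P.material nj [] keys t a := by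
  simp only [Scheme.material, if_neg h]

/-- The honest node occurs only once on the path, so its table enters through the single entry for
the index; all other hops can be computed with the empty table. -/
theorem Scheme.arrive_eq_incoming (P : Scheme κ S) {nj : Addr S} (L : List (Stream κ S × Key κ))
    (keys : List (Addr S × Key κ)) (t : ℕ) {pre suf : List (Addr S)}
    (σ : Fin S.slots → Fin S.slots) (R : Header κ S) (pay : Bits S.pay)
    (hpre : nj ∉ pre) (hsuf : nj ∉ suf) (hlen : pre.length + 1 + suf.length ≤ S.slots) :
    P.arrive (hopsWith (P.material nj L keys t) (List.ofFn σ) (pre ++ nj :: suf)) pre.length R pay =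
      some (P.incoming nj keys t pre suf σ R pay ((L.drop t).headD 0)) := by
  have hsl : ((List.ofFn σ).drop pre.length).length ≠ 0 := by
    rw [List.length_drop, List.length_ofFn]; omega
  obtain ⟨s, sl, hs⟩ := List.exists_cons_of_ne_nil
    (show (List.ofFn σ).drop pre.length ≠ [] from fun h => hsl (by rw [h]; rfl))
  have e1 : hopsWith (P.material nj L keys t) (List.ofFn σ) pre =
      hopsWith (P.material nj [] keys t) (List.ofFn σ) pre :=
    hopsWith_congr fun a ha => P.material_of_ne (fun h : a = nj => hpre (h ▸ ha)) _ _ _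
  have e2 : hopsWith (P.material nj L keys t) sl suf = hopsWith (P.material nj [] keys t) sl suf :=
    hopsWith_congr fun a ha => P.material_of_ne (fun h : a = nj => hsuf (h ▸ ha)) _ _ _
  have e3 : P.material nj L keys t nj = (L.drop t).headD 0 := if_pos rfl
  have hlp : (hopsWith (P.material nj [] keys t) (List.ofFn σ) pre).length = pre.length :=
    length_hopsWith _ _ _ (by rw [List.length_ofFn]; omega)
  unfold Scheme.arrive Scheme.incoming Scheme.base
  rw [hopsWith_append, hs, hopsWith_cons, hopsWith_cons, e1, e2, e3]
  generalize hopsWith (P.material nj [] keys t) (List.ofFn σ) pre = a at hlp ⊢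
  generalize hopsWith (P.material nj [] keys t) sl suf = l
  rw [← hlp, List.drop_left, List.head?_cons, Option.bind_some, P.filler_append]
  simp only [Scheme.filler]
  generalize P.material nj [] keys t nj = m
  generalize (L.drop t).headD 0 = m'
  have h1 := P.prefill_congr a (g := ⟨nj, s, m'.1, m'.2⟩) (g' := ⟨nj, s, m.1, m.2⟩) l rfl rfl R
  have h2 := P.relem_congr (g := ⟨nj, s, m'.1, m'.2⟩) (g' := ⟨nj, s, m.1, m.2⟩) rfl rfl l 0
  rw [h1, h2]

/-- An instance of `relay_wrap`. The layer of the honest node comes off, but the header mask added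
during preparation stays in the vector on which the rest of the packet is built. This is the
one-time pad that hides the nodes before. -/
theorem Scheme.relay_incoming (P : Scheme κ S) {nj : Addr S}
    (keys : List (Addr S × Key κ)) (t : ℕ) {pre suf : List (Addr S)}
    {σ : Fin S.slots → Fin S.slots} (hσ : Function.Injective σ) (R : Header κ S)
    (pay : Bits S.pay) (m : Stream κ S × Key κ) (hne : suf ≠ [])
    (hlen : pre.length + 1 + suf.length ≤ S.slots) :
    P.relay m.1 m.2 (P.incoming nj keys t pre suf σ R pay m) =
      P.outgoing nj keys t suf ((List.ofFn σ).drop (pre.length + 1))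
        (P.base nj keys t pre suf σ R + m.1.2.1) pay := by
  have hsl : ((List.ofFn σ).drop pre.length).length ≠ 0 := by
    rw [List.length_drop, List.length_ofFn]; omega
  obtain ⟨s, sl, hs⟩ := List.exists_cons_of_ne_nil
    (show (List.ofFn σ).drop pre.length ≠ [] from fun h => hsl (by rw [h]; rfl))
  have hs' : (List.ofFn σ).drop (pre.length + 1) = sl := by
    rw [← List.drop_drop, hs]; rfl
  have hlsl : suf.length ≤ sl.length := by
    rw [← hs', List.length_drop, List.length_ofFn]; omega
  have hnd : (s :: sl).Nodup :=
    hs ▸ (List.nodup_ofFn.2 hσ).sublist (List.drop_sublist _ _)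
  have hnot : s ∉ (hopsWith (P.material nj [] keys t) sl suf).map Hop.slot := by
    rw [map_slot_hopsWith _ _ _ hlsl]
    exact fun h => (List.nodup_cons.1 hnd).1 (List.mem_of_mem_take h)
  have hne' : hopsWith (P.material nj [] keys t) sl suf ≠ [] := by
    rw [← List.length_pos_iff, length_hopsWith _ _ _ hlsl, List.length_pos_iff]; exact hne
  unfold Scheme.incoming Scheme.outgoing Scheme.base
  rw [hs', hs, hopsWith_cons]
  generalize hopsWith (P.material nj [] keys t) sl suf = l at hnot hne' ⊢
  obtain ⟨g, l, rfl⟩ := List.exists_cons_of_ne_nil hne'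
  exact P.relay_wrap ⟨nj, s, m.1, m.2⟩ (g :: l) _ pay hnot

theorem entry_of_lt {N : ℕ} (tab : Fin N → Stream κ S × Key κ) {t : ℕ} (h : t < N) :
    entry tab t = tab ⟨t, h⟩ := dif_pos h

theorem headD_drop_take_ofFn {N T t : ℕ} (tab : Fin N → Stream κ S × Key κ) (hT : T ≤ N)
    (ht : t < T) : ((((List.ofFn tab).take T).drop t).headD 0) = entry tab t := by
  rw [entry_of_lt tab (ht.trans_le hT), List.headD_eq_head?_getD, List.head?_drop,
    List.getElem?_take_of_lt ht, List.getElem?_ofFn, dif_pos (ht.trans_le hT)]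
  rfl

theorem Scheme.incoming_pattern (P : Scheme κ S) {nj : Addr S}
    (keys : List (Addr S × Key κ)) (t : ℕ) {pre suf : List (Addr S)}
    (σ : Fin S.slots → Fin S.slots) (R : Header κ S)
    (pay : Bits S.pay) (m : Stream κ S × Key κ)
    (hlen : pre.length + 1 + suf.length ≤ S.slots) :
    ∃ s, (P.incoming nj keys t pre suf σ R pay m).2.1 = ptrOf s ∧
      ((P.incoming nj keys t pre suf σ R pay m).2.2.1 s).1 = P.pattern + m.1.1.1 := by
  have hsl : ((List.ofFn σ).drop pre.length).length ≠ 0 := by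
    rw [List.length_drop, List.length_ofFn]; omega
  obtain ⟨s, sl, hs⟩ := List.exists_cons_of_ne_nil
    (show (List.ofFn σ).drop pre.length ≠ [] from fun h => hsl (by rw [h]; rfl))
  unfold Scheme.incoming
  rw [hs, hopsWith_cons]
  refine ⟨s, rfl, ?_⟩
  simp only [Scheme.wrap, Function.update_self]
  rfl

/-- If no other entry of the table fits the packet that arrives at the honest node, then the node
emits the ideal packet, or drops the packet because of a collision. -/
theorem Scheme.emit_eq_of_relay_eq_none (P : Scheme κ S) {nj : Addr S} {N : ℕ}
    (hN : S.table ≤ N) (tab : Fin N → Stream κ S × Key κ) {t : ℕ} [Decidable (Collides tab t)]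
    (keys : List (Addr S × Key κ)) (ht : t < S.table) {pre suf : List (Addr S)}
    {σ : Fin S.slots → Fin S.slots} (hσ : Function.Injective σ) (R : Header κ S)
    (pay : Bits S.pay) (hpre : nj ∉ pre) (hsuf : nj ∉ suf) (hne : suf ≠ [])
    (hlen : pre.length + 1 + suf.length ≤ S.slots)
    (h : ∀ i : Fin N, i.val ≠ t → P.relay (tab i).1 (tab i).2
      (P.incoming nj keys t pre suf σ R pay (entry tab t)) = none) :
    P.emit nj ((List.ofFn tab).take S.table) keys t pre suf σ R pay =
      if Collides tab t then none else
        P.outgoing nj keys t suf ((List.ofFn σ).drop (pre.length + 1))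
          (P.base nj keys t pre suf σ R + (entry tab t).1.2.1) pay := by
  have htN := ht.trans_le hN
  unfold Scheme.emit
  rw [P.arrive_eq_incoming _ _ _ _ _ _ hpre hsuf hlen, headD_drop_take_ofFn tab hN ht,
    Option.bind_some]
  have hr := P.relay_incoming (nj := nj) keys t hσ R pay (entry tab t) hne hlen
  obtain ⟨s, hs, hpat⟩ := P.incoming_pattern (nj := nj) keys t σ R pay (entry tab t) hlen
  generalize P.incoming nj keys t pre suf σ R pay (entry tab t) = pkt at *
  unfold Scheme.pick
  rw [hs, slotOf_ptrOf, Option.bind_some, hpat]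
  have hget : ∀ (i : ℕ) (hi : i < ((List.ofFn tab).take S.table).length),
      ((List.ofFn tab).take S.table)[i] =
        tab ⟨i, by simp at hi; omega⟩ := by intro i hi; simp
  have hlenL : ((List.ofFn tab).take S.table).length = S.table := by simp [hN]
  cases hf : ((List.ofFn tab).take S.table).find?
      (fun m => decide (P.pattern + (entry tab t).1.1.1 = P.pattern + m.1.1.1)) with
  | none =>
    rw [List.find?_eq_none] at hf
    refine absurd ?_ (hf (tab ⟨t, htN⟩) ?_)
    · rw [entry_of_lt tab htN]; simp
    · rw [← hget t (by omega)]; exact List.getElem_mem _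
  | some m =>
    rw [Option.bind_some]
    obtain ⟨h1, i, hi, h2, h3⟩ := List.find?_eq_some_iff_getElem.1 hf
    rw [hget] at h2
    subst h2
    rw [decide_eq_true_eq, add_right_inj] at h1
    -- The entry for `t` itself matches, so the first match lies at or before `t`.
    have hit : i ≤ t := by
      by_contra hlt
      have := h3 t (by omega)
      rw [hget, entry_of_lt tab htN] at this
      simp at this
    -- If the first match is `t`, there is no collision and the right material opens the packet. If
    -- it is earlier, there is a collision, and the wrong material rejects the packet by `h`.
    rcases hit.eq_or_lt with rfl | hlt
    · rw [if_neg, ← entry_of_lt tab htN]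
      · exact hr
      · rintro ⟨j, hj, hc⟩
        have := h3 j hj
        rw [hget] at this
        simp [hc] at this
    · rw [if_pos ⟨⟨i, by omega⟩, hlt, h1.symm⟩]
      exact h ⟨i, by omega⟩ (by simpa using hlt.ne)

/-! ### Tags of unmasked routing elements -/

/-- A modification of the mask of the tag. -/
def tagShift (v : Key κ) : Stream κ S × Key κ := (((0, 0, 0, v), 0), 0)

/-- With different masks for the tag, a packet is accepted at most once. -/
theorem Scheme.relay_tagShift (P : Scheme κ S) (m : Stream κ S × Key κ) (pkt : Packet κ S)
    {v v' : Key κ} (h : P.relay (m + tagShift v).1 (m + tagShift v).2 pkt ≠ none)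
    (h' : P.relay (m + tagShift v').1 (m + tagShift v').2 pkt ≠ none) : v = v' := by
  rw [Scheme.relay_eq] at h h'
  cases hs : slotOf pkt.2.1 with
  | none => rw [hs] at h; exact absurd rfl h
  | some s =>
    rw [hs, Option.bind_some] at h h'
    -- The body under the MAC has its tag field cleared, so the MAC value does not change with `v`,
    -- whereas the unmasked tag changes by `v`. Acceptance is a linear equation that determines `v`.
    have key : ∀ v : Key κ, (if P.mac (m + tagShift v).2 (Function.update pkt.2.2.1 s
        ((pkt.2.2.1 s + (m + tagShift v).1.1).1, (pkt.2.2.1 s + (m + tagShift v).1.1).2.1,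
        (pkt.2.2.1 s + (m + tagShift v).1.1).2.2.1, 0), pkt.2.2.2) =
          (pkt.2.2.1 s + (m + tagShift v).1.1).2.2.2 then
        some ((pkt.2.2.1 s + (m + tagShift v).1.1).2.1,
          (pkt.2.2.1 s + (m + tagShift v).1.1).2.2.1,
          (Function.update pkt.2.2.1 s ((pkt.2.2.1 s + (m + tagShift v).1.1).1,
            (pkt.2.2.1 s + (m + tagShift v).1.1).2.1,
            (pkt.2.2.1 s + (m + tagShift v).1.1).2.2.1, 0), pkt.2.2.2) + (m + tagShift v).1.2)
      else none) ≠ none → P.mac m.2 (Function.update pkt.2.2.1 s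
        ((pkt.2.2.1 s + m.1.1).1, (pkt.2.2.1 s + m.1.1).2.1,
        (pkt.2.2.1 s + m.1.1).2.2.1, 0), pkt.2.2.2) =
          (pkt.2.2.1 s + m.1.1).2.2.2 + v := by
      intro v hv
      have h1 := (ite_ne_right_iff.1 hv).1
      have e1 : (m + tagShift v).2 = m.2 := add_zero _
      have e2 : (m + tagShift v).1.1 = (m.1.1.1, m.1.1.2.1, m.1.1.2.2.1, m.1.1.2.2.2 + v) := by
        simp only [tagShift, Prod.fst_add]
        refine Prod.ext (add_zero _) (Prod.ext (add_zero _) (Prod.ext (add_zero _) rfl))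
      rw [e1, e2] at h1
      refine h1.trans ?_
      exact (add_assoc _ _ _).symm
    exact add_left_cancel ((key v h).symm.trans (key v' h'))

/-- A packet whose tag is modified in different ways is accepted at most once. -/
theorem Scheme.relay_incoming_tagShift (P : Scheme κ S) {nj : Addr S}
    (keys : List (Addr S × Key κ)) (t : ℕ) {pre suf : List (Addr S)}
    (σ : Fin S.slots → Fin S.slots) (R : Header κ S)
    (pay : Bits S.pay) (m m' : Stream κ S × Key κ)
    (hlen : pre.length + 1 + suf.length ≤ S.slots) {v v' : Key κ}
    (h : P.relay m'.1 m'.2 (P.incoming nj keys t pre suf σ R pay (m + tagShift v)) ≠ none)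
    (h' : P.relay m'.1 m'.2 (P.incoming nj keys t pre suf σ R pay (m + tagShift v')) ≠ none) :
    v = v' := by
  have hsl : ((List.ofFn σ).drop pre.length).length ≠ 0 := by
    rw [List.length_drop, List.length_ofFn]; omega
  obtain ⟨s, sl, hs⟩ := List.exists_cons_of_ne_nil
    (show (List.ofFn σ).drop pre.length ≠ [] from fun h => hsl (by rw [h]; rfl))
  unfold Scheme.incoming at h h'
  rw [hs, hopsWith_cons] at h h'
  simp only [Scheme.wrap, Scheme.relay_eq, slotOf_ptrOf, Option.bind_some,
    Function.update_self, Function.update_idem] at h h'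
  generalize hopsWith (P.material nj [] keys t) sl suf = l at h h'
  generalize P.base nj keys t pre suf σ R = D at h h'
  have h1 := (ite_ne_right_iff.1 h).1
  have h2 := (ite_ne_right_iff.1 h').1
  have e1 : ∀ v : Key κ, (m + tagShift v).2 = m.2 := fun v => add_zero _
  have e2 : ∀ v : Key κ, (m + tagShift v).1.2 = m.1.2 := fun v => add_zero _
  have e3 : ∀ v : Key κ, (m + tagShift v).1.1 =
      (m.1.1.1, m.1.1.2.1, m.1.1.2.2.1, m.1.1.2.2.2 + v) := fun v => by
    simp only [tagShift, Prod.fst_add]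
    refine Prod.ext (add_zero _) (Prod.ext (add_zero _) (Prod.ext (add_zero _) rfl))
  -- A routing element does not read the stream or MAC key of its own hop, so the shifted materials
  -- give one and the same function `q` of the tag. The genuine tag is also unaffected, being
  -- computed before the element is masked.
  obtain ⟨q, e4⟩ : ∃ q : Key κ → RElem κ S, ∀ x y tag, P.relem ⟨nj, s, x, y⟩ l tag = q tag :=
    ⟨P.relem ⟨nj, s, 0, 0⟩ l, fun x y tag => P.relem_congr (g := ⟨nj, s, x, y⟩)
      (g' := ⟨nj, s, 0, 0⟩) rfl rfl l tag⟩
  simp only [e4, e1, e2, e3] at h1 h2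
  have h3 := h1.symm.trans h2
  simpa using h3

end

/-! ## The ideal game -/

section

/-- Rotation by `k` places. -/
def rotate : ∀ (n _ : ℕ), Equiv.Perm (Fin n)
  | 0, _ => 1
  | n + 1, k => Equiv.addRight (Fin.ofNat (n + 1) k)

theorem val_rotate {n : ℕ} (k : ℕ) (i : Fin n) : (rotate n k i).val = (i.val + k) % n := by
  cases n with
  | zero => exact i.elim0
  | succ n => simp [rotate, Fin.val_add]

/-- A rotation by `k` moves the window of length `m` that starts at `k` to the front; by `h` it does
not wrap around. In this way the slots after the honest node no longer tell how many nodes precede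
it. -/
theorem take_ofFn_rotate {n k m : ℕ} {X : Type} (f : Fin n → X) (h : k + m ≤ n) :
    (List.ofFn fun i => f (rotate n k i)).take m = ((List.ofFn f).drop k).take m := by
  refine List.ext_getElem? fun i => ?_
  rw [List.getElem?_take, List.getElem?_take]
  split_ifs with hi
  · rw [List.getElem?_drop, List.getElem?_ofFn, List.getElem?_ofFn, dif_pos (by omega),
      dif_pos (by omega)]
    congr 2
    ext
    rw [val_rotate, Nat.mod_eq_of_lt (by simp only; omega)]
    simp only
    omega
  · rfl

variable {κ : ℕ} {S : Sizes}

theorem hopsWith_take (mat : Addr S → Stream κ S × Key κ) (slots : List (Fin S.slots))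
    (path : List (Addr S)) :
    hopsWith mat (slots.take path.length) path = hopsWith mat slots path := by
  induction path generalizing slots with
  | nil => rfl
  | cons a p ih =>
    cases slots with
    | nil => rfl
    | cons s slots => rw [List.length_cons, List.take_succ_cons, hopsWith_cons, ih, hopsWith_cons]

theorem Scheme.outgoing_take (P : Scheme κ S) (nj : Addr S) (keys : List (Addr S × Key κ)) (t : ℕ)
    (suf : List (Addr S)) (slots : List (Fin S.slots)) (U : Header κ S) (pay : Bits S.pay) :
    P.outgoing nj keys t suf (slots.take suf.length) U pay =
      P.outgoing nj keys t suf slots U pay := by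
  unfold Scheme.outgoing
  rw [hopsWith_take]

/-! ### Answers and adversaries in the ideal game -/

open Classical in
/-- The packet emitted by the honest node, in the ideal game. -/
noncomputable def Scheme.idealEmit (P : Scheme κ S) (nj : Addr S) {N : ℕ}
    (tab : Fin N → Stream κ S × Key κ) (keys : List (Addr S × Key κ)) (t : ℕ)
    (pre suf : List (Addr S)) (σ : Fin S.slots → Fin S.slots) (R : Header κ S)
    (pay : Bits S.pay) : Option (Packet κ S) :=
  if Collides tab t then none else
    P.outgoing nj keys t suf ((List.ofFn σ).drop (pre.length + 1))
      (P.base nj keys t pre suf σ R + (entry tab t).1.2.1) pay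

/-- The answer to the challenge in the ideal game. -/
noncomputable def Scheme.idealAnswer (P : Scheme κ S) (nj : Addr S) {N : ℕ}
    (tab : Fin N → Stream κ S × Key κ) (b : Bool) (w₁ w₂ : PacketCoins κ S)
    (c : Challenge κ S) : Option (Packet κ S) × Option (Packet κ S) :=
  if c.Valid nj then
    (P.idealEmit nj tab c.keys c.index c.pre₁ c.suf w₁.1 w₁.2 c.payload₁,
      P.idealEmit nj tab c.keys (c.index + 1) (if b = true then c.pre₂ else c.pre₁) c.suf w₂.1 w₂.2
        c.payload₂)
  else (none, none)

open Classical in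
/-- An answer with the same distribution as in the ideal game, that does not depend on the bit. -/
noncomputable def Scheme.blindAnswer (P : Scheme κ S) (nj : Addr S) {N : ℕ}
    (tab : Fin N → Stream κ S × Key κ) (w₁ : PacketCoins κ S) (σ : Fin S.slots → Fin S.slots)
    (c : Challenge κ S) : Option (Packet κ S) × Option (Packet κ S) :=
  if c.Valid nj then
    (P.idealEmit nj tab c.keys c.index c.pre₁ c.suf w₁.1 w₁.2 c.payload₁,
      if Collides tab (c.index + 1) then none else
        P.outgoing nj c.keys (c.index + 1) c.suf (List.ofFn σ) (entry tab (c.index + 1)).1.2.1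
          c.payload₂)
  else (none, none)

theorem collides_congr {N : ℕ} {tab tab' : Fin N → Stream κ S × Key κ}
    (h : ∀ i, (tab' i).1.1.1 = (tab i).1.1.1) (t : ℕ) : Collides tab' t ↔ Collides tab t := by
  have h' : (entry tab' t).1.1.1 = (entry tab t).1.1.1 := by
    unfold entry
    split_ifs
    · exact h _
    · rfl
  unfold Collides
  simp only [h, h']

open Classical in
theorem Scheme.idealEmit_congr (P : Scheme κ S) (nj : Addr S) {N : ℕ}
    {tab tab' : Fin N → Stream κ S × Key κ} (h : ∀ i, (tab' i).1.1.1 = (tab i).1.1.1)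
    (keys : List (Addr S × Key κ)) {t : ℕ} (h' : (entry tab' t).1.2.1 = (entry tab t).1.2.1)
    (pre suf : List (Addr S)) (σ : Fin S.slots → Fin S.slots) (R : Header κ S)
    (pay : Bits S.pay) : P.idealEmit nj tab' keys t pre suf σ R pay =
      P.idealEmit nj tab keys t pre suf σ R pay := by
  unfold Scheme.idealEmit
  rw [h', if_congr (collides_congr h t) rfl rfl]

theorem entry_congr {N : ℕ} {tab tab' : Fin N → Stream κ S × Key κ}
    (h : ∀ i, (tab' i).1.2.1 = (tab i).1.2.1) (t : ℕ) :
    (entry tab' t).1.2.1 = (entry tab t).1.2.1 := by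
  unfold entry
  split_ifs
  · exact h _
  · rfl

/-- The ideal answers show the table only through masks of patterns and of routing vectors. Masks of
tags remain invisible, and the forgery bounds rest on this. -/
theorem Scheme.idealAnswer_congr (P : Scheme κ S) (nj : Addr S) {N : ℕ}
    {tab tab' : Fin N → Stream κ S × Key κ} (h : ∀ i, (tab' i).1.1.1 = (tab i).1.1.1)
    (h' : ∀ i, (tab' i).1.2.1 = (tab i).1.2.1) (b : Bool) (w₁ w₂ : PacketCoins κ S)
    (c : Challenge κ S) :
    P.idealAnswer nj tab' b w₁ w₂ c = P.idealAnswer nj tab b w₁ w₂ c := by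
  unfold Scheme.idealAnswer
  rw [P.idealEmit_congr nj h _ (entry_congr h' _), P.idealEmit_congr nj h _ (entry_congr h' _)]

/-- The answers in the first phase if all packets are dropped. -/
def Adversary.before (A : Adversary) (nj : Addr S) (r : Bits (A.coins.eval κ)) (i : ℕ) :
    List Data :=
  (A.query nj r fun _ => none)^[i] []

/-- The challenge if all packets are dropped. -/
def Adversary.challenge (A : Adversary) (nj : Addr S) (r : Bits (A.coins.eval κ)) :
    Challenge κ S :=
  Challenge.ofData (A.move nj r (A.before nj r (A.queries₁.eval κ)))

/-- The answers after the challenge phase if all packets are dropped. -/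
def Adversary.after (A : Adversary) (nj : Addr S) (r : Bits (A.coins.eval κ))
    (a : Option (Packet κ S) × Option (Packet κ S)) (i : ℕ) : List Data :=
  (A.query nj r fun _ => none)^[i] (Code.enc a :: A.before nj r (A.queries₁.eval κ))

/-- The packets submitted to the honest node if all of them are dropped. -/
def Adversary.asked (A : Adversary) (nj : Addr S) (r : Bits (A.coins.eval κ))
    (a : Option (Packet κ S) × Option (Packet κ S)) (i : ℕ) : Packet κ S :=
  Code.dec (A.move nj r (if i < A.queries₁.eval κ then A.before nj r i else
    A.after nj r a (i - A.queries₁.eval κ)))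

/-- The guess if all packets are dropped. -/
def Adversary.guess (A : Adversary) (nj : Addr S) (r : Bits (A.coins.eval κ))
    (a : Option (Packet κ S) × Option (Packet κ S)) : Data :=
  A.move nj r (A.after nj r a (A.queries₂.eval κ))

/-- Agreement of the oracles is required only along the run with `step'`: up to the first
disagreement both runs ask the same packets. -/
theorem Adversary.iterate_query_congr (A : Adversary) (nj : Addr S) (r : Bits (A.coins.eval κ))
    {step step' : Packet κ S → Option (Packet κ S)} (n : ℕ) (l : List Data)
    (h : ∀ i < n, step (Code.dec (A.move nj r ((A.query nj r step')^[i] l))) =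
      step' (Code.dec (A.move nj r ((A.query nj r step')^[i] l)))) :
    (A.query nj r step)^[n] l = (A.query nj r step')^[n] l := by
  induction n with
  | zero => rfl
  | succ n ih =>
    rw [Function.iterate_succ_apply', Function.iterate_succ_apply',
      ih fun i hi => h i (hi.trans (Nat.lt_succ_self n))]
    unfold Adversary.query
    exact congrArg (fun x => Code.enc x :: _) (h n (Nat.lt_succ_self n))

/-- The comparison is with the run in which every packet is dropped. The packets in that run depend
on the adversary's coins and on `a` only, so the hypothesis concerns packets fixed independently of
the oracle; an adaptive adversary gains nothing before its first accepted packet. -/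
theorem Adversary.output_eq_guess (A : Adversary) (nj : Addr S) (r : Bits (A.coins.eval κ))
    {step : Packet κ S → Option (Packet κ S)}
    {ans : Challenge κ S → Option (Packet κ S) × Option (Packet κ S)}
    {a : Option (Packet κ S) × Option (Packet κ S)} (ha : ans (A.challenge nj r) = a)
    (h : ∀ i < A.queries₁.eval κ + A.queries₂.eval κ, step (A.asked nj r a i) = none) :
    A.output nj r step ans = A.guess nj r a := by
  have h1 : (A.query nj r step)^[A.queries₁.eval κ] [] = A.before nj r (A.queries₁.eval κ) := by
    refine A.iterate_query_congr nj r _ _ fun i hi => ?_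
    have := h i (by omega)
    rwa [Adversary.asked, if_pos hi] at this
  have h2 : (A.query nj r step)^[A.queries₂.eval κ]
      (Code.enc a :: A.before nj r (A.queries₁.eval κ)) = A.after nj r a (A.queries₂.eval κ) := by
    refine A.iterate_query_congr nj r _ _ fun i hi => ?_
    have := h (A.queries₁.eval κ + i) (by omega)
    rwa [Adversary.asked, if_neg (by omega), Nat.add_sub_cancel_left] at this
  subst ha
  unfold Adversary.output Adversary.guess
  simp only [h1]
  exact congrArg _ h2

theorem Scheme.pick_eq_none (P : Scheme κ S) {N : ℕ} (tab : Fin N → Stream κ S × Key κ) (n : ℕ)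
    {pkt : Packet κ S} (h : ∀ i, P.relay (tab i).1 (tab i).2 pkt = none) :
    P.pick ((List.ofFn tab).take n) pkt = none := by
  unfold Scheme.pick
  refine Option.bind_eq_none_iff.2 fun s _ => Option.bind_eq_none_iff.2 fun m hm => ?_
  obtain ⟨i, rfl⟩ := (List.mem_ofFn' _ _).1 (List.mem_of_mem_take (List.mem_of_find?_eq_some hm))
  exact h i

/-! ### Accepted packets are rare -/

set_option synthInstance.maxSize 1000
set_option synthInstance.maxHeartbeats 200000

theorem add_tagShift_pattern (m : Stream κ S × Key κ) (v : Key κ) :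
    (m + tagShift v).1.1.1 = m.1.1.1 := add_zero _

theorem add_tagShift_header (m : Stream κ S × Key κ) (v : Key κ) :
    (m + tagShift v).1.2.1 = m.1.2.1 := add_zero _

theorem card_key : (Fintype.card (Key κ) : ℝ) = 2 ^ κ := by
  simp [Key, Bits, ZMod.card]

/-- A packet is rarely accepted with the `t`-th key material, if it does not depend on the mask of
the tag in this material. -/
theorem Scheme.prob_relay_le (P : Scheme κ S) {N : ℕ} {X : Type} [Fintype X] (t : Fin N)
    (pkt : (Fin N → Stream κ S × Key κ) × X → Packet κ S)
    (h : ∀ w v, pkt (w.1 + Pi.single t (tagShift v), w.2) = pkt w) :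
    prob (fun w : (Fin N → Stream κ S × Key κ) × X =>
      P.relay (w.1 t).1 (w.1 t).2 (pkt w) ≠ none) ≤ 1 / 2 ^ κ := by
  rw [← card_key]
  refine prob_le_of_family (fun v w => (w.1 + Pi.single t (tagShift v), w.2))
    (fun v w w' h => ?_) _ fun w v v' hv hv' => ?_
  · rw [Prod.mk.injEq, add_left_inj] at h
    exact Prod.ext h.1 h.2
  · rw [h] at hv hv'
    simp only [Pi.add_apply, Pi.single_eq_same] at hv hv'
    exact P.relay_tagShift _ _ hv hv'

/-- A packet for the honest node is rarely accepted with the key material for another index. -/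
theorem Scheme.prob_relay_incoming_le (P : Scheme κ S) {nj : Addr S} {N : ℕ} {X : Type}
    [Fintype X] (i : Fin N) (keys : X → List (Addr S × Key κ)) (t : X → ℕ)
    (pre suf : X → List (Addr S)) (σ : X → Fin S.slots → Fin S.slots) (R : X → Header κ S)
    (pay : X → Bits S.pay) :
    prob (fun w : (Fin N → Stream κ S × Key κ) × X => (t w.2 < N ∧ i.val ≠ t w.2 ∧
      (pre w.2).length + 1 + (suf w.2).length ≤ S.slots) ∧ P.relay (w.1 i).1 (w.1 i).2
        (P.incoming nj (keys w.2) (t w.2) (pre w.2) (suf w.2) (σ w.2) (R w.2) (pay w.2)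
          (entry w.1 (t w.2))) ≠ none) ≤ 1 / 2 ^ κ := by
  rw [← card_key]
  -- The tag mask is shifted in the entry used by the source. The checking entry `i` is a different
  -- one and stays fixed.
  refine prob_le_of_family (fun v w => (w.1 + (fun j => if j.val = t w.2 then tagShift v else 0),
    w.2)) (fun v w w' h => ?_) _ fun w v v' hv hv' => ?_
  · rw [Prod.mk.injEq] at h
    obtain ⟨h1, h2⟩ := h
    rw [h2, add_left_inj] at h1
    exact Prod.ext h1 h2
  · obtain ⟨⟨ht, hi, hlen⟩, hv⟩ := hv
    replace hv' := hv'.2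
    simp only [Pi.add_apply, if_neg hi, add_zero, entry_of_lt _ ht, if_true] at hv hv'
    exact P.relay_incoming_tagShift _ _ _ _ _ _ _ hlen hv hv'

end

/-! ### Blinding of the bit and the statistical bound -/

section

set_option synthInstance.maxSize 1000
set_option synthInstance.maxHeartbeats 200000

variable {κ : ℕ} {S : Sizes}

/-- The random choices besides the key material of the honest node in the game with uniformly
random slots for the second packet: the bit, the coins of the two packets, and those of the
adversary. -/
abbrev Choices (κ : ℕ) (S : Sizes) (c : ℕ) : Type :=
  Bool × (Bits S.seed × Header κ S) × (Equiv.Perm (Fin S.slots) × Header κ S) × Bits c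

/-- The adversary guesses the bit in the game with a table of key material. -/
def Adversary.WinsWith (A : Adversary) (P : Scheme κ S) (nj : Addr S)
    (L : List (Stream κ S × Key κ)) (b : Bool) (w₁ w₂ : PacketCoins κ S)
    (r : Bits (A.coins.eval κ)) : Prop :=
  A.output nj r (P.pick L) (P.respond nj L b w₁ w₂) ≠ .nil ↔ b = true

theorem prob_eq_half {Ω : Type} [Fintype Ω] [Nonempty Ω] {f : Ω → Ω} (hf : Function.Injective f)
    (E : Ω → Prop) (h : ∀ w, E (f w) ↔ ¬ E w) : prob E = 1 / 2 := by
  classical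
  have h1 := prob_injective hf E
  have h2 : prob (fun w => E (f w)) + prob E = 1 := by
    simp only [prob_eq, h]
    rw [← add_div, ← Finset.sum_add_distrib, div_eq_one_iff_eq (by simp)]
    rw [Finset.sum_congr rfl (g := fun _ => (1 : ℝ)) fun w _ => by by_cases E w <;> simp [*]]
    simp
  linarith

/-- The slots of the path with the honest node, in the coins of the first packet. -/
def Scheme.firstCoins {c : ℕ} (P : Scheme κ S) (w : Choices κ S c) : PacketCoins κ S :=
  (P.perm w.2.1.1, w.2.1.2)

/-- Slots and routing vector of the second packet. -/
def Choices.secondCoins {c : ℕ} (w : Choices κ S c) : PacketCoins κ S :=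
  (w.2.2.1.1, w.2.2.1.2)

/-- The nodes before the honest node on the path of the second packet. -/
def Challenge.preOf (c : Challenge κ S) (b : Bool) : List (Addr S) :=
  if b = true then c.pre₂ else c.pre₁

variable (A : Adversary) (P : Scheme κ S) (nj : Addr S) {N : ℕ}

/-- A modification of the mask of the routing vector for the index `t`. -/
def headerShift (N t : ℕ) (D : Header κ S) : Fin N → Stream κ S × Key κ :=
  fun j => if j.val = t then ((0, D, 0), 0) else 0

/-- The change of the random choices that makes the ideal answer independent of the bit. -/
def Adversary.blind (w : (Fin N → Stream κ S × Key κ) × Choices κ S (A.coins.eval κ)) :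
    (Fin N → Stream κ S × Key κ) × Choices κ S (A.coins.eval κ) :=
  let c := A.challenge nj w.2.2.2.2
  (w.1 + headerShift N (c.index + 1) (P.base nj c.keys (c.index + 1) (c.preOf w.2.1) c.suf
      w.2.secondCoins.1 w.2.secondCoins.2),
    w.2.1, w.2.2.1, ((rotate S.slots ((c.preOf w.2.1).length + 1)).trans w.2.2.2.1.1,
      w.2.2.2.1.2), w.2.2.2.2)

/-- The bit, `R` and the adversary's coins are left unchanged, and they determine the rotation.
Undoing it recovers `σ`; only then is the header shift, which depends on `σ` and `R`, known and can
be cancelled. -/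
theorem Adversary.blind_injective : Function.Injective (A.blind P nj (N := N)) := by
  rintro ⟨tab, b, w₁, ⟨σ, R⟩, r⟩ ⟨tab', b', w₁', ⟨σ', R'⟩, r'⟩ h
  simp only [Adversary.blind, Prod.mk.injEq] at h
  obtain ⟨h1, rfl, rfl, ⟨h2, rfl⟩, rfl⟩ := h
  have h3 : σ = σ' := by
    ext i
    have := Equiv.congr_fun h2 ((rotate S.slots (((A.challenge nj r).preOf b).length + 1)).symm i)
    simpa using congrArg Fin.val this
  subst h3
  rw [add_left_inj] at h1
  rw [h1]

open Classical in
-- Renaming `base` plus mask as the new mask, and the rotated slots as the new slots, removes both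
-- places where the nodes before the honest one enter the second packet.
theorem Scheme.idealAnswer_eq_blindAnswer (hN : S.table ≤ N) (tab : Fin N → Stream κ S × Key κ)
    (b : Bool) (w₁ : PacketCoins κ S) (σ : Fin S.slots → Fin S.slots) (R : Header κ S)
    (c : Challenge κ S) : P.idealAnswer nj tab b w₁ (σ, R) c =
      P.blindAnswer nj (tab + headerShift N (c.index + 1)
        (P.base nj c.keys (c.index + 1) (c.preOf b) c.suf σ R)) w₁
        (fun i => σ (rotate S.slots ((c.preOf b).length + 1) i)) c := by
  unfold Scheme.idealAnswer Scheme.blindAnswer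
  by_cases hc : c.Valid nj
  swap
  · rw [if_neg hc, if_neg hc]
  rw [if_pos hc, if_pos hc]
  obtain ⟨ht, -, -, -, -, hl1, hl2⟩ := hc
  have hl : (c.preOf b).length + 1 + c.suf.length ≤ S.slots := by
    unfold Challenge.preOf
    split_ifs <;> assumption
  have htN : c.index + 1 < N := ht.trans_le hN
  change (_, P.idealEmit nj tab c.keys (c.index + 1) (c.preOf b) _ σ R _) = _
  generalize hD : P.base nj c.keys (c.index + 1) (c.preOf b) c.suf σ R = D
  have hpat : ∀ i, ((tab + headerShift N (c.index + 1) D) i).1.1.1 = (tab i).1.1.1 := fun i => by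
    rw [Pi.add_apply]
    unfold headerShift
    split_ifs <;> exact add_zero _
  refine Prod.ext ?_ ?_
  -- The shift sits at `c.index + 1`, so the first packet, which uses the mask for `c.index`, is not
  -- affected.
  · refine (P.idealEmit_congr nj hpat _ ?_ _ _ _ _ _).symm
    rw [entry_of_lt _ (by omega), entry_of_lt _ (by omega), Pi.add_apply, headerShift,
      if_neg (by simp)]
    exact add_zero _
  · unfold Scheme.idealEmit
    simp only
    rw [if_congr (collides_congr hpat _) rfl rfl]
    congr 1
    rw [← P.outgoing_take, ← P.outgoing_take (slots := List.ofFn _), take_ofFn_rotate _ hl,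
      hD, entry_of_lt _ htN, entry_of_lt _ htN, Pi.add_apply, headerShift, if_pos rfl, add_comm D]
    rfl

/-- In the ideal game, the adversary has no advantage. -/
theorem Adversary.prob_ideal (hN : S.table ≤ N) :
    prob (fun w : (Fin N → Stream κ S × Key κ) × Choices κ S (A.coins.eval κ) =>
      (A.guess nj w.2.2.2.2 (P.idealAnswer nj w.1 w.2.1 (P.firstCoins w.2) w.2.secondCoins
        (A.challenge nj w.2.2.2.2)) ≠ .nil ↔ w.2.1 = true)) = 1 / 2 := by
  have h1 := prob_injective (A.blind_injective P nj (N := N))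
    fun w : (Fin N → Stream κ S × Key κ) × Choices κ S (A.coins.eval κ) =>
    (A.guess nj w.2.2.2.2 (P.blindAnswer nj w.1 (P.firstCoins w.2) w.2.secondCoins.1
        (A.challenge nj w.2.2.2.2)) ≠ .nil ↔ w.2.1 = true)
  -- The blind answer does not read the bit. Flipping it leaves the guess alone and exchanges
  -- success and failure.
  refine Eq.trans ?_ (h1.trans (prob_eq_half
    (f := fun w => (w.1, !w.2.1, w.2.2)) (fun w w' h => ?_) _ fun w => ?_))
  · congr 1
    funext w
    exact congrArg (fun a => (A.guess nj w.2.2.2.2 a ≠ .nil ↔ w.2.1 = true))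
      (P.idealAnswer_eq_blindAnswer nj hN w.1 w.2.1 (P.firstCoins w.2) w.2.secondCoins.1
        w.2.secondCoins.2 (A.challenge nj w.2.2.2.2))
  · simp only [Prod.mk.injEq, Bool.not_inj_iff] at h
    exact Prod.ext h.1 (Prod.ext h.2.1 h.2.2)
  · change (A.guess nj w.2.2.2.2 (P.blindAnswer nj w.1 (P.firstCoins w.2) (Choices.secondCoins w.2).1
        (A.challenge nj w.2.2.2.2)) ≠ .nil ↔ (!w.2.1) = true) ↔ _
    rw [Bool.not_eq_true']
    cases w.2.1 <;> simp

open Classical in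
/-- Outside of the improbable events, the game coincides with the ideal game. -/
theorem Adversary.winsWith_iff (hN : S.table ≤ N)
    (w : (Fin N → Stream κ S × Key κ) × Choices κ S (A.coins.eval κ))
    (hq : ∀ i < A.queries₁.eval κ + A.queries₂.eval κ, ∀ t : Fin N, P.relay (w.1 t).1 (w.1 t).2
      (A.asked nj w.2.2.2.2 (P.idealAnswer nj w.1 w.2.1 (P.firstCoins w.2) w.2.secondCoins
        (A.challenge nj w.2.2.2.2)) i) = none)
    (h₁ : (A.challenge nj w.2.2.2.2).Valid nj → ∀ i : Fin N,
      i.val ≠ (A.challenge nj w.2.2.2.2).index → P.relay (w.1 i).1 (w.1 i).2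
        (P.incoming nj (A.challenge nj w.2.2.2.2).keys (A.challenge nj w.2.2.2.2).index
          (A.challenge nj w.2.2.2.2).pre₁ (A.challenge nj w.2.2.2.2).suf (P.firstCoins w.2).1
          (P.firstCoins w.2).2 (A.challenge nj w.2.2.2.2).payload₁
          (entry w.1 (A.challenge nj w.2.2.2.2).index)) = none)
    (h₂ : (A.challenge nj w.2.2.2.2).Valid nj → ∀ i : Fin N,
      i.val ≠ (A.challenge nj w.2.2.2.2).index + 1 → P.relay (w.1 i).1 (w.1 i).2
        (P.incoming nj (A.challenge nj w.2.2.2.2).keys ((A.challenge nj w.2.2.2.2).index + 1)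
          ((A.challenge nj w.2.2.2.2).preOf w.2.1) (A.challenge nj w.2.2.2.2).suf
          w.2.secondCoins.1 w.2.secondCoins.2 (A.challenge nj w.2.2.2.2).payload₂
          (entry w.1 ((A.challenge nj w.2.2.2.2).index + 1))) = none) :
    A.WinsWith P nj ((List.ofFn w.1).take S.table) w.2.1 (P.firstCoins w.2) w.2.secondCoins
      w.2.2.2.2 ↔ (A.guess nj w.2.2.2.2 (P.idealAnswer nj w.1 w.2.1 (P.firstCoins w.2)
        w.2.secondCoins (A.challenge nj w.2.2.2.2)) ≠ .nil ↔ w.2.1 = true) := by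
  unfold Adversary.WinsWith
  rw [A.output_eq_guess nj w.2.2.2.2 ?_ fun i hi => P.pick_eq_none w.1 _ (hq i hi)]
  obtain ⟨tab, b, w₁, w₂, r⟩ := w
  simp only at h₁ h₂ ⊢
  unfold Scheme.respond Scheme.idealAnswer
  by_cases hc : (A.challenge nj r).Valid nj
  swap
  · rw [if_neg hc, if_neg hc]
  rw [if_pos hc, if_pos hc]
  specialize h₁ hc
  specialize h₂ hc
  obtain ⟨ht, hne, hp1, hp2, hs, hl1, hl2⟩ := hc
  refine Prod.ext ?_ ?_
  · exact P.emit_eq_of_relay_eq_none hN tab _ (by omega) (P.perm w₁.1).injective _ _ hp1 hs hne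
      hl1 h₁
  · refine P.emit_eq_of_relay_eq_none hN tab _ ht w₂.1.injective _ _ ?_ hs hne ?_ h₂
    · split_ifs <;> assumption
    · split_ifs <;> assumption

/-- The packet is computed from the ideal answer, which does not change with the tag mask of the
entry that checks it. -/
theorem Adversary.prob_relay_asked_le (i : ℕ) (t : Fin N) :
    prob (fun w : (Fin N → Stream κ S × Key κ) × Choices κ S (A.coins.eval κ) =>
      P.relay (w.1 t).1 (w.1 t).2 (A.asked nj w.2.2.2.2 (P.idealAnswer nj w.1 w.2.1
      (P.firstCoins w.2) w.2.secondCoins (A.challenge nj w.2.2.2.2)) i) ≠ none) ≤ 1 / 2 ^ κ := by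
  refine P.prob_relay_le t _ fun w v => ?_
  have h : P.idealAnswer nj (w.1 + Pi.single t (tagShift v)) w.2.1 (P.firstCoins w.2)
      w.2.secondCoins (A.challenge nj w.2.2.2.2) = P.idealAnswer nj w.1 w.2.1 (P.firstCoins w.2)
      w.2.secondCoins (A.challenge nj w.2.2.2.2) := by
    refine P.idealAnswer_congr nj (fun i => ?_) (fun i => ?_) _ _ _ _
    · rw [Pi.add_apply]
      by_cases h : i = t
      · rw [h, Pi.single_eq_same]; exact add_tagShift_pattern _ _
      · rw [Pi.single_eq_of_ne h, add_zero]
    · rw [Pi.add_apply]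
      by_cases h : i = t
      · rw [h, Pi.single_eq_same]; exact add_tagShift_header _ _
      · rw [Pi.single_eq_of_ne h, add_zero]
  exact congrArg (fun a => A.asked nj w.2.2.2.2 a i) h

/-- With a uniformly random table of key material and uniformly random slots for the second
packet, the advantage of the adversary is small. -/
theorem Adversary.abs_prob_winsWith_sub_half_le (hN : S.table ≤ N) :
    |prob (fun w : (Fin N → Stream κ S × Key κ) × Choices κ S (A.coins.eval κ) =>
      A.WinsWith P nj ((List.ofFn w.1).take S.table) w.2.1 (P.firstCoins w.2) w.2.secondCoins
        w.2.2.2.2) - 1 / 2| ≤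
      ((A.queries₁.eval κ + A.queries₂.eval κ + 2) * N : ℕ) * (1 / 2 ^ κ) := by
  -- The bad events: `B₀`, a query is accepted by some entry; `B₁` and `B₂`, the first or second
  -- challenge packet is accepted by an entry for another index. With `N` entries this makes
  -- `(queries₁ + queries₂) * N + N + N` events of probability at most `1 / 2 ^ κ` each.
  let B₀ : (ℕ × Fin N) → (Fin N → Stream κ S × Key κ) × Choices κ S (A.coins.eval κ) → Prop :=
    fun p w => P.relay (w.1 p.2).1 (w.1 p.2).2
      (A.asked nj w.2.2.2.2 (P.idealAnswer nj w.1 w.2.1 (P.firstCoins w.2) w.2.secondCoins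
        (A.challenge nj w.2.2.2.2)) p.1) ≠ none
  let B₁ : Fin N → (Fin N → Stream κ S × Key κ) × Choices κ S (A.coins.eval κ) → Prop :=
    fun i w => ((A.challenge nj w.2.2.2.2).index < N ∧
      i.val ≠ (A.challenge nj w.2.2.2.2).index ∧ (A.challenge nj w.2.2.2.2).pre₁.length + 1 +
        (A.challenge nj w.2.2.2.2).suf.length ≤ S.slots) ∧ P.relay (w.1 i).1 (w.1 i).2
        (P.incoming nj (A.challenge nj w.2.2.2.2).keys (A.challenge nj w.2.2.2.2).index
          (A.challenge nj w.2.2.2.2).pre₁ (A.challenge nj w.2.2.2.2).suf (P.firstCoins w.2).1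
          (P.firstCoins w.2).2 (A.challenge nj w.2.2.2.2).payload₁
          (entry w.1 (A.challenge nj w.2.2.2.2).index)) ≠ none
  let B₂ : Fin N → (Fin N → Stream κ S × Key κ) × Choices κ S (A.coins.eval κ) → Prop :=
    fun i w => ((A.challenge nj w.2.2.2.2).index + 1 < N ∧
      i.val ≠ (A.challenge nj w.2.2.2.2).index + 1 ∧
      ((A.challenge nj w.2.2.2.2).preOf w.2.1).length + 1 +
        (A.challenge nj w.2.2.2.2).suf.length ≤ S.slots) ∧ P.relay (w.1 i).1 (w.1 i).2
        (P.incoming nj (A.challenge nj w.2.2.2.2).keys ((A.challenge nj w.2.2.2.2).index + 1)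
          ((A.challenge nj w.2.2.2.2).preOf w.2.1) (A.challenge nj w.2.2.2.2).suf
          w.2.secondCoins.1 w.2.secondCoins.2 (A.challenge nj w.2.2.2.2).payload₂
          (entry w.1 ((A.challenge nj w.2.2.2.2).index + 1))) ≠ none
  have b₀ : ∀ p, prob (B₀ p) ≤ 1 / 2 ^ κ := fun p => A.prob_relay_asked_le P nj p.1 p.2
  have b₁ : ∀ i, prob (B₁ i) ≤ 1 / 2 ^ κ := fun i =>
    P.prob_relay_incoming_le (nj := nj) i (fun x : Choices κ S (A.coins.eval κ) =>
      (A.challenge nj x.2.2.2).keys) (fun x => (A.challenge nj x.2.2.2).index)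
      (fun x => (A.challenge nj x.2.2.2).pre₁) (fun x => (A.challenge nj x.2.2.2).suf)
      (fun x => (P.firstCoins x).1) (fun x => (P.firstCoins x).2)
      fun x => (A.challenge nj x.2.2.2).payload₁
  have b₂ : ∀ i, prob (B₂ i) ≤ 1 / 2 ^ κ := fun i =>
    P.prob_relay_incoming_le (nj := nj) i (fun x : Choices κ S (A.coins.eval κ) =>
      (A.challenge nj x.2.2.2).keys) (fun x => (A.challenge nj x.2.2.2).index + 1)
      (fun x => (A.challenge nj x.2.2.2).preOf x.1) (fun x => (A.challenge nj x.2.2.2).suf)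
      (fun x => x.secondCoins.1) (fun x => x.secondCoins.2)
      fun x => (A.challenge nj x.2.2.2).payload₂
  rw [← A.prob_ideal P nj hN]
  refine (abs_prob_sub_le (B := fun w => (∃ p ∈ Finset.range (A.queries₁.eval κ +
    A.queries₂.eval κ) ×ˢ (Finset.univ : Finset (Fin N)), B₀ p w) ∨
    (∃ i ∈ (Finset.univ : Finset (Fin N)), B₁ i w) ∨
    ∃ i ∈ (Finset.univ : Finset (Fin N)), B₂ i w) fun w hw => ?_).trans ?_
  · simp only [not_or, not_exists, not_and] at hw
    obtain ⟨hw0, hw1, hw2⟩ := hw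
    refine A.winsWith_iff P nj hN w (fun i hi t => ?_) (fun hc i hi => ?_) fun hc i hi => ?_
    · exact not_not.1 (hw0 (i, t) (by simpa using hi))
    · obtain ⟨ht, -, -, -, -, hl1, hl2⟩ := hc
      by_contra h
      exact hw1 i (Finset.mem_univ _) ⟨⟨by omega, hi, hl1⟩, h⟩
    · obtain ⟨ht, -, -, -, -, hl1, hl2⟩ := hc
      by_contra h
      refine hw2 i (Finset.mem_univ _) ⟨⟨by omega, hi, ?_⟩, h⟩
      unfold Challenge.preOf
      split_ifs <;> assumption
  · refine (prob_or_le _ _).trans ((add_le_add (prob_exists_le _ _) ((prob_or_le _ _).trans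
      (add_le_add (prob_exists_le _ _) (prob_exists_le _ _)))).trans
      ((add_le_add (Finset.sum_le_card_nsmul _ _ _ fun p _ => b₀ p)
        (add_le_add (Finset.sum_le_card_nsmul _ _ _ fun p _ => b₁ p)
          (Finset.sum_le_card_nsmul _ _ _ fun p _ => b₂ p))).trans (le_of_eq ?_)))
    simp only [Finset.card_product, Finset.card_range, Finset.card_univ, Fintype.card_fin,
      nsmul_eq_mul]
    push_cast
    ring

end

/-! ## Negligible functions -/

theorem Negligible.of_abs_le_mul {f g : ℕ → ℝ} (hf : Negligible f) (p : Polynomial ℕ)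
    (h : ∀ κ, |g κ| ≤ (p.eval κ : ℕ) * |f κ|) : Negligible g := by
  have h1 := SuperpolynomialDecay.polynomial_mul hf (p.map (Nat.castRingHom ℝ))
  refine h1.trans_abs_le fun κ => (h κ).trans (le_of_eq ?_)
  rw [abs_mul, Polynomial.eval_natCast_map, eq_natCast, Nat.abs_cast]
  simp

theorem Negligible.of_abs_le {f g : ℕ → ℝ} (hf : Negligible f) (h : ∀ κ, |g κ| ≤ |f κ|) :
    Negligible g :=
  hf.trans_abs_le h

theorem negligible_two_pow : Negligible fun κ => 1 / (2 : ℝ) ^ κ := by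
  intro n
  have h := tendsto_pow_const_div_const_pow_of_one_lt n (one_lt_two (α := ℝ))
  refine h.congr fun κ => ?_
  rw [mul_one_div]

/-! ## The hybrid argument -/

section

/-- Resampling one coordinate does not change the uniform distribution. -/
theorem prob_update {Ω Z : Type} [Fintype Ω] [Nonempty Ω] [Fintype Z] (get : Z → Ω)
    (upd : Ω → Z → Z) (h₁ : ∀ y z, get (upd y z) = y) (h₂ : ∀ y z, upd (get z) (upd y z) = z)
    (E : Z → Prop) : prob (fun w : Ω × Z => E (upd w.1 w.2)) = prob E := by
  rw [← prob_snd (Ω' := Ω) E]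
  -- The fresh value and the old coordinate change places. This loses nothing, by `h₁` and `h₂`.
  refine prob_injective (f := fun w : Ω × Z => (get w.2, upd w.1 w.2)) ?_ fun w => E w.2
  rintro ⟨y, z⟩ ⟨y', z'⟩ h
  simp only [Prod.mk.injEq] at h
  have h3 : y = y' := by rw [← h₁ y z, h.2, h₁]
  have h4 : z = z' := by rw [← h₂ y z, h.1, h.2, h₂]
  rw [h3, h4]

/-- The binary digits of a number. -/
def digits (m j : ℕ) : Bits m := fun i => if j.testBit i then 1 else 0

theorem digits_injOn {m j j' : ℕ} (hj : j < 2 ^ m) (hj' : j' < 2 ^ m)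
    (h : digits m j = digits m j') : j = j' := by
  refine Nat.eq_of_testBit_eq fun i => ?_
  by_cases hi : i < m
  · have := congrFun h ⟨i, hi⟩
    simp only [digits] at this
    cases h1 : j.testBit i <;> cases h2 : j'.testBit i <;> simp [h1, h2] at this ⊢
  · have h1 := Nat.testBit_lt_two_pow (hj.trans_le (Nat.pow_le_pow_right two_pos (not_lt.1 hi)))
    have h2 := Nat.testBit_lt_two_pow (hj'.trans_le (Nat.pow_le_pow_right two_pos (not_lt.1 hi)))
    rw [h1, h2]

/-- The number below `N` with the given binary digits. -/
def ofDigits (N : ℕ) {m : ℕ} (x : Bits m) : Option ℕ :=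
  (List.range N).find? fun j => decide (digits m j = x)

theorem ofDigits_digits {N m j : ℕ} (hN : N ≤ 2 ^ m) (hj : j < N) :
    ofDigits N (digits m j) = some j := by
  refine List.find?_range_eq_some.2 ⟨by simp, List.mem_range.2 hj, fun i hi => ?_⟩
  have : digits m i ≠ digits m j := fun h =>
    hi.ne (digits_injOn (by omega) (by omega) h)
  simp [this]

theorem exists_of_ofDigits {N m j : ℕ} {x : Bits m} (h : ofDigits N x = some j) :
    j < N ∧ digits m j = x := by
  obtain ⟨h1, h2, -⟩ := List.find?_range_eq_some.1 h
  exact ⟨List.mem_range.1 h2, by simpa using h1⟩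

/-- Probability of an event that depends on a number given by random binary digits. -/
theorem prob_ofDigits {A Z : Type} [Fintype A] [Fintype Z] {N m : ℕ} (hN : N ≤ 2 ^ m)
    (E : A → Z → ℕ → Prop) :
    2 ^ m * prob (fun w : A × (Z × Bits m) =>
        ∃ j, ofDigits N w.2.2 = some j ∧ E w.1 w.2.1 j) =
      ∑ j ∈ Finset.range N, prob fun w : A × Z => E w.1 w.2 j := by
  have h1 := prob_equiv ((Equiv.prodAssoc A Z (Bits m)).symm.trans (Equiv.prodComm _ _))
    fun w : Bits m × (A × Z) => ∃ j, ofDigits N w.1 = some j ∧ E w.2.1 w.2.2 j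
  have h2 : (Fintype.card (Bits m) : ℝ) = 2 ^ m := by simp [Bits, ZMod.card]
  refine (congrArg (2 ^ m * ·) (h1.trans (prob_prod _))).trans ?_
  simp only
  rw [h2, mul_div_cancel₀ _ (by positivity), Finset.sum_range]
  -- Among the `2 ^ m` digit strings exactly `N` name an index below `N`; the others contribute
  -- zero.
  refine (Fintype.sum_of_injective (fun j : Fin N => digits m j) (fun i j h => ?_) _ _
    (fun x hx => ?_) fun j => ?_).symm
  · exact Fin.ext (digits_injOn (i.isLt.trans_le hN) (j.isLt.trans_le hN) h)
  · have : ofDigits N x = none := by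
      rw [Option.eq_none_iff_forall_ne_some]
      intro j hj
      obtain ⟨h1, h2⟩ := exists_of_ofDigits hj
      exact hx ⟨⟨j, h1⟩, h2⟩
    simp [this, prob]
  · rw [ofDigits_digits hN j.isLt]
    simp

/-- The hybrid with `j` samples of the second kind, and the samples of the first kind after it. -/
def mixed {N : ℕ} {Ω Ω' β : Type} (X : Ω → β) (Y : Ω' → β) (j : ℕ) (u : Fin N → Ω')
    (a : Fin N → Ω) (t : Fin N) : β :=
  if t.val < j then Y (u t) else X (a t)

/-- The hybrid with the sample `y` at the place `j`. -/
def mixedWith {N : ℕ} {Ω Ω' β : Type} (X : Ω → β) (Y : Ω' → β) (j : ℕ) (y : β) (u : Fin N → Ω')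
    (a : Fin N → Ω) (t : Fin N) : β :=
  if t.val < j then Y (u t) else if t.val = j then y else X (a t)

theorem mixed_update_right {N : ℕ} {Ω Ω' β : Type} (X : Ω → β) (Y : Ω' → β) (j : Fin N) (y : Ω)
    (u : Fin N → Ω') (a : Fin N → Ω) :
    mixed X Y j u (Function.update a j y) = mixedWith X Y j (X y) u a := by
  funext t
  unfold mixed mixedWith
  rcases lt_trichotomy t j with h | rfl | h
  · simp [h]
  · simp
  · have h' : t.val ≠ j.val := fun e => h.ne' (Fin.ext e)
    rw [Function.update_of_ne h.ne', if_neg (not_lt.2 (Fin.le_def.1 h.le)),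
      if_neg (not_lt.2 (Fin.le_def.1 h.le)), if_neg h']

theorem mixed_update_left {N : ℕ} {Ω Ω' β : Type} (X : Ω → β) (Y : Ω' → β) (j : Fin N) (y : Ω')
    (u : Fin N → Ω') (a : Fin N → Ω) :
    mixed X Y (j + 1) (Function.update u j y) a = mixedWith X Y j (Y y) u a := by
  funext t
  unfold mixed mixedWith
  rcases lt_trichotomy t j with h | rfl | h
  · have h' : t.val < j.val + 1 := Nat.lt_succ_of_lt h
    rw [Function.update_of_ne h.ne, if_pos h', if_pos (Fin.lt_def.1 h)]
  · simp
  · have h1 : ¬ t.val < j.val + 1 := not_lt.2 h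
    have h2 : ¬ t.val < j.val := not_lt.2 (Fin.le_def.1 h.le)
    have h' : t.val ≠ j.val := fun e => h.ne' (Fin.ext e)
    rw [if_neg h1, if_neg h2, if_neg h']

/-- The hybrid argument for a fixed value of the security parameter. -/
theorem prob_mixed_sub {N m : ℕ} (hN : N ≤ 2 ^ m) {Ω Ω' β W : Type} [Fintype Ω] [Fintype Ω']
    [Fintype W] [Nonempty Ω] [Nonempty Ω'] [Nonempty W] (X : Ω → β) (Y : Ω' → β)
    (T : (Fin N → β) → W → Prop) :
    prob (fun w : (Fin N → Ω) × W => T (fun t => X (w.1 t)) w.2) -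
        prob (fun w : (Fin N → Ω') × W => T (fun t => Y (w.1 t)) w.2) =
      2 ^ m * (prob (fun w : Ω × (((Fin N → Ω') × (Fin N → Ω) × W) × Bits m) =>
          ∃ j, ofDigits N w.2.2 = some j ∧
            T (mixedWith X Y j (X w.1) w.2.1.1 w.2.1.2.1) w.2.1.2.2) -
        prob (fun w : Ω' × (((Fin N → Ω') × (Fin N → Ω) × W) × Bits m) =>
          ∃ j, ofDigits N w.2.2 = some j ∧
            T (mixedWith X Y j (Y w.1) w.2.1.1 w.2.1.2.1) w.2.1.2.2)) := by
  have e1 := prob_ofDigits (Z := (Fin N → Ω') × (Fin N → Ω) × W) hN fun (y : Ω) z j =>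
    T (mixedWith X Y j (X y) z.1 z.2.1) z.2.2
  have e2 := prob_ofDigits (Z := (Fin N → Ω') × (Fin N → Ω) × W) hN fun (y : Ω') z j =>
    T (mixedWith X Y j (Y y) z.1 z.2.1) z.2.2
  rw [mul_sub, e1, e2, ← Finset.sum_sub_distrib]
  -- `h j` is the acceptance probability of the `j`-th hybrid. The left side is `h 0 - h N`, a
  -- telescoping sum; in each summand, putting the challenge sample at the place `j` is resampling
  -- one coordinate of the hybrid `j` or `j + 1`.
  set h : ℕ → ℝ := fun j => prob fun z : (Fin N → Ω') × (Fin N → Ω) × W =>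
    T (mixed X Y j z.1 z.2.1) z.2.2 with hh
  have h0 : prob (fun w : (Fin N → Ω) × W => T (fun t => X (w.1 t)) w.2) = h 0 :=
    (prob_snd (Ω' := Fin N → Ω') fun w : (Fin N → Ω) × W => T (fun t => X (w.1 t)) w.2).symm
  have hN' : prob (fun w : (Fin N → Ω') × W => T (fun t => Y (w.1 t)) w.2) = h N := by
    have hp : IsProjection fun z : (Fin N → Ω') × (Fin N → Ω) × W => (z.1, z.2.2) :=
      IsProjection.id.prod ⟨Fin N → Ω, inferInstance, inferInstance, Equiv.prodComm _ _,
        fun _ => rfl⟩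
    rw [← hp.prob_eq, hh]
    congr 1
    funext z
    have : mixed X Y N z.1 z.2.1 = fun t => Y (z.1 t) := funext fun t => if_pos t.isLt
    rw [this]
  rw [h0, hN', ← neg_sub (h N), ← Finset.sum_range_sub h N, ← Finset.sum_neg_distrib]
  refine Finset.sum_congr rfl fun j hj => ?_
  have hj' := Finset.mem_range.1 hj
  rw [neg_sub]
  congr 1
  · rw [hh]
    refine Eq.trans (Eq.symm (prob_update (fun z => z.2.1 ⟨j, hj'⟩)
      (fun y z => (z.1, Function.update z.2.1 ⟨j, hj'⟩ y, z.2.2)) (fun y z => ?_) (fun y z => ?_)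
      _)) ?_
    · simp
    · simp
    · congr 1
      funext w
      rw [mixed_update_right X Y ⟨j, hj'⟩]
  · rw [hh]
    refine Eq.trans (Eq.symm (prob_update (fun z => z.1 ⟨j, hj'⟩)
      (fun y z => (Function.update z.1 ⟨j, hj'⟩ y, z.2)) (fun y z => ?_) (fun y z => ?_)
      _)) ?_
    · simp
    · simp
    · congr 1
      funext w
      rw [mixed_update_left X Y ⟨j, hj'⟩]

end

/-- The number of binary digits. -/
def bitLength (n : ℕ) : ℕ := ((List.range (n + 1)).find? fun i => decide (n / 2 ^ i = 0)).getD 0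

/-- The first bound makes room for every index; the second keeps the loss of the hybrid argument
polynomial. -/
theorem bitLength_spec (n : ℕ) : n < 2 ^ bitLength n ∧ 2 ^ bitLength n ≤ 2 * n + 1 := by
  unfold bitLength
  cases h : (List.range (n + 1)).find? fun i => decide (n / 2 ^ i = 0) with
  | none =>
    have := List.find?_range_eq_none.1 h n (Nat.lt_succ_self n)
    simp [Nat.div_eq_of_lt (Nat.lt_two_pow_self (n := n))] at this
  | some i =>
    obtain ⟨h1, -, h2⟩ := List.find?_range_eq_some.1 h
    rw [Option.getD_some]
    have h3 : n < 2 ^ i := by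
      rw [decide_eq_true_eq, Nat.div_eq_zero_iff] at h1
      exact h1.resolve_left (by positivity)
    refine ⟨h3, ?_⟩
    cases i with
    | zero => omega
    | succ i =>
      have h4 := h2 i (Nat.lt_succ_self i)
      have h5 : 2 ^ i ≤ n := by
        by_contra h6
        rw [Nat.div_eq_of_lt (not_le.1 h6)] at h4
        simp at h4
      rw [pow_succ]
      omega

namespace Feasible

variable {α : ℕ → Type} [∀ κ, DataRep (α κ)]

theorem bitLength {n : ∀ κ, α κ → ℕ} (hn : Feasible n) :
    Feasible fun κ x => Ariadne.bitLength (n κ x) :=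
  .ogetD (.lfind? (p := fun κ x i => decide (n κ x / 2 ^ i = 0)) (.lrange (hn.add (.num 1)))
    (.deq (fun _ => rep_nat_injective) (.divTwoPow (hn.comp id.fst) id.snd) (.num 0))) (.num 0)

theorem ofDigits {m : ℕ → ℕ} {n : ∀ κ, α κ → ℕ} {x : ∀ κ, α κ → Bits (m κ)}
    (hm : Feasible fun κ (_ : Unit) => m κ) (hn : Feasible n) (hx : Feasible x) :
    Feasible fun κ y => Ariadne.ofDigits (n κ y) (x κ y) := by
  refine .lfind? (p := fun κ y j => decide (digits (m κ) j = x κ y)) (.lrange hn)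
    (.bits_eq ?_ (hx.comp id.fst))
  exact .lam (f := fun κ (y : α κ × ℕ) (i : Fin (m κ)) =>
      if y.2.testBit i then (1 : ZMod 2) else 0) hm
    (.cond (.testBit id.fst.snd id.snd.val) .zmod_one .zmod_zero)

end Feasible

/-- Indistinguishability of polynomially many independent samples. -/
theorem Indistinguishable.tuple {Ω Ω' α β W : ℕ → Type} [∀ κ, Fintype (Ω κ)]
    [∀ κ, Fintype (Ω' κ)] [∀ κ, Fintype (W κ)] [∀ κ, Nonempty (Ω κ)] [∀ κ, Nonempty (Ω' κ)]
    [∀ κ, Nonempty (W κ)] [∀ κ, Code (α κ)] [∀ κ, DataRep (β κ)] [∀ κ, DataRep (W κ)]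
    [∀ κ, DataRep (Ω κ)] [∀ κ, DataRep (Ω' κ)]
    {X : ∀ κ, Ω κ → α κ} {Y : ∀ κ, Ω' κ → α κ} (h : Indistinguishable X Y)
    {X' : ∀ κ, Ω κ → β κ} {Y' : ∀ κ, Ω' κ → β κ} (hX : ∀ κ w, rep (X' κ w) = Code.enc (X κ w))
    (hY : ∀ κ w, rep (Y' κ w) = Code.enc (Y κ w)) (fX : Feasible X') (fY : Feasible Y')
    (hΩ : Samplable Ω) (hΩ' : Samplable Ω') (hW : Samplable W) (N : Polynomial ℕ)
    {test : ∀ κ, (Fin (N.eval κ) → β κ) → W κ → Bool}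
    (ht : Feasible fun κ (y : (Fin (N.eval κ) → β κ) × W κ) => test κ y.1 y.2) :
    Negligible fun κ =>
      |prob (fun w : (Fin (N.eval κ) → Ω κ) × W κ => test κ (fun t => X' κ (w.1 t)) w.2 = true) -
        prob (fun w : (Fin (N.eval κ) → Ω' κ) × W κ =>
          test κ (fun t => Y' κ (w.1 t)) w.2 = true)| := by
  have hN : Feasible fun κ (_ : Unit) => N.eval κ := .evalPoly N
  have hm : Feasible fun κ (_ : Unit) => bitLength (N.eval κ) := hN.bitLength
  -- The distinguisher guesses a place `j` from random digits, puts the challenge sample there and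
  -- produces all other samples itself. Digits that name no place lead to rejection, equally for
  -- both kinds of challenge.
  have hfeas : Feasible fun κ (y : β κ × (((Fin (N.eval κ) → Ω' κ) × (Fin (N.eval κ) → Ω κ) ×
      W κ) × Bits (bitLength (N.eval κ)))) => (ofDigits (N.eval κ) y.2.2).elim false fun j =>
        test κ (mixedWith (X' κ) (Y' κ) j y.1 y.2.1.1 y.2.1.2.1) y.2.1.2.2 := by
    refine .oelim (.ofDigits hm (.evalPoly N) Feasible.id.snd.snd) .bfalse
      (ht.comp (.pair ?_ Feasible.id.fst.snd.fst.snd.snd))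
    refine .lam (f := fun κ (y : (β κ × (((Fin (N.eval κ) → Ω' κ) × (Fin (N.eval κ) → Ω κ) ×
      W κ) × Bits (bitLength (N.eval κ)))) × ℕ) =>
        mixedWith (X' κ) (Y' κ) y.2 y.1.1 y.1.2.1.1 y.1.2.1.2.1) (.evalPoly N) ?_
    exact .ite (.dlt Feasible.id.snd.val Feasible.id.fst.snd)
      (fY.comp (.app Feasible.id.fst.fst.snd.fst.fst Feasible.id.snd))
      (.ite (.deq (fun _ => Feasible.rep_nat_injective) Feasible.id.snd.val Feasible.id.fst.snd)
        Feasible.id.fst.fst.fst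
        (fX.comp (.app Feasible.id.fst.fst.snd.fst.snd.fst Feasible.id.snd)))
  have h1 := h.test (test := fun κ y z => (ofDigits (N.eval κ) z.2).elim false fun j =>
        test κ (mixedWith (X' κ) (Y' κ) j y z.1.1 z.1.2.1) z.1.2.2) hX hY
    (((Samplable.tuple hN hΩ').prod ((Samplable.tuple hN hΩ).prod hW)).prod (.bits hm)) hfeas
  -- The hybrid identity loses the factor `2 ^ bitLength (N.eval κ)`, which is at most `2 * N.eval κ
  -- + 1`.
  refine h1.of_abs_le_mul (2 * N + 1) fun κ => ?_
  have h2 := bitLength_spec (N.eval κ)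
  have h3 := prob_mixed_sub h2.1.le (X' κ) (Y' κ) fun y (w : W κ) => test κ y w = true
  have h4 : ∀ (o : Option ℕ) (f : ℕ → Bool), (o.elim false f = true) =
      ∃ j, o = some j ∧ f j = true := by
    intro o f; cases o <;> simp
  rw [h3]
  simp only [abs_abs, h4]
  rw [abs_mul]
  refine mul_le_mul_of_nonneg_right ?_ (abs_nonneg _)
  rw [abs_of_nonneg (by positivity)]
  simp only [Polynomial.eval_add, Polynomial.eval_mul, Polynomial.eval_ofNat, Polynomial.eval_one]
  exact_mod_cast h2.2

/-! ## Unlinkability -/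

set_option synthInstance.maxSize 1000
set_option synthInstance.maxHeartbeats 200000

instance {κ : ℕ} {S : Sizes} (A : Adversary) (P : Scheme κ S) (nj : Addr S)
    (L : List (Stream κ S × Key κ)) (b : Bool) (w₁ w₂ : PacketCoins κ S)
    (r : Bits (A.coins.eval κ)) : Decidable (A.WinsWith P nj L b w₁ w₂ r) := by
  unfold Adversary.WinsWith; infer_instance

/-- The random choices besides the key material of the honest node: the bit, the coins of the two
packets, and those of the adversary. -/
abbrev SeedChoices (κ : ℕ) (S : Sizes) (c : ℕ) : Type :=
  Bool × (Bits S.seed × Header κ S) × (Bits S.seed × Header κ S) × Bits c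

/-- The adversary wins the game with a table of key material and pseudo-random slots. -/
def Adversary.WinsSeeds {κ N : ℕ} {S : Sizes} (A : Adversary) (P : Scheme κ S) (nj : Addr S)
    (tab : Fin N → Stream κ S × Key κ) (w : SeedChoices κ S (A.coins.eval κ)) : Prop :=
  A.WinsWith P nj ((List.ofFn tab).take S.table) w.1 (P.perm w.2.1.1, w.2.1.2)
    (P.perm w.2.2.1.1, w.2.2.1.2) w.2.2.2

instance {κ N : ℕ} {S : Sizes} (A : Adversary) (P : Scheme κ S) (nj : Addr S)
    (tab : Fin N → Stream κ S × Key κ) (w : SeedChoices κ S (A.coins.eval κ)) :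
    Decidable (A.WinsSeeds P nj tab w) := by
  unfold Adversary.WinsSeeds; infer_instance

theorem take_ofFn_eq_map_range {N T : ℕ} {X : Type} (f : ℕ → X) (h : T ≤ N) :
    (List.ofFn fun t : Fin N => f t).take T = (List.range T).map f := by
  refine List.ext_getElem (by simp [h]) fun i h1 h2 => ?_
  simp

/-- An exact rewriting of the game. The table has `N` entries and is cut down to the `S.table`
entries that the node uses. -/
theorem Adversary.wins_iff_winsSeeds {κ N : ℕ} {S : Sizes} (hN : S.table ≤ N) (A : Adversary)
    (P : Scheme κ S) (nj : Addr S) (w : ChallengerCoins κ S) (r : Bits (A.coins.eval κ)) :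
    A.Wins P nj w r ↔ A.WinsSeeds P nj (fun t : Fin N => P.derive w.1 t)
      (w.2.1, w.2.2.1, w.2.2.2, r) := by
  unfold Adversary.WinsSeeds Adversary.WinsWith
  rw [A.wins_iff, ← P.pick_eq_nodeStep, take_ofFn_eq_map_range _ hN]
  have : P.answer nj w = P.respond nj ((List.range S.table).map (P.derive w.1)) w.2.1
      (P.perm w.2.2.1.1, w.2.2.1.2) (P.perm w.2.2.2.1, w.2.2.2.2) :=
    P.answer_eq_respond nj w
  rw [this]

/-! ### The three game hops and the conclusion -/

section

variable {S : ℕ → Sizes} {P : ∀ κ, Scheme κ (S κ)} {nj : ∀ κ, Addr (S κ)} (A : Adversary)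

namespace Efficient

theorem samplable_relem (E : Efficient S P) : Samplable fun κ => RElem κ (S κ) :=
  (Samplable.bits E.f_pat).prod ((Samplable.bits E.f_addr).prod ((Samplable.bits E.f_ptr).prod
    (.bits .kappa)))

theorem samplable_header (E : Efficient S P) : Samplable fun κ => Header κ (S κ) :=
  .tuple E.f_slots E.samplable_relem

theorem samplable_stream (E : Efficient S P) : Samplable fun κ => Stream κ (S κ) :=
  E.samplable_relem.prod (E.samplable_header.prod (.bits E.f_pay))

theorem samplable_seedChoices (E : Efficient S P) :
    Samplable fun κ => SeedChoices κ (S κ) (A.coins.eval κ) :=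
  Samplable.bool.prod (((Samplable.bits E.f_seed).prod E.samplable_header).prod
    (((Samplable.bits E.f_seed).prod E.samplable_header).prod (.bits (.evalPoly A.coins))))

variable {α : ℕ → Type} [∀ κ, DataRep (α κ)] {A}

theorem f_winsWith (E : Efficient S P) (hN : Feasible fun κ (_ : Unit) => nj κ)
    {L : ∀ κ, α κ → List (Stream κ (S κ) × Key κ)} {b : ∀ κ, α κ → Bool}
    {w₁ w₂ : ∀ κ, α κ → PacketCoins κ (S κ)} {r : ∀ κ, α κ → Bits (A.coins.eval κ)}
    (hL : Feasible L) (hb : Feasible b) (h₁ : Feasible w₁) (h₂ : Feasible w₂) (hr : Feasible r) :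
    Feasible fun κ x =>
      decide (A.WinsWith (P κ) (nj κ) (L κ x) (b κ x) (w₁ κ x) (w₂ κ x) (r κ x)) := by
  have ho := E.f_output (A := A) hN hr
    (step := fun κ x => (P κ).pick (L κ x))
    (ans := fun κ x => (P κ).respond (nj κ) (L κ x) (b κ x) (w₁ κ x) (w₂ κ x))
    (E.f_pick.comp ((hL.comp Feasible.id.fst).pair Feasible.id.snd))
    (E.f_respond hN (hL.comp Feasible.id.fst) (hb.comp Feasible.id.fst) (h₁.comp Feasible.id.fst)
      (h₂.comp Feasible.id.fst) Feasible.id.snd)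
  have hn : Feasible fun κ x => decide (A.output (nj κ) (r κ x) ((P κ).pick (L κ x))
      ((P κ).respond (nj κ) (L κ x) (b κ x) (w₁ κ x) (w₂ κ x)) = .nil) :=
    .deq (fun _ => Function.injective_id) ho (.const .nil fun _ _ => rfl)
  refine (hn.cond (hb.cond .bfalse .btrue) hb).congr fun κ x => ?_
  unfold Adversary.WinsWith
  by_cases hd : A.output (nj κ) (r κ x) ((P κ).pick (L κ x))
    ((P κ).respond (nj κ) (L κ x) (b κ x) (w₁ κ x) (w₂ κ x)) = .nil <;>
  cases hbx : b κ x <;> simp [hbx] at *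

theorem f_winsSeeds (E : Efficient S P) (hN : Feasible fun κ (_ : Unit) => nj κ) {n : ℕ → ℕ}
    {tab : ∀ κ, α κ → Fin (n κ) → Stream κ (S κ) × Key κ}
    {w : ∀ κ, α κ → SeedChoices κ (S κ) (A.coins.eval κ)} (ht : Feasible tab) (hw : Feasible w) :
    Feasible fun κ x => decide (A.WinsSeeds (P κ) (nj κ) (tab κ x) (w κ x)) :=
  E.f_winsWith hN (.ltake E.f_table.param ht.toList) hw.fst
    ((E.f_perm.comp hw.snd.fst.fst).pair hw.snd.fst.snd)
    ((E.f_perm.comp hw.snd.snd.fst.fst).pair hw.snd.snd.fst.snd) hw.snd.snd.snd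

end Efficient

/-- Replacing the temporary keys of the honest node by random ones. -/
theorem Adversary.negligible_of_kdf (E : Efficient S P)
    (hN : Feasible fun κ (_ : Unit) => nj κ) (N : Polynomial ℕ) (hKdf : SecureKeyDerivation S P) : Negligible fun κ =>
    |prob (fun w : Key κ × SeedChoices κ (S κ) (A.coins.eval κ) =>
        A.WinsSeeds (P κ) (nj κ) (fun t : Fin (N.eval κ) => (P κ).derive w.1 t) w.2) -
      prob (fun w : (Fin (N.eval κ) → Key κ × Key κ) × SeedChoices κ (S κ) (A.coins.eval κ) =>
        A.WinsSeeds (P κ) (nj κ) (fun t => ((P κ).prg (w.1 t).1, (w.1 t).2)) w.2)| := by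
  have h := (hKdf N).test (β := fun κ => Fin (N.eval κ) → Key κ × Key κ)
    (X' := fun κ (k : Key κ) t => (P κ).kdf k t) (Y' := fun κ y => y)
    (W := fun κ => SeedChoices κ (S κ) (A.coins.eval κ))
    (test := fun κ y w => decide (A.WinsSeeds (P κ) (nj κ)
      (fun t => ((P κ).prg (y t).1, (y t).2)) w))
    (fun _ _ => rfl) (fun _ _ => rfl) (E.samplable_seedChoices A) ?_
  · simp only [decide_eq_true_eq] at h
    exact h
  · have h1 := Feasible.app (α := fun κ => ((Fin (N.eval κ) → Key κ × Key κ) ×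
      SeedChoices κ (S κ) (A.coins.eval κ)) × Fin (N.eval κ)) Feasible.id.fst.fst Feasible.id.snd
    exact E.f_winsSeeds hN (.lam (.evalPoly N) ((E.f_prg.comp h1.fst).pair h1.snd)) Feasible.id.snd

/-- Replacing the output of the generator by random strings. -/
theorem Adversary.negligible_of_prg (E : Efficient S P)
    (hN : Feasible fun κ (_ : Unit) => nj κ) (N : Polynomial ℕ) (hPrg : PseudorandomGenerator S P) : Negligible fun κ =>
    |prob (fun w : (Fin (N.eval κ) → Key κ × Key κ) × SeedChoices κ (S κ) (A.coins.eval κ) =>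
        A.WinsSeeds (P κ) (nj κ) (fun t => ((P κ).prg (w.1 t).1, (w.1 t).2)) w.2) -
      prob (fun w : (Fin (N.eval κ) → Stream κ (S κ)) × (Fin (N.eval κ) → Key κ) ×
          SeedChoices κ (S κ) (A.coins.eval κ) =>
        A.WinsSeeds (P κ) (nj κ) (fun t => (w.1 t, w.2.1 t)) w.2.2)| := by
  have h := Indistinguishable.tuple hPrg (X' := fun κ (k : Key κ) => (P κ).prg k)
    (Y' := fun κ y => y)
    (W := fun κ => (Fin (N.eval κ) → Key κ) × SeedChoices κ (S κ) (A.coins.eval κ))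
    (fun _ _ => rfl) (fun _ _ => rfl) E.f_prg .id (.bits .kappa) E.samplable_stream
    ((Samplable.tuple (.evalPoly N) (.bits .kappa)).prod (E.samplable_seedChoices A)) N
    (test := fun κ y w => decide (A.WinsSeeds (P κ) (nj κ) (fun t => (y t, w.1 t)) w.2)) ?_
  · simp only [decide_eq_true_eq] at h
    convert h using 4 with κ
    -- The random pairs are regrouped: encryption keys become the samples of the hybrid argument,
    -- and MAC keys join the additional randomness.
    exact prob_equiv (((Equiv.arrowProdEquivProdArrow _ _ _).prodCongr (Equiv.refl _)).trans
      (Equiv.prodAssoc _ _ _)) fun w : (Fin (N.eval κ) → Key κ) × (Fin (N.eval κ) → Key κ) ×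
          SeedChoices κ (S κ) (A.coins.eval κ) =>
        A.WinsSeeds (P κ) (nj κ) (fun t => ((P κ).prg (w.1 t), w.2.1 t)) w.2.2
  · exact E.f_winsSeeds hN (.lam (f := fun κ (x : (Fin (N.eval κ) → Stream κ (S κ)) ×
      (Fin (N.eval κ) → Key κ) × SeedChoices κ (S κ) (A.coins.eval κ)) t => (x.1 t, x.2.1 t))
      (.evalPoly N) ((Feasible.app Feasible.id.fst.fst Feasible.id.snd).pair
        (.app Feasible.id.fst.snd.fst Feasible.id.snd))) Feasible.id.snd.snd

/-- The random choices besides the slots of the second packet. -/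
abbrev SlotChoices (κ : ℕ) (S : Sizes) (N c : ℕ) : Type :=
  (Fin N → Stream κ S) × (Fin N → Key κ) × Bool × (Bits S.seed × Header κ S) × Header κ S × Bits c

/-- The adversary wins the game with given slots of the second packet. -/
def Adversary.WinsSlots {κ N : ℕ} {S : Sizes} (A : Adversary) (P : Scheme κ S) (nj : Addr S)
    (σ : Fin S.slots → Fin S.slots) (w : SlotChoices κ S N (A.coins.eval κ)) : Prop :=
  A.WinsWith P nj ((List.ofFn fun t => (w.1 t, w.2.1 t)).take S.table) w.2.2.1
    (P.perm w.2.2.2.1.1, w.2.2.2.1.2) (σ, w.2.2.2.2.1) w.2.2.2.2.2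

instance {κ N : ℕ} {S : Sizes} (A : Adversary) (P : Scheme κ S) (nj : Addr S)
    (σ : Fin S.slots → Fin S.slots) (w : SlotChoices κ S N (A.coins.eval κ)) :
    Decidable (A.WinsSlots P nj σ w) := by
  unfold Adversary.WinsSlots; infer_instance

theorem Adversary.prob_winsSeeds_eq {κ N : ℕ} {S : Sizes} (A : Adversary) (P : Scheme κ S)
    (nj : Addr S) :
    prob (fun w : (Fin N → Stream κ S) × (Fin N → Key κ) × SeedChoices κ S (A.coins.eval κ) =>
        A.WinsSeeds P nj (fun t => (w.1 t, w.2.1 t)) w.2.2) =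
      prob fun w : Bits S.seed × SlotChoices κ S N (A.coins.eval κ) =>
        A.WinsSlots P nj (P.perm w.1) w.2 := by
  let e : (Fin N → Stream κ S) × (Fin N → Key κ) × SeedChoices κ S (A.coins.eval κ) ≃
      Bits S.seed × SlotChoices κ S N (A.coins.eval κ) :=
    ⟨fun w => (w.2.2.2.2.1.1, w.1, w.2.1, w.2.2.1, w.2.2.2.1, w.2.2.2.2.1.2, w.2.2.2.2.2),
      fun w => (w.2.1, w.2.2.1, w.2.2.2.1, w.2.2.2.2.1, (w.1, w.2.2.2.2.2.1), w.2.2.2.2.2.2),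
      fun _ => rfl, fun _ => rfl⟩
  rw [← prob_equiv e]
  rfl

theorem Adversary.prob_winsWith_eq {κ N : ℕ} {S : Sizes} (A : Adversary) (P : Scheme κ S)
    (nj : Addr S) :
    prob (fun w : (Fin N → Stream κ S × Key κ) × Choices κ S (A.coins.eval κ) =>
        A.WinsWith P nj ((List.ofFn w.1).take S.table) w.2.1 (P.firstCoins w.2)
          (Choices.secondCoins w.2) w.2.2.2.2) =
      prob fun w : Equiv.Perm (Fin S.slots) × SlotChoices κ S N (A.coins.eval κ) =>
        A.WinsSlots P nj w.1 w.2 := by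
  let e : (Fin N → Stream κ S × Key κ) × Choices κ S (A.coins.eval κ) ≃
      Equiv.Perm (Fin S.slots) × SlotChoices κ S N (A.coins.eval κ) :=
    ⟨fun w => (w.2.2.2.1.1, fun t => (w.1 t).1, fun t => (w.1 t).2, w.2.1, w.2.2.1,
        w.2.2.2.1.2, w.2.2.2.2),
      fun w => (fun t => (w.2.1 t, w.2.2.1 t), w.2.2.2.1, w.2.2.2.2.1, (w.1, w.2.2.2.2.2.1),
        w.2.2.2.2.2.2), fun _ => rfl, fun _ => rfl⟩
  rw [← prob_equiv e]
  rfl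

/-- Replacing the slots of the second packet by random ones. -/
theorem Adversary.negligible_of_slots (E : Efficient S P)
    (hN : Feasible fun κ (_ : Unit) => nj κ) (N : Polynomial ℕ) (hSlots : PseudorandomSlots S P) : Negligible fun κ =>
    |prob (fun w : (Fin (N.eval κ) → Stream κ (S κ)) × (Fin (N.eval κ) → Key κ) ×
          SeedChoices κ (S κ) (A.coins.eval κ) =>
        A.WinsSeeds (P κ) (nj κ) (fun t => (w.1 t, w.2.1 t)) w.2.2) -
      prob (fun w : (Fin (N.eval κ) → Stream κ (S κ) × Key κ) ×
          Choices κ (S κ) (A.coins.eval κ) =>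
        A.WinsWith (P κ) (nj κ) ((List.ofFn w.1).take (S κ).table) w.2.1 ((P κ).firstCoins w.2)
          (Choices.secondCoins w.2) w.2.2.2.2)| := by
  -- `SlotChoices` contains no permutation, so all of it can be sampled exactly from random bits;
  -- the permutation enters only as the challenge. Since the first packet keeps its seed and this
  -- hop comes last, no reduction ever has to sample a random permutation.
  have h := Indistinguishable.test hSlots (β := fun κ => Fin (S κ).slots → Fin (S κ).slots)
    (X' := fun κ s => (P κ).perm s) (Y' := fun κ σ => σ)
    (W := fun κ => SlotChoices κ (S κ) (N.eval κ) (A.coins.eval κ))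
    (fun _ _ => rfl) (fun _ _ => rfl)
    ((Samplable.tuple (.evalPoly N) E.samplable_stream).prod
      ((Samplable.tuple (.evalPoly N) (.bits .kappa)).prod (Samplable.bool.prod
        (((Samplable.bits E.f_seed).prod E.samplable_header).prod
          (E.samplable_header.prod (.bits (.evalPoly A.coins)))))))
    (test := fun κ σ w => decide (A.WinsSlots (P κ) (nj κ) σ w)) ?_
  · simp only [decide_eq_true_eq] at h
    simpa only [A.prob_winsSeeds_eq, A.prob_winsWith_eq] using h
  · have h2 := Feasible.id (α := fun κ => (Fin (S κ).slots → Fin (S κ).slots) ×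
      SlotChoices κ (S κ) (N.eval κ) (A.coins.eval κ))
    have h3 : Feasible fun κ (x : (Fin (S κ).slots → Fin (S κ).slots) ×
        SlotChoices κ (S κ) (N.eval κ) (A.coins.eval κ)) => fun t => (x.2.1 t, x.2.2.1 t) :=
      .lam (.evalPoly N) ((Feasible.app Feasible.id.fst.snd.fst Feasible.id.snd).pair
        (.app Feasible.id.fst.snd.snd.fst Feasible.id.snd))
    exact E.f_winsWith hN (.ltake E.f_table.param h3.toList) h2.snd.snd.snd.fst
      ((E.f_perm.comp h2.snd.snd.snd.snd.fst.fst).pair h2.snd.snd.snd.snd.fst.snd)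
      (h2.fst.pair h2.snd.snd.snd.snd.snd.fst) h2.snd.snd.snd.snd.snd.snd

theorem pathSessionUnlinkable (E : Efficient S P)
    (hN : Feasible fun κ (_ : Unit) => nj κ) (hPrg : PseudorandomGenerator S P)
    (hKdf : SecureKeyDerivation S P) (hSlots : PseudorandomSlots S P) :
    PathSessionUnlinkable S P nj := by
  intro A
  -- Key derivation and the hybrid argument are formulated for polynomial lengths, so the table is
  -- extended to a polynomial bound `N` of its true length.
  obtain ⟨N, hT⟩ := PolySize.exists_le E.f_table
  have h1 := A.negligible_of_kdf E hN N hKdf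
  have h2 := A.negligible_of_prg E hN N hPrg
  have h3 := A.negligible_of_slots E hN N hSlots
  have h4 : Negligible fun κ => (((A.queries₁.eval κ + A.queries₂.eval κ + 2) * N.eval κ : ℕ) : ℝ) *
      (1 / 2 ^ κ) :=
    negligible_two_pow.of_abs_le_mul ((A.queries₁ + A.queries₂ + 2) * N) fun κ => by
      rw [abs_mul, Nat.abs_cast]
      simp
  refine Negligible.of_abs_le (((h1.add h2).add h3).add h4) fun κ => ?_
  have h5 := A.abs_prob_winsWith_sub_half_le (P κ) (nj κ) (hT κ)
  have h6 : prob (fun w : ChallengerCoins κ (S κ) × Bits (A.coins.eval κ) =>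
      A.Wins (P κ) (nj κ) w.1 w.2) =
      prob (fun w : Key κ × SeedChoices κ (S κ) (A.coins.eval κ) =>
        A.WinsSeeds (P κ) (nj κ) (fun t : Fin (N.eval κ) => (P κ).derive w.1 t) w.2) := by
    -- Only the bracketing of the coins changes here.
    rw [← prob_equiv (Ω := ChallengerCoins κ (S κ) × Bits (A.coins.eval κ))
      ⟨fun w => (w.1.1, w.1.2.1, w.1.2.2.1, w.1.2.2.2, w.2),
        fun w => ((w.1, w.2.1, w.2.2.1, w.2.2.2.1), w.2.2.2.2), fun _ => rfl, fun _ => rfl⟩]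
    congr 1
    funext w
    exact propext (A.wins_iff_winsSeeds (hT κ) (P κ) (nj κ) w.1 w.2)
  rw [h6]
  refine le_trans ?_ (le_abs_self _)
  rw [abs_abs]
  refine (abs_sub_le _ _ _).trans (add_le_add ?_ h5)
  refine (abs_sub_le _ _ _).trans (add_le_add ?_ le_rfl)
  exact abs_sub_le _ _ _

end

end Ariadne

/-- If the algorithms of Ariadne are efficient, `ρ` is a pseudo-random generator, `δ` a secure key
derivation function and the slot permutation pseudo-random, then Ariadne achieves path-session
unlinkability against adversaries that hold the master keys of all nodes but the honest one. -/
theorem theorem2 (S : ℕ → Ariadne.Sizes) (P : ∀ κ, Ariadne.Scheme κ (S κ))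
    (nj : ∀ κ, Ariadne.Addr (S κ))
    (hEfficient : Ariadne.Efficient S P)
    (hName : Ariadne.PolyTimeFamily fun κ (_ : Unit) => nj κ)
    (hPrg : Ariadne.PseudorandomGenerator S P)
    (hKdf : Ariadne.SecureKeyDerivation S P)
    (hSlots : Ariadne.PseudorandomSlots S P) :
    Ariadne.PathSessionUnlinkable S P nj :=
  Ariadne.pathSessionUnlinkable hEfficient hName hPrg hKdf hSlots
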